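/- Let $d\ge 1$ be an integer, let $0<\sigma<1$, let $$p\in\Bigl(2-\frac{2\sigma}{2d+d\sigma+2\sigma},\;2+\frac2d\Bigr),\qquad q:=\frac{2p(d\sigma+d+\sigma)}{d(p\sigma+2)},\qquad p':=\frac{p}{p-1}.$$ For $\varphi\in C_c^\infty(\mathbb R^{1+2d})$, a function of $(t,x,v)\in\mathbb R\times\mathbb R^d\times\mathbb R^d$, let $D_v^\sigma\varphi=(-\Delta_v)^{\sigma/2}\varphi$ be the Fourier multiplier $|\xi|^\sigma$ acting in the variable $v$; for $u\in L^r(\mathbb R^{1+2d})$ with $1\le r\le\infty$ let $D_v^\sigma u$ be the distribution $\varphi\mapsto\int u\,D_v^\sigma\varphi\,\mathrm d(t,x,v)$. Then there is a constant $C=C(d,p,\sigma)>0$ such that the following holds. Let $f\in L^p(\mathbb R^{1+2d})$ be real-valued and of class $C^1$ with $D_v^\sigma f\in L^p(\mathbb R^{1+2d})$, and suppose that $$(\partial_t+v\cdot\nabla_x)f=D_v^\sigma S$$ in the sense of distributions on $\mathbb R^{1+2d}$ for some real-valued $S\in L^{p'}(\mathbb R^{1+2d})$. Then $f\in L^q(\mathbb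 R^{1+2d})$ and $$\|f\|_{L^q(\mathbb R^{1+2d})}\le C\,\|D_v^\sigma f\|_{L^p(\mathbb R^{1+2d})}^{\frac{d\sigma+2d+\sigma}{2(d\sigma+d+\sigma)}}\;\|S\|_{L^{p'}(\mathbb R^{1+2d})}^{\frac{\sigma(d+1)}{2(d\sigma+d+\sigma)}}.$$ -/

import Mathlib

open scoped FourierTransform ContDiff

namespace KineticBessel

/-- Euclidean `d`-space, used both for the position `x` and for the velocity `v`. -/
abbrev Space (d : ℕ) : Type := EuclideanSpace ℝ (Fin d)

/-- The space `ℝ^{1+2d}` of triples `z = (t, x, v)`, with its Lebesgue measure `volume`.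
Coordinates: `t = z.1`, `x = z.2.1`, `v = z.2.2`. -/
abbrev Phase (d : ℕ) : Type := ℝ × Space d × Space d

/-- Test functions: `φ ∈ C_c^∞(ℝ^{1+2d}; ℝ)`. -/
def IsTest {d : ℕ} (φ : Phase d → ℝ) : Prop :=
  ContDiff ℝ ∞ φ ∧ HasCompactSupport φ

/-- The Fourier multiplier `|ξ|^σ` on functions of `v ∈ ℝ^d`, i.e. `(-Δ)^{σ/2}`. Mathlib's Fourier
transform has the phase `exp (-2 π i ⟨v, ξ⟩)`, so the frequency variable of the convention
`exp (-i ⟨v, ξ⟩)` is `2 π ξ` here. -/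
noncomputable def rieszDeriv {d : ℕ} (σ : ℝ) (u : Space d → ℂ) : Space d → ℂ :=
  𝓕⁻ (fun ξ : Space d => (((2 * Real.pi * ‖ξ‖) ^ σ : ℝ) : ℂ) * 𝓕 u ξ)

/-- `D_v^σ φ` for a test function `φ`: the multiplier `|ξ|^σ` acting in the velocity variable, with
`(t, x)` as parameters. For real `φ` the value of `rieszDeriv` is real (`rieszDeriv_ofReal_im`
below), so that taking the real part loses nothing. -/
noncomputable def velDeriv {d : ℕ} (σ : ℝ) (φ : Phase d → ℝ) : Phase d → ℝ :=
  fun z => (rieszDeriv σ (fun w : Space d => (φ (z.1, z.2.1, w) : ℂ)) z.2.2).re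

/-- The free transport operator `(∂_t + v · ∇_x) φ`: at `z = (t, x, v)` this is the derivative of
`φ` in the direction `(1, v, 0)`. -/
noncomputable def transport {d : ℕ} (φ : Phase d → ℝ) : Phase d → ℝ :=
  fun z => fderiv ℝ φ z (1, z.2.2, 0)

/-- `D_v^σ f = g` in the sense of distributions on `ℝ^{1+2d}` (the multiplier `|ξ|^σ` is real and
even, hence `D_v^σ` is symmetric). The right-hand integral converges absolutely for `f` in any `L^p`,
`1 ≤ p ≤ ∞`, because `D_v^σ φ` is bounded by a constant times `(1 + |v|)^{-d-σ}` and vanishes for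
`(t, x)` outside a compact set. -/
def HasVelDeriv {d : ℕ} (σ : ℝ) (f g : Phase d → ℝ) : Prop :=
  ∀ φ : Phase d → ℝ, IsTest φ → ∫ z, g z * φ z = ∫ z, f z * velDeriv σ φ z

/-- `(∂_t + v · ∇_x) f = D_v^σ S` in the sense of distributions on `ℝ^{1+2d}`. -/
def SolvesKinetic {d : ℕ} (σ : ℝ) (f S : Phase d → ℝ) : Prop :=
  ∀ φ : Phase d → ℝ, IsTest φ → -∫ z, f z * transport φ z = ∫ z, S z * velDeriv σ φ z

theorem rieszDeriv_ofReal_im {d : ℕ} (σ : ℝ) (u : Space d → ℝ) (v : Space d) :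
    (rieszDeriv σ (fun w => (u w : ℂ)) v).im = 0 := by
  have hF : ∀ ξ : Space d, (starRingEnd ℂ) (𝓕 (fun w => (u w : ℂ)) ξ)
      = 𝓕 (fun w => (u w : ℂ)) (-ξ) := by
    intro ξ
    rw [Real.fourier_eq', Real.fourier_eq', ← integral_conj]
    congr 1
    ext w
    simp [← Complex.exp_conj, Complex.conj_ofNat]
  rw [← Complex.conj_eq_iff_im]
  unfold rieszDeriv
  rw [Real.fourierInv_eq', ← integral_conj, ← MeasureTheory.integral_neg_eq_self]
  congr 1
  ext ξ
  simp [← Complex.exp_conj, Complex.conj_ofNat, hF]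

end KineticBessel

open MeasureTheory Set
open scoped ENNReal

/-! By duality it suffices to bound `∫ f ψ` by the `L^m` norm of a test function `ψ`, where `m` is
conjugate to `q`. The bound comes from a representation of `∫ f ψ` along random kinetic
trajectories.

Let a point follow free transport during time `s` and then be displaced by a random `X_s` in
position and velocity. Put `F(s) = E ∫ f(z) ψ(flow s X_s z) dz` (`gaussAverage`), so that `F(0+) = ∫
f ψ`. The displacement is built from two independent Gaussians `h`, `n` on `ℝ^d`. Read at the
starting point it is a velocity kick `β h + α n` and a position kick `-μ n`, with `β = κ s^e`, `α =
(e+1) β / ν`, `μ = κ s^(e+1) / ν`. If `ν² = e(e+1)`, the cross terms in the evolution of the density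
of `X_s` cancel, and its `s`-derivative is a multiple of the Laplacian of the Gaussian in `h` alone
(`hasDerivAt_density`). Since `h` moves only the starting velocity, an average over `h` can exchange
velocity derivatives with its kernel.

Consequently `F'` is a sum of two terms. In the transport term the equation produces `S` paired with
`D_v^σ` of the transported `ψ`, and the average absorbs this derivative at the price `β^(-σ)`, with
kernel `K₁ = D^σ gauss`. In the density term the Laplacian is split as `D^σ D^(2-σ)`; the factor
`D^σ` passes to `f` and gives `g = D_v^σ f`, with prefactor `β^σ / s` and kernel `K₂ = D^(2-σ)
gauss`. Both kernels are bounded and integrable (`exists_kernel`).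

Each term is estimated by Young's inequality in `(x, v)`, which yields a negative power of `βμ`, and
then by the one-sided Hardy–Littlewood–Sobolev inequality in time
(`exists_lintegral_flow_average_le`). With `δ = 1/p - 1/q` and `δ' = 1/p' - 1/q`, the powers of `s`
are critical when `eσ = (d(2e+1)+1) δ` and `eσ + (d(2e+1)+1) δ' = 1`. The value of `q` makes the two
equations compatible, and the interval for `p` expresses `δ, δ' > 0`.

The same estimate applied to `f` shows that `F` cannot stay away from zero as `s → ∞`. Hence `|∫ f
ψ|` is at most a constant times `(κ^(-A) ‖S‖ + κ^B ‖g‖) ‖ψ‖_m` for every `κ > 0`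
(`exists_enorm_integral_mul_le`). The converse of Hölder's inequality and optimisation in `κ`
conclude. -/

namespace KineticBessel

/-! ### One-sided Hardy–Littlewood–Sobolev inequality on the line, by level sets. -/

section FractionalIntegral

lemma lintegral_layer (x : ℝ≥0∞) :
    ∫⁻ α in Ioi (0 : ℝ), {α : ℝ | ENNReal.ofReal α < x}.indicator 1 α = x := by
  have hm : MeasurableSet {α : ℝ | ENNReal.ofReal α < x} :=
    measurableSet_lt ENNReal.measurable_ofReal measurable_const
  rw [lintegral_indicator_one hm, Measure.restrict_apply hm]
  rcases eq_or_ne x ⊤ with rfl | hx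
  · simp
  · have : {α : ℝ | ENNReal.ofReal α < x} ∩ Ioi 0 = Ioo 0 x.toReal := by
      ext α
      simp only [mem_inter_iff, mem_ofPred_eq, mem_Ioi, mem_Ioo]
      constructor
      · rintro ⟨h1, h2⟩
        exact ⟨h2, (ENNReal.ofReal_lt_iff_lt_toReal h2.le hx).1 h1⟩
      · rintro ⟨h1, h2⟩
        exact ⟨(ENNReal.ofReal_lt_iff_lt_toReal h1.le hx).2 h2, h1⟩
    rw [this]
    simp [hx]

lemma lintegral_Ioc_rpow {γ X : ℝ} (hγ : 0 < γ) (hX : 0 ≤ X) :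
    ∫⁻ α in Ioc (0 : ℝ) X, ENNReal.ofReal (α ^ (γ - 1)) = ENNReal.ofReal (X ^ γ / γ) := by
  rw [← ofReal_integral_eq_lintegral_ofReal]
  · rw [← intervalIntegral.integral_of_le hX, integral_rpow (Or.inl (by linarith))]
    simp [Real.zero_rpow hγ.ne']
  · exact (intervalIntegrable_iff_integrableOn_Ioc_of_le hX).1
      (intervalIntegral.intervalIntegrable_rpow' (by linarith))
  · filter_upwards [ae_restrict_mem measurableSet_Ioc] with α hα
    exact Real.rpow_nonneg hα.1.le _

lemma lintegral_layer_rpow {p : ℝ} (hp : 1 ≤ p) (x : ℝ≥0∞) :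
    ∫⁻ α in Ioi (0 : ℝ), ENNReal.ofReal (α ^ (p - 1)) *
      {α : ℝ | ENNReal.ofReal α < x}.indicator 1 α ≤ x ^ p := by
  have hp0 : 0 < p := by linarith
  rcases eq_or_ne x ⊤ with rfl | hx
  · simp [ENNReal.top_rpow_of_pos hp0]
  · calc _ ≤ ∫⁻ α in Ioi (0 : ℝ), (Ioc 0 x.toReal).indicator
            (fun α => ENNReal.ofReal (α ^ (p - 1))) α := by
          refine setLIntegral_mono' measurableSet_Ioi fun α hα => ?_
          by_cases h : ENNReal.ofReal α < x
          · have h' : α ∈ Ioc 0 x.toReal :=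
              ⟨hα, ((ENNReal.ofReal_lt_iff_lt_toReal (le_of_lt hα) hx).1 h).le⟩
            simp [indicator_of_mem h', h]
          · simp [h]
      _ = ∫⁻ α in Ioc 0 x.toReal, ENNReal.ofReal (α ^ (p - 1)) := by
          rw [lintegral_indicator measurableSet_Ioc, Measure.restrict_restrict measurableSet_Ioc,
            inter_eq_left.2 (fun y hy => hy.1)]
      _ ≤ _ := by
          rw [lintegral_Ioc_rpow hp0 ENNReal.toReal_nonneg]
          calc _ ≤ ENNReal.ofReal (x.toReal ^ p) := by
                apply ENNReal.ofReal_le_ofReal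
                exact div_le_self (Real.rpow_nonneg ENNReal.toReal_nonneg _) hp
            _ = x ^ p := by
                rw [← ENNReal.ofReal_rpow_of_nonneg ENNReal.toReal_nonneg hp0.le,
                  ENNReal.ofReal_toReal hx]

/-- Hölder's inequality with exponents `1/δ` and `1/(1-δ)`, after inserting the weight controlled by
`hW`. The remaining power of `β` is integrable at `0` because `m δ < 1`. In the application `w` is
the distribution function of an `L^m` function. -/
lemma lintegral_Ioc_level_rpow_le {m δ : ℝ} (hδ : 0 < δ) (hδ1 : δ < 1)
    (hmδ : m * δ < 1) {w : ℝ → ℝ≥0∞} (hw : Measurable w)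
    (hW : ∫⁻ β in Ioi (0 : ℝ), ENNReal.ofReal (β ^ (m - 1)) * w β ≤ 1) {X : ℝ} (hX : 0 < X) :
    ∫⁻ β in Ioc (0 : ℝ) X, w β ^ δ ≤
      ENNReal.ofReal ((1 - (m - 1) * δ / (1 - δ))⁻¹) ^ (1 - δ) *
        ENNReal.ofReal (X ^ (1 - m * δ)) := by
  have h1δ : 0 < 1 - δ := by linarith
  set γ : ℝ := 1 - (m - 1) * δ / (1 - δ) with hγ
  have hγ0 : 0 < γ := by
    rw [hγ, sub_pos, div_lt_one h1δ]; linarith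
  have hγe : γ * (1 - δ) = 1 - m * δ := by
    rw [hγ]; field_simp; ring
  have hconj : (1 / δ).HolderConjugate (1 / (1 - δ)) := by
    rw [Real.holderConjugate_iff]
    refine ⟨by rw [lt_div_iff₀ hδ]; linarith, by simp⟩
  calc ∫⁻ β in Ioc (0 : ℝ) X, w β ^ δ
      = ∫⁻ β in Ioc (0 : ℝ) X, ((fun β => (ENNReal.ofReal (β ^ (m - 1)) * w β) ^ δ) *
          (fun β => ENNReal.ofReal (β ^ (-((m - 1) * δ))))) β := by
        refine setLIntegral_congr_fun measurableSet_Ioc fun β hβ => ?_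
        have hb : (0 : ℝ) < β := hβ.1
        simp only [Pi.mul_apply]
        rw [ENNReal.mul_rpow_of_nonneg _ _ hδ.le,
          ENNReal.ofReal_rpow_of_nonneg (Real.rpow_nonneg hb.le _) hδ.le, ← Real.rpow_mul hb.le,
          mul_right_comm, ← ENNReal.ofReal_mul (Real.rpow_nonneg hb.le _), ← Real.rpow_add hb]
        simp
    _ ≤ (∫⁻ β in Ioc (0 : ℝ) X, ((ENNReal.ofReal (β ^ (m - 1)) * w β) ^ δ) ^ (1 / δ)) ^ (1 / (1 / δ))
        * (∫⁻ β in Ioc (0 : ℝ) X, (ENNReal.ofReal (β ^ (-((m - 1) * δ)))) ^ (1 / (1 - δ))) ^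
          (1 / (1 / (1 - δ))) := by
        apply ENNReal.lintegral_mul_le_Lp_mul_Lq _ hconj <;> fun_prop
    _ ≤ 1 * ENNReal.ofReal (X ^ γ / γ) ^ (1 - δ) := by
        gcongr
        · rw [one_div_one_div]
          apply ENNReal.rpow_le_one _ hδ.le
          refine le_trans ?_ hW
          simp_rw [← ENNReal.rpow_mul, mul_one_div_cancel hδ.ne', ENNReal.rpow_one]
          exact lintegral_mono_set Ioc_subset_Ioi_self
        · rw [one_div_one_div]
          gcongr
          rw [← lintegral_Ioc_rpow hγ0 hX.le]
          apply le_of_eq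
          refine setLIntegral_congr_fun measurableSet_Ioc fun β hβ => ?_
          have hb : (0 : ℝ) < β := hβ.1
          rw [ENNReal.ofReal_rpow_of_nonneg (Real.rpow_nonneg hb.le _) (by positivity),
            ← Real.rpow_mul hb.le]
          congr 2
          rw [hγ]; field_simp; ring
    _ = _ := by
        rw [one_mul, div_eq_inv_mul, ENNReal.ofReal_mul (by positivity),
          ENNReal.mul_rpow_of_nonneg _ _ h1δ.le,
          ENNReal.ofReal_rpow_of_nonneg (Real.rpow_nonneg hX.le _) h1δ.le, ← Real.rpow_mul hX.le,
          hγe]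

/-- The kernel is decreasing, so an interval at the origin is the worst case up to a constant.
Splitting at `R = |B|`, the set is forgotten below `R` and the kernel is bounded by `R^(δ-1)` above.
-/
lemma lintegral_indicator_mul_rpow_le {δ : ℝ} (hδ : 0 < δ) (hδ1 : δ < 1) {B : Set ℝ}
    (hB : MeasurableSet B) :
    ∫⁻ s in Ioi (0 : ℝ), B.indicator 1 s * ENNReal.ofReal (s ^ (δ - 1)) ≤
      ENNReal.ofReal (1 / δ + 1) * volume B ^ δ := by
  rcases eq_or_ne (volume B) ⊤ with hT | hT
  · rw [hT, ENNReal.top_rpow_of_pos hδ, ENNReal.mul_top]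
    · exact le_top
    · rw [Ne, ENNReal.ofReal_eq_zero, not_le]
      positivity
  rcases eq_or_ne (volume B) 0 with h0 | h0
  · refine le_of_eq_of_le ?_ (zero_le)
    rw [lintegral_eq_zero_iff' (by
      refine AEMeasurable.mul (by fun_prop (disch := assumption)) (by fun_prop))]
    refine ae_restrict_of_ae ?_
    filter_upwards [measure_eq_zero_iff_ae_notMem.1 h0] with s hs
    simp [hs]
  set R := (volume B).toReal with hR
  have hR0 : 0 < R := ENNReal.toReal_pos h0 hT
  have hBR : volume B = ENNReal.ofReal R := (ENNReal.ofReal_toReal hT).symm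
  calc ∫⁻ s in Ioi (0 : ℝ), B.indicator 1 s * ENNReal.ofReal (s ^ (δ - 1))
      ≤ ∫⁻ s in Ioi (0 : ℝ), ((Ioc 0 R).indicator (fun s => ENNReal.ofReal (s ^ (δ - 1))) s +
          B.indicator 1 s * ENNReal.ofReal (R ^ (δ - 1))) := by
        refine setLIntegral_mono' measurableSet_Ioi fun s hs => ?_
        by_cases h : s ≤ R
        · refine le_trans ?_ le_self_add
          rw [indicator_of_mem (show s ∈ Ioc 0 R from ⟨hs, h⟩)]
          by_cases hb : s ∈ B <;> simp [hb]
        · refine le_trans ?_ le_add_self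
          exact mul_le_mul' le_rfl (ENNReal.ofReal_le_ofReal
            (Real.rpow_le_rpow_of_nonpos hR0 (not_le.1 h).le (by linarith)))
    _ = ENNReal.ofReal (R ^ δ / δ) + volume (B ∩ Ioi 0) * ENNReal.ofReal (R ^ (δ - 1)) := by
        rw [lintegral_add_left (by
            refine Measurable.indicator ?_ measurableSet_Ioc
            fun_prop), lintegral_indicator measurableSet_Ioc,
          Measure.restrict_restrict measurableSet_Ioc, inter_eq_left.2 (fun y hy => hy.1),
          lintegral_Ioc_rpow hδ hR0.le, lintegral_mul_const _ (measurable_one.indicator hB),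
          lintegral_indicator_one hB, Measure.restrict_apply hB]
    _ ≤ ENNReal.ofReal (R ^ δ / δ) + ENNReal.ofReal R * ENNReal.ofReal (R ^ (δ - 1)) := by
        gcongr
        rw [← hBR]
        exact measure_mono inter_subset_left
    _ = _ := by
        rw [hBR, ENNReal.ofReal_rpow_of_nonneg hR0.le hδ.le, ← ENNReal.ofReal_mul hR0.le,
          ← ENNReal.ofReal_add (by positivity) (by positivity), ← ENNReal.ofReal_mul (by positivity)]
        congr 1
        rw [Real.rpow_sub_one hR0.ne']
        field_simp

/-- Integrating the lag first, against either endpoint, gives one bound each. Both are needed: each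
of them will be integrable only over part of the pairs of levels. -/
lemma lintegral_sets_rpow_le {δ : ℝ} (hδ : 0 < δ) (hδ1 : δ < 1) {A B : Set ℝ}
    (hA : MeasurableSet A) (hB : MeasurableSet B) :
    ∫⁻ z : ℝ × ℝ, A.indicator 1 z.1 * B.indicator 1 (z.1 + z.2) * ENNReal.ofReal (z.2 ^ (δ - 1))
        ∂(volume.prod (volume.restrict (Ioi (0 : ℝ)))) ≤
      ENNReal.ofReal (1 / δ + 1) * min (volume A * volume B ^ δ) (volume B * volume A ^ δ) := by
  have hiA : Measurable (A.indicator (1 : ℝ → ℝ≥0∞)) := measurable_one.indicator hA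
  have hiB : Measurable (B.indicator (1 : ℝ → ℝ≥0∞)) := measurable_one.indicator hB
  have hmeas : Measurable (fun z : ℝ × ℝ => A.indicator (1 : ℝ → ℝ≥0∞) z.1 *
      B.indicator (1 : ℝ → ℝ≥0∞) (z.1 + z.2) * ENNReal.ofReal (z.2 ^ (δ - 1))) := by
    fun_prop
  have hsplit : ∀ {L c x y : ℝ≥0∞}, L ≤ c * x → L ≤ c * y → L ≤ c * min x y := by
    intro L c x y hx hy
    rcases min_choice x y with h | h <;> rwa [h]
  apply hsplit
  · rw [lintegral_prod _ hmeas.aemeasurable]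
    calc _ ≤ ∫⁻ t, A.indicator 1 t * (ENNReal.ofReal (1 / δ + 1) * volume B ^ δ) := by
          refine lintegral_mono fun t => ?_
          simp only [mul_assoc]
          rw [lintegral_const_mul _ (by fun_prop)]
          gcongr
          have := lintegral_indicator_mul_rpow_le hδ hδ1
            (hB.preimage (measurable_const_add t))
          rw [measure_preimage_add] at this
          exact this
      _ = _ := by
          rw [lintegral_mul_const _ hiA, lintegral_indicator_one hA]; ring
  · rw [lintegral_prod_symm _ hmeas.aemeasurable]
    calc _ = ∫⁻ s in Ioi (0 : ℝ), ∫⁻ u, A.indicator 1 (u - s) * B.indicator 1 u *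
            ENNReal.ofReal (s ^ (δ - 1)) := by
          refine lintegral_congr fun s => ?_
          rw [← lintegral_sub_right_eq_self _ s]
          simp
      _ = ∫⁻ u, ∫⁻ s in Ioi (0 : ℝ), A.indicator 1 (u - s) * B.indicator 1 u *
            ENNReal.ofReal (s ^ (δ - 1)) := by
          rw [lintegral_lintegral_swap]
          fun_prop
      _ ≤ ∫⁻ u, B.indicator 1 u * (ENNReal.ofReal (1 / δ + 1) * volume A ^ δ) := by
          refine lintegral_mono fun u => ?_
          simp only [mul_comm (A.indicator 1 _), mul_assoc]
          rw [lintegral_const_mul _ (by fun_prop)]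
          gcongr
          have hAu : MeasurableSet ((fun s : ℝ => u - s) ⁻¹' A) :=
            hA.preimage (by fun_prop)
          have := lintegral_indicator_mul_rpow_le hδ hδ1 hAu
          have h2 : volume ((fun s : ℝ => u - s) ⁻¹' A) = volume A :=
            (Measure.measurePreserving_sub_left volume u).measure_preimage hA.nullMeasurableSet
          rw [h2] at this
          simp only [mul_comm] at this ⊢
          exact this
      _ = _ := by
          rw [lintegral_mul_const _ hiB, lintegral_indicator_one hB]; ring

/-- The critical relation between `p`, `m`, `δ` enters through `(p/m)(1 - mδ) = p - 1`: integrating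
out `β` up to `α^(p/m)` leaves exactly the weight of `hV`. -/
lemma lintegral_region_le {p m δ : ℝ} (hp : 1 < p) (hm : 1 < m) (hδ : 0 < δ) (hδ1 : δ < 1)
    (h : 1 / p + 1 / m = 1 + δ) {v w : ℝ → ℝ≥0∞} (hw : Measurable w)
    (hV : ∫⁻ α in Ioi (0 : ℝ), ENNReal.ofReal (α ^ (p - 1)) * v α ≤ 1)
    (hW : ∫⁻ β in Ioi (0 : ℝ), ENNReal.ofReal (β ^ (m - 1)) * w β ≤ 1) :
    ∫⁻ α in Ioi (0 : ℝ), ∫⁻ β in Ioi (0 : ℝ),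
      (if β ≤ α ^ (p / m) then v α * w β ^ δ else 0) ≤
      ENNReal.ofReal ((1 - (m - 1) * δ / (1 - δ))⁻¹) ^ (1 - δ) := by
  have hp0 : 0 < p := by linarith
  have hm0 : 0 < m := by linarith
  have hmδ : m * δ < 1 := by
    have : 1 / p < 1 := by rw [div_lt_one hp0]; exact hp
    have h2 : δ < 1 / m := by linarith
    rwa [lt_div_iff₀ hm0, mul_comm] at h2
  set C := ENNReal.ofReal ((1 - (m - 1) * δ / (1 - δ))⁻¹) ^ (1 - δ) with hC
  calc _ ≤ ∫⁻ α in Ioi (0 : ℝ), C * (ENNReal.ofReal (α ^ (p - 1)) * v α) := by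
        refine setLIntegral_mono' measurableSet_Ioi fun α hα => ?_
        have ha : (0 : ℝ) < α := hα
        have hX : 0 < α ^ (p / m) := Real.rpow_pos_of_pos ha _
        have := lintegral_Ioc_level_rpow_le hδ hδ1 hmδ hw hW hX
        rw [← hC, ← Real.rpow_mul ha.le] at this
        have he : p / m * (1 - m * δ) = p - 1 := by
          have h3 : 1 / m - δ = 1 - 1 / p := by linarith
          calc p / m * (1 - m * δ) = p * (1 / m - δ) := by field_simp
            _ = _ := by rw [h3]; field_simp
        rw [he] at this
        calc _ = ∫⁻ β in Ioi (0 : ℝ), (Ioc 0 (α ^ (p / m))).indicator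
                (fun β => v α * w β ^ δ) β := by
              refine setLIntegral_congr_fun measurableSet_Ioi fun β hβ => ?_
              have hb : (0 : ℝ) < β := hβ
              simp [indicator_apply, hb]
          _ = v α * ∫⁻ β in Ioc 0 (α ^ (p / m)), w β ^ δ := by
              rw [lintegral_indicator measurableSet_Ioc,
                Measure.restrict_restrict measurableSet_Ioc, inter_eq_left.2 (fun y hy => hy.1),
                lintegral_const_mul _ (by fun_prop)]
          _ ≤ v α * (C * ENNReal.ofReal (α ^ (p - 1))) := by gcongr
          _ = _ := by ring
    _ = C * ∫⁻ α in Ioi (0 : ℝ), (ENNReal.ofReal (α ^ (p - 1)) * v α) := by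
        rw [lintegral_const_mul']
        rw [hC]
        exact ENNReal.rpow_ne_top_of_nonneg (by linarith) ENNReal.ofReal_ne_top
    _ ≤ C * 1 := by gcongr
    _ = C := mul_one _

/-- Writing `a` and `b` as superpositions of their superlevel sets reduces the form to pairs of
sets. The pairs of levels are divided along the curve `β = α^(p/m)`, and each side uses the member
of the minimum that `lintegral_region_le` can integrate there. -/
lemma lintegral_fractional_le_of_le_one {p m δ : ℝ} (hp : 1 < p) (hm : 1 < m) (hδ : 0 < δ)
    (hδ1 : δ < 1) (h : 1 / p + 1 / m = 1 + δ) {a b : ℝ → ℝ≥0∞} (ha : Measurable a)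
    (hb : Measurable b) (hA : ∫⁻ t, a t ^ p ≤ 1) (hB : ∫⁻ t, b t ^ m ≤ 1) :
    ∫⁻ t, ∫⁻ s in Ioi (0 : ℝ), a t * b (t + s) * ENNReal.ofReal (s ^ (δ - 1)) ≤
      ENNReal.ofReal (1 / δ + 1) * (ENNReal.ofReal ((1 - (m - 1) * δ / (1 - δ))⁻¹) ^ (1 - δ) +
        ENNReal.ofReal ((1 - (p - 1) * δ / (1 - δ))⁻¹) ^ (1 - δ)) := by
  have hp0 : 0 < p := by linarith
  have hm0 : 0 < m := by linarith
  set ν : Measure ℝ := volume.restrict (Ioi (0 : ℝ)) with hν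
  have hsA : MeasurableSet {x : ℝ × ℝ | ENNReal.ofReal x.1 < a x.2} :=
    measurableSet_lt (by fun_prop) (by fun_prop)
  have hsB : MeasurableSet {x : ℝ × ℝ | ENNReal.ofReal x.1 < b x.2} :=
    measurableSet_lt (by fun_prop) (by fun_prop)
  set A : ℝ → Set ℝ := fun α => {t | ENNReal.ofReal α < a t} with hAdef
  set B : ℝ → Set ℝ := fun β => {t | ENNReal.ofReal β < b t} with hBdef
  have hAm : ∀ α, MeasurableSet (A α) := fun α => measurableSet_lt measurable_const ha
  have hBm : ∀ α, MeasurableSet (B α) := fun α => measurableSet_lt measurable_const hb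
  have hiA : Measurable (fun x : ℝ × ℝ => (A x.1).indicator (1 : ℝ → ℝ≥0∞) x.2) := by
    have := (measurable_one (α := ℝ≥0∞)).indicator hsA
    exact this
  have hiB : Measurable (fun x : ℝ × ℝ => (B x.1).indicator (1 : ℝ → ℝ≥0∞) x.2) := by
    have := (measurable_one (α := ℝ≥0∞)).indicator hsB
    exact this
  have hv : Measurable (fun α => volume (A α)) := by
    simp_rw [← fun α => lintegral_indicator_one (μ := volume) (hAm α)]
    exact hiA.lintegral_prod_right'
  have hw : Measurable (fun β => volume (B β)) := by
    simp_rw [← fun α => lintegral_indicator_one (μ := volume) (hBm α)]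
    exact hiB.lintegral_prod_right'
  have hV : ∀ {c : ℝ → ℝ≥0∞} {r : ℝ}, 1 ≤ r → Measurable c → (∫⁻ t, c t ^ r ≤ 1) →
      (Measurable (fun x : ℝ × ℝ =>
        ({t | ENNReal.ofReal x.1 < c t}).indicator (1 : ℝ → ℝ≥0∞) x.2)) →
      ∫⁻ α, ENNReal.ofReal (α ^ (r - 1)) * volume {t | ENNReal.ofReal α < c t} ∂ν ≤ 1 := by
    intro c r hr hc h1 hmeas
    refine le_trans ?_ h1
    calc _ = ∫⁻ α, (∫⁻ t, ENNReal.ofReal (α ^ (r - 1)) *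
            ({t | ENNReal.ofReal α < c t}).indicator 1 t) ∂ν := by
          refine lintegral_congr fun α => ?_
          rw [lintegral_const_mul' _ _ ENNReal.ofReal_ne_top,
            lintegral_indicator_one (measurableSet_lt measurable_const hc)]
      _ = ∫⁻ t, ∫⁻ α, ENNReal.ofReal (α ^ (r - 1)) *
            ({t | ENNReal.ofReal α < c t}).indicator 1 t ∂ν := by
          rw [lintegral_lintegral_swap]
          exact ((by fun_prop : Measurable fun x : ℝ × ℝ => ENNReal.ofReal (x.1 ^ (r - 1))).mul
            hmeas).aemeasurable
      _ ≤ _ := lintegral_mono fun t => lintegral_layer_rpow hr (c t)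
  have hv1 : Measurable fun y : ℝ × ℝ => volume (A y.1) := hv.comp measurable_fst
  have hw1 : Measurable fun y : ℝ × ℝ => volume (B y.2) := hw.comp measurable_snd
  have hvw : Measurable fun y : ℝ × ℝ => volume (A y.1) * volume (B y.2) ^ δ :=
    hv1.mul (hw1.pow_const δ)
  have hwv : Measurable fun y : ℝ × ℝ => volume (B y.2) * volume (A y.1) ^ δ :=
    hw1.mul (hv1.pow_const δ)
  have hV1 := hV hp.le ha hA hiA
  have hW1 := hV hm.le hb hB hiB
  have key : ∀ z : ℝ × ℝ, a z.1 * b (z.1 + z.2) * ENNReal.ofReal (z.2 ^ (δ - 1)) =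
      ∫⁻ y : ℝ × ℝ, (A y.1).indicator 1 z.1 * (B y.2).indicator 1 (z.1 + z.2) *
        ENNReal.ofReal (z.2 ^ (δ - 1)) ∂(ν.prod ν) := by
    intro z
    have h1 : Measurable fun α => (A α).indicator (1 : ℝ → ℝ≥0∞) z.1 :=
      hiA.comp (measurable_id.prodMk measurable_const)
    have h2 : Measurable fun β => (B β).indicator (1 : ℝ → ℝ≥0∞) (z.1 + z.2) :=
      hiB.comp (measurable_id.prodMk measurable_const)
    have h3 : Measurable fun y : ℝ × ℝ => (A y.1).indicator (1 : ℝ → ℝ≥0∞) z.1 *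
        (B y.2).indicator (1 : ℝ → ℝ≥0∞) (z.1 + z.2) :=
      (h1.comp measurable_fst).mul (h2.comp measurable_snd)
    rw [lintegral_mul_const _ h3, lintegral_prod_mul h1.aemeasurable h2.aemeasurable]
    congr 2
    · exact (lintegral_layer (a z.1)).symm
    · exact (lintegral_layer (b (z.1 + z.2))).symm
  have hmeas : Measurable (fun x : (ℝ × ℝ) × (ℝ × ℝ) =>
      (A x.2.1).indicator (1 : ℝ → ℝ≥0∞) x.1.1 *
      (B x.2.2).indicator (1 : ℝ → ℝ≥0∞) (x.1.1 + x.1.2) * ENNReal.ofReal (x.1.2 ^ (δ - 1))) := by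
    have h1 := hiA.comp ((measurable_fst.comp measurable_snd).prodMk
      (measurable_fst.comp measurable_fst) : Measurable fun x : (ℝ × ℝ) × (ℝ × ℝ) => (x.2.1, x.1.1))
    have h2 := hiB.comp ((measurable_snd.comp measurable_snd).prodMk
      (by fun_prop) : Measurable fun x : (ℝ × ℝ) × (ℝ × ℝ) => (x.2.2, x.1.1 + x.1.2))
    exact (h1.mul h2).mul (by fun_prop)
  calc _ = ∫⁻ z : ℝ × ℝ, a z.1 * b (z.1 + z.2) * ENNReal.ofReal (z.2 ^ (δ - 1))
        ∂(volume.prod ν) := by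
        rw [lintegral_prod _ (by fun_prop)]
    _ = ∫⁻ y : ℝ × ℝ, ∫⁻ z : ℝ × ℝ, (A y.1).indicator 1 z.1 * (B y.2).indicator 1 (z.1 + z.2) *
        ENNReal.ofReal (z.2 ^ (δ - 1)) ∂(volume.prod ν) ∂(ν.prod ν) := by
        simp_rw [key]
        rw [lintegral_lintegral_swap]
        exact hmeas.aemeasurable
    _ ≤ ∫⁻ y : ℝ × ℝ, ENNReal.ofReal (1 / δ + 1) *
          ((if y.2 ≤ y.1 ^ (p / m) then volume (A y.1) * volume (B y.2) ^ δ else 0) +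
          (if y.1 ≤ y.2 ^ (m / p) then volume (B y.2) * volume (A y.1) ^ δ else 0))
          ∂(ν.prod ν) := by
        have hpos : ∀ᵐ y : ℝ × ℝ ∂(ν.prod ν), 0 < y.1 ∧ 0 < y.2 := by
          rw [hν, Measure.prod_restrict]
          filter_upwards [ae_restrict_mem (measurableSet_Ioi.prod measurableSet_Ioi)] with y hy
          exact hy
        refine lintegral_mono_ae ?_
        filter_upwards [hpos] with y hy
        refine (lintegral_sets_rpow_le hδ hδ1 (hAm y.1) (hBm y.2)).trans ?_
        gcongr
        by_cases hc : y.2 ≤ y.1 ^ (p / m)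
        · rw [if_pos hc]
          exact (min_le_left _ _).trans le_self_add
        · have hc' : y.1 ≤ y.2 ^ (m / p) := by
            calc y.1 = (y.1 ^ (p / m)) ^ (m / p) := by
                  rw [← Real.rpow_mul hy.1.le]
                  field_simp
                  simp
              _ ≤ _ := Real.rpow_le_rpow (Real.rpow_nonneg hy.1.le _) (not_le.1 hc).le
                  (by positivity)
          rw [if_pos hc']
          exact (min_le_right _ _).trans le_add_self
    _ = ENNReal.ofReal (1 / δ + 1) *
          ((∫⁻ y : ℝ × ℝ, (if y.2 ≤ y.1 ^ (p / m) then volume (A y.1) * volume (B y.2) ^ δ else 0)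
            ∂(ν.prod ν)) +
          ∫⁻ y : ℝ × ℝ, (if y.1 ≤ y.2 ^ (m / p) then volume (B y.2) * volume (A y.1) ^ δ else 0)
          ∂(ν.prod ν)) := by
        rw [lintegral_const_mul' _ _ ENNReal.ofReal_ne_top, lintegral_add_left]
        exact Measurable.ite (measurableSet_le (by fun_prop) (by fun_prop)) hvw
          measurable_const
    _ ≤ _ := by
        gcongr
        · rw [lintegral_prod _ (Measurable.ite (measurableSet_le (by fun_prop) (by fun_prop))
            hvw measurable_const).aemeasurable]
          exact lintegral_region_le hp hm hδ hδ1 h hw hV1 hW1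
        · rw [lintegral_prod_symm _ (Measurable.ite (measurableSet_le (by fun_prop) (by fun_prop))
            hwv measurable_const).aemeasurable]
          exact lintegral_region_le hm hp hδ hδ1 (by rw [add_comm]; exact h) hv hW1 hV1

/-- The one-dimensional Hardy–Littlewood–Sobolev inequality for a one-sided kernel. -/
theorem exists_lintegral_fractional_le {p m δ : ℝ} (hp : 1 < p) (hm : 1 < m) (hδ : 0 < δ)
    (hδ1 : δ < 1) (h : 1 / p + 1 / m = 1 + δ) :
    ∃ C : ℝ≥0∞, C ≠ ⊤ ∧ ∀ a b : ℝ → ℝ≥0∞, Measurable a → Measurable b →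
      ∫⁻ t, ∫⁻ s in Ioi (0 : ℝ), a t * b (t + s) * ENNReal.ofReal (s ^ (δ - 1)) ≤
        C * (∫⁻ t, a t ^ p) ^ (1 / p) * (∫⁻ t, b t ^ m) ^ (1 / m) := by
  have hp0 : 0 < p := by linarith
  have hm0 : 0 < m := by linarith
  refine ⟨ENNReal.ofReal (1 / δ + 1) *
      (ENNReal.ofReal ((1 - (m - 1) * δ / (1 - δ))⁻¹) ^ (1 - δ) +
        ENNReal.ofReal ((1 - (p - 1) * δ / (1 - δ))⁻¹) ^ (1 - δ)), ?_, ?_⟩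
  · refine ENNReal.mul_ne_top ENNReal.ofReal_ne_top (ENNReal.add_ne_top.2 ⟨?_, ?_⟩) <;>
      exact ENNReal.rpow_ne_top_of_nonneg (by linarith) ENNReal.ofReal_ne_top
  intro a b ha hb
  set C := ENNReal.ofReal (1 / δ + 1) *
      (ENNReal.ofReal ((1 - (m - 1) * δ / (1 - δ))⁻¹) ^ (1 - δ) +
        ENNReal.ofReal ((1 - (p - 1) * δ / (1 - δ))⁻¹) ^ (1 - δ)) with hC
  -- Needed only to have `C * ⊤ = ⊤` when one of the two norms is infinite.
  have hCpos : C ≠ 0 := by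
    rw [hC]
    refine mul_ne_zero ?_ ?_
    · rw [Ne, ENNReal.ofReal_eq_zero, not_le]; positivity
    · intro h0
      have h1 := (add_eq_zero.1 h0).1
      rw [ENNReal.rpow_eq_zero_iff] at h1
      have hmδ : m * δ < 1 := by
        have : 1 / p < 1 := by rw [div_lt_one hp0]; exact hp
        have h2 : δ < 1 / m := by linarith
        rwa [lt_div_iff₀ hm0, mul_comm] at h2
      have h3 : 0 < 1 - (m - 1) * δ / (1 - δ) := by
        rw [sub_pos, div_lt_one (by linarith)]; linarith
      rcases h1 with ⟨h1, -⟩ | ⟨h1, -⟩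
      · rw [ENNReal.ofReal_eq_zero] at h1
        exact absurd (inv_pos.2 h3) (not_lt.2 h1)
      · exact ENNReal.ofReal_ne_top h1
  set N := (∫⁻ t, a t ^ p) ^ (1 / p) with hN
  set M := (∫⁻ t, b t ^ m) ^ (1 / m) with hM
  have hzero : ∀ {c : ℝ → ℝ≥0∞} {r : ℝ}, 0 < r → Measurable c →
      (∫⁻ t, c t ^ r) ^ (1 / r) = 0 → c =ᵐ[volume] 0 := by
    intro c r hr hc h0
    rw [ENNReal.rpow_eq_zero_iff_of_pos (by positivity),
      lintegral_eq_zero_iff (by fun_prop)] at h0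
    filter_upwards [h0] with t ht
    exact (ENNReal.rpow_eq_zero_iff_of_pos hr).1 ht
  by_cases hN0 : N = 0
  · have h0 := hzero hp0 ha hN0
    refine le_of_eq_of_le ?_ zero_le
    rw [lintegral_eq_zero_iff' (Measurable.aemeasurable
      (Measurable.lintegral_prod_right' (f := fun x : ℝ × ℝ => a x.1 * b (x.1 + x.2) *
        ENNReal.ofReal (x.2 ^ (δ - 1))) (by fun_prop)))]
    filter_upwards [h0] with t ht
    simp [ht]
  by_cases hM0 : M = 0
  · have h0 := hzero hm0 hb hM0
    refine le_of_eq_of_le ?_ zero_le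
    rw [lintegral_eq_zero_iff' (Measurable.aemeasurable
      (Measurable.lintegral_prod_right' (f := fun x : ℝ × ℝ => a x.1 * b (x.1 + x.2) *
        ENNReal.ofReal (x.2 ^ (δ - 1))) (by fun_prop)))]
    refine Filter.Eventually.of_forall fun t => ?_
    simp only [Pi.zero_apply]
    rw [lintegral_eq_zero_iff (by fun_prop)]
    refine ae_restrict_of_ae ?_
    filter_upwards [(measurePreserving_add_left volume t).quasiMeasurePreserving.ae h0] with s hs
    simp [hs]
  by_cases hNT : N = ⊤
  · rw [hNT, ENNReal.mul_top hCpos, ENNReal.top_mul hM0]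
    exact le_top
  by_cases hMT : M = ⊤
  · rw [hMT, ENNReal.mul_top (mul_ne_zero hCpos hN0)]
    exact le_top
  have hnorm : ∀ {c : ℝ → ℝ≥0∞} {r : ℝ} {L : ℝ≥0∞}, 0 < r → Measurable c →
      L = (∫⁻ t, c t ^ r) ^ (1 / r) → L ≠ 0 → L ≠ ⊤ → ∫⁻ t, (L⁻¹ * c t) ^ r ≤ 1 := by
    intro c r L hr hc hL hL0 hLT
    simp_rw [ENNReal.mul_rpow_of_nonneg _ _ hr.le]
    rw [lintegral_const_mul _ (by fun_prop)]
    have h2 : ∫⁻ t, c t ^ r = L ^ r := by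
      rw [hL, ← ENNReal.rpow_mul, one_div_mul_cancel hr.ne', ENNReal.rpow_one]
    rw [h2, ← ENNReal.mul_rpow_of_nonneg _ _ hr.le, ENNReal.inv_mul_cancel hL0 hLT,
      ENNReal.one_rpow]
  have := lintegral_fractional_le_of_le_one hp hm hδ hδ1 h (ha.const_mul N⁻¹) (hb.const_mul M⁻¹)
    (hnorm hp0 ha hN hN0 hNT) (hnorm hm0 hb hM hM0 hMT)
  rw [← hC] at this
  calc _ = N * M * ∫⁻ t, ∫⁻ s in Ioi (0 : ℝ), N⁻¹ * a t * (M⁻¹ * b (t + s)) *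
        ENNReal.ofReal (s ^ (δ - 1)) := by
        rw [← lintegral_const_mul' _ _ (ENNReal.mul_ne_top hNT hMT)]
        refine lintegral_congr fun t => ?_
        rw [← lintegral_const_mul' _ _ (ENNReal.mul_ne_top hNT hMT)]
        refine lintegral_congr fun s => ?_
        calc _ = (N * N⁻¹) * (M * M⁻¹) * (a t * b (t + s) * ENNReal.ofReal (s ^ (δ - 1))) := by
              rw [ENNReal.mul_inv_cancel hN0 hNT, ENNReal.mul_inv_cancel hM0 hMT]; simp
          _ = _ := by ring
    _ ≤ N * M * C := by gcongr
    _ = _ := by ring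

end FractionalIntegral

/-! ### Young's inequality along the flow, and integrability in the time lag. -/

section Young

instance isAddHaarMeasure_volume_space_prod {d : ℕ} :
    (volume : Measure (Space d × Space d)).IsAddHaarMeasure :=
  Measure.prod.instIsAddHaarMeasure (volume : Measure (Space d)) volume

instance isAddHaarMeasure_volume_phase {d : ℕ} : (volume : Measure (Phase d)).IsAddHaarMeasure :=
  Measure.prod.instIsAddHaarMeasure (volume : Measure ℝ) (volume : Measure (Space d × Space d))

/-- A trilinear form of Young's convolution inequality, where the increment is passed through a map
`Λ` that multiplies the measure by a constant. -/
lemma lintegral_trilinear_le {W : Type*} [AddCommGroup W] [MeasurableSpace W] [MeasurableAdd₂ W]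
    {ν : Measure W} [SFinite ν] [ν.IsAddLeftInvariant] {Λ : W → W}
    (hΛ : Measurable Λ)
    {c : ℝ≥0∞} (hc : ∀ g : W → ℝ≥0∞, Measurable g → ∫⁻ η, g (Λ η) ∂ν = c * ∫⁻ X, g X ∂ν)
    {p m r : ℝ} (hp : 1 ≤ p) (hm : 1 ≤ m) (hr : 1 ≤ r) (h : 1 / p + 1 / m + 1 / r = 2)
    {a b k : W → ℝ≥0∞} (ha : Measurable a) (hb : Measurable b) (hk : Measurable k) :
    ∫⁻ X, ∫⁻ η, a X * b (X + Λ η) * k η ∂ν ∂ν ≤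
      c ^ (1 - 1 / r) * (∫⁻ X, a X ^ p ∂ν) ^ (1 / p) * (∫⁻ X, b X ^ m ∂ν) ^ (1 / m) *
        (∫⁻ X, k X ^ r ∂ν) ^ (1 / r) := by
  have hp0 : 0 < p := by linarith
  have hm0 : 0 < m := by linarith
  have hr0 : 0 < r := by linarith
  have hx : 0 ≤ 1 - 1 / r := by rw [sub_nonneg, div_le_one hr0]; exact hr
  have hy : 0 ≤ 1 - 1 / p := by rw [sub_nonneg, div_le_one hp0]; exact hp
  have hz : 0 ≤ 1 - 1 / m := by rw [sub_nonneg, div_le_one hm0]; exact hm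
  have hcomb : ∀ (u : ℝ≥0∞) {s x y : ℝ}, 0 < s → 0 ≤ x → 0 ≤ y → x + y = 1 / s →
      (u ^ s) ^ x * (u ^ s) ^ y = u := by
    intro u s x y hs hx hy hxy
    rw [← ENNReal.rpow_add_of_nonneg _ _ hx hy, ← ENNReal.rpow_mul, hxy, mul_one_div_cancel hs.ne',
      ENNReal.rpow_one]
  -- Three-function Hölder for the pairwise products of the `p`-th, `m`-th and `r`-th powers, with
  -- exponents `1 - 1/r`, `1 - 1/p`, `1 - 1/m` of sum one. Only the product of `a` and `b` is
  -- integrated along `Λ`, hence the factor `c ^ (1 - 1/r)`.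
  let F : Fin 3 → W × W → ℝ≥0∞ := ![fun z => a z.1 ^ p * b (z.1 + Λ z.2) ^ m,
    fun z => b (z.1 + Λ z.2) ^ m * k z.2 ^ r, fun z => k z.2 ^ r * a z.1 ^ p]
  have hF : ∀ i ∈ Finset.univ, AEMeasurable (F i) (ν.prod ν) := by
    have m0 : Measurable fun z : W × W => a z.1 ^ p * b (z.1 + Λ z.2) ^ m := by fun_prop
    have m1 : Measurable fun z : W × W => b (z.1 + Λ z.2) ^ m * k z.2 ^ r := by fun_prop
    have m2 : Measurable fun z : W × W => k z.2 ^ r * a z.1 ^ p := by fun_prop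
    intro i _
    fin_cases i
    exacts [m0.aemeasurable, m1.aemeasurable, m2.aemeasurable]
  have H := ENNReal.lintegral_prod_norm_pow_le (μ := ν.prod ν) Finset.univ hF
    (p := ![1 - 1 / r, 1 - 1 / p, 1 - 1 / m])
    (by simp only [Fin.sum_univ_three, Matrix.cons_val]; linarith)
    (by intro i _; fin_cases i; exacts [hx, hy, hz])
  simp only [Fin.prod_univ_three, F, Matrix.cons_val] at H
  have e0 : ∫⁻ z, a z.1 ^ p * b (z.1 + Λ z.2) ^ m ∂(ν.prod ν) =
      c * (∫⁻ X, a X ^ p ∂ν) * ∫⁻ X, b X ^ m ∂ν := by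
    rw [lintegral_prod _ (by fun_prop)]
    calc _ = ∫⁻ X, a X ^ p * (c * ∫⁻ X, b X ^ m ∂ν) ∂ν := by
          refine lintegral_congr fun X => ?_
          dsimp only
          rw [lintegral_const_mul _ (by fun_prop), hc (fun Y => b (X + Y) ^ m) (by fun_prop),
            lintegral_add_left_eq_self (fun Y => b Y ^ m) X]
      _ = _ := by rw [lintegral_mul_const _ (by fun_prop)]; ring
  have e1 : ∫⁻ z, b (z.1 + Λ z.2) ^ m * k z.2 ^ r ∂(ν.prod ν) =
      (∫⁻ X, b X ^ m ∂ν) * ∫⁻ X, k X ^ r ∂ν := by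
    rw [lintegral_prod_symm _ (by fun_prop)]
    calc _ = ∫⁻ η, (∫⁻ X, b X ^ m ∂ν) * k η ^ r ∂ν := by
          refine lintegral_congr fun η => ?_
          dsimp only
          rw [lintegral_mul_const _ (by fun_prop),
            lintegral_add_right_eq_self (fun Y => b Y ^ m) (Λ η)]
      _ = _ := by rw [lintegral_const_mul _ (by fun_prop)]
  have e2 : ∫⁻ z : W × W, k z.2 ^ r * a z.1 ^ p ∂(ν.prod ν) =
      (∫⁻ X, k X ^ r ∂ν) * ∫⁻ X, a X ^ p ∂ν := by
    simp_rw [mul_comm (k _ ^ r)]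
    rw [lintegral_prod_mul (f := fun X => a X ^ p) (g := fun X => k X ^ r) (by fun_prop)
      (by fun_prop), mul_comm]
  rw [e0, e1, e2] at H
  rw [← lintegral_prod (fun z : W × W => a z.1 * b (z.1 + Λ z.2) * k z.2) (by fun_prop)]
  calc _ = ∫⁻ z : W × W, (a z.1 ^ p * b (z.1 + Λ z.2) ^ m) ^ (1 - 1 / r) *
        (b (z.1 + Λ z.2) ^ m * k z.2 ^ r) ^ (1 - 1 / p) *
        (k z.2 ^ r * a z.1 ^ p) ^ (1 - 1 / m) ∂(ν.prod ν) := by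
        refine lintegral_congr fun z => ?_
        rw [ENNReal.mul_rpow_of_nonneg _ _ hx, ENNReal.mul_rpow_of_nonneg _ _ hy,
          ENNReal.mul_rpow_of_nonneg _ _ hz]
        have h1 := hcomb (a z.1) hp0 hx hz (by linarith)
        have h2 := hcomb (b (z.1 + Λ z.2)) hm0 hx hy (by linarith)
        have h3 := hcomb (k z.2) hr0 hy hz (by linarith)
        calc _ = ((a z.1 ^ p) ^ (1 - 1 / r) * (a z.1 ^ p) ^ (1 - 1 / m)) *
              ((b (z.1 + Λ z.2) ^ m) ^ (1 - 1 / r) * (b (z.1 + Λ z.2) ^ m) ^ (1 - 1 / p)) *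
              ((k z.2 ^ r) ^ (1 - 1 / p) * (k z.2 ^ r) ^ (1 - 1 / m)) := by rw [h1, h2, h3]
          _ = _ := by ring
    _ ≤ _ := H
    _ = _ := by
        set A := ∫⁻ X, a X ^ p ∂ν
        set B := ∫⁻ X, b X ^ m ∂ν
        set D := ∫⁻ X, k X ^ r ∂ν
        have hcomb' : ∀ (u : ℝ≥0∞) {s x y : ℝ}, 0 ≤ x → 0 ≤ y → x + y = s →
            u ^ s = u ^ x * u ^ y := by
          intro u s x y hx hy hxy
          rw [← hxy, ENNReal.rpow_add_of_nonneg _ _ hx hy]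
        rw [hcomb' A hx hz (by linarith : _ = 1 / p), hcomb' B hx hy (by linarith : _ = 1 / m),
          hcomb' D hy hz (by linarith : _ = 1 / r), ENNReal.mul_rpow_of_nonneg _ _ hx,
          ENNReal.mul_rpow_of_nonneg _ _ hx, ENNReal.mul_rpow_of_nonneg _ _ hy,
          ENNReal.mul_rpow_of_nonneg _ _ hz]
        ring

/-- The linear change of variables between the increments `(h, n)` and the displacements `(y, w)` in
position and velocity: `w = β h + α n` and `y = s w - μ n`. -/
noncomputable def displacement {d : ℕ} (s β α μ : ℝ) (η : Space d × Space d) : Space d × Space d :=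
  (s • (β • η.1 + α • η.2) - μ • η.2, β • η.1 + α • η.2)

lemma continuous_displacement {d : ℕ} (s β α μ : ℝ) :
    Continuous (displacement (d := d) s β α μ) := by
  unfold displacement; fun_prop

lemma lintegral_comp_smul_space {d : ℕ} {β : ℝ} (hβ : β ≠ 0) {g : Space d → ℝ≥0∞}
    (hg : Measurable g) :
    ∫⁻ h, g (β • h) = ENNReal.ofReal ((|β| ^ d)⁻¹) * ∫⁻ h, g h := by
  have := lintegral_map (μ := volume) hg (measurable_const_smul β)
  rw [← this, Measure.map_addHaar_smul _ hβ, lintegral_smul_measure, smul_eq_mul,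
    finrank_euclideanSpace_fin, abs_inv, abs_pow]

/-- Substitute `h ↦ w` at fixed `n`, then `n ↦ y` at fixed `w`. Each is an affine dilation, by `β`
and by `-μ`, so neither `s` nor `α` enters the Jacobian. -/
lemma lintegral_comp_displacement {d : ℕ} {s β α μ : ℝ} (hβ : 0 < β) (hμ : 0 < μ)
    {g : Space d × Space d → ℝ≥0∞} (hg : Measurable g) :
    ∫⁻ η, g (displacement s β α μ η) = ENNReal.ofReal (((β * μ) ^ d)⁻¹) * ∫⁻ X, g X := by
  unfold displacement
  have m1 : Measurable fun z : Space d × Space d => g (s • (β • z.1 + α • z.2) - μ • z.2,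
    β • z.1 + α • z.2) := by fun_prop
  have m2 : Measurable fun z : Space d × Space d => g (s • z.1 - μ • z.2, z.1) := by fun_prop
  calc _ = ∫⁻ n, ∫⁻ h, g (s • (β • h + α • n) - μ • n, β • h + α • n) := by
        rw [Measure.volume_eq_prod, lintegral_prod_symm _ m1.aemeasurable]
    _ = ∫⁻ n, ENNReal.ofReal ((|β| ^ d)⁻¹) * ∫⁻ w, g (s • w - μ • n, w) := by
        refine lintegral_congr fun n => ?_
        rw [lintegral_comp_smul_space hβ.ne' (g := fun h => g (s • (h + α • n) - μ • n, h + α • n))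
          (by fun_prop), lintegral_add_right_eq_self (fun w => g (s • w - μ • n, w))]
    _ = ENNReal.ofReal ((|β| ^ d)⁻¹) * ∫⁻ w, ∫⁻ n, g (s • w - μ • n, w) := by
        rw [lintegral_const_mul' _ _ ENNReal.ofReal_ne_top, lintegral_lintegral_swap]
        exact (m2.comp measurable_swap).aemeasurable
    _ = ENNReal.ofReal ((|β| ^ d)⁻¹) * ∫⁻ w, ENNReal.ofReal ((|μ| ^ d)⁻¹) * ∫⁻ y, g (y, w) := by
        congr 1
        refine lintegral_congr fun w => ?_
        have h1 := lintegral_comp_smul_space (neg_ne_zero.2 hμ.ne') (g := fun n => g (s • w + n, w))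
          (by fun_prop)
        simp only [neg_smul, abs_neg, ← sub_eq_add_neg] at h1
        rw [h1, lintegral_add_left_eq_self (fun y => g (y, w))]
    _ = _ := by
        rw [lintegral_const_mul' _ _ ENNReal.ofReal_ne_top, Measure.volume_eq_prod,
          lintegral_prod_symm _ hg.aemeasurable, ← mul_assoc, ← ENNReal.ofReal_mul (by positivity),
          abs_of_pos hβ, abs_of_pos hμ, mul_pow, mul_inv]

lemma map_displacement {d : ℕ} {s β α μ : ℝ} (hβ : 0 < β) (hμ : 0 < μ) :
    Measure.map (displacement (d := d) s β α μ) volume =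
      ENNReal.ofReal (((β * μ) ^ d)⁻¹) • volume := by
  refine Measure.ext_of_lintegral _ fun g hg => ?_
  rw [lintegral_map hg (continuous_displacement s β α μ).measurable,
    lintegral_comp_displacement hβ hμ hg, lintegral_smul_measure, smul_eq_mul]

/-- The point reached from `z` by free transport during time `s`, followed by the displacement
`X` in position and velocity. -/
def flow {d : ℕ} (s : ℝ) (X : Space d × Space d) (z : Phase d) : Phase d :=
  (z.1 + s, z.2.1 + s • z.2.2 + X.1, z.2.2 + X.2)

lemma continuous_flow {d : ℕ} (s : ℝ) (X : Space d × Space d) : Continuous (flow s X) := by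
  unfold flow; fun_prop

lemma measurable_comp_flow_displacement {d : ℕ} {ψ : Phase d → ℝ≥0∞} (hψ : Measurable ψ)
    (s β α μ : ℝ) : Measurable fun x : Phase d × (Space d × Space d) =>
      ψ (flow s (displacement s β α μ x.2) x.1) := by
  have := (continuous_displacement (d := d) s β α μ).measurable
  refine hψ.comp ?_
  unfold flow
  fun_prop

/-- The shear `(x, v) ↦ (x + s v, v)` can be pulled outside. At fixed `t`, averaging over `η` is
then a convolution in `(x, v)` followed by a measure-preserving shear, to which Young's inequality
applies. -/
lemma flow_displacement {d : ℕ} (s β α μ t : ℝ) (X η : Space d × Space d) :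
    flow s (displacement s β α μ η) (t, X) =
      (t + s, (X + displacement 0 β α μ η).1 + s • (X + displacement 0 β α μ η).2,
        (X + displacement 0 β α μ η).2) := by
  simp only [flow, displacement, Prod.fst_add, Prod.snd_add, zero_smul, smul_add]
  congr 2
  abel

lemma lintegral_flow_average_slice_le {d : ℕ} {p m r : ℝ} (hp : 1 ≤ p) (hm : 1 ≤ m) (hr : 1 ≤ r)
    (h : 1 / p + 1 / m + 1 / r = 2) {k : Space d × Space d → ℝ≥0∞} (hk : Measurable k)
    {u ψ : Phase d → ℝ≥0∞} (hu : Measurable u) (hψ : Measurable ψ) {s β α μ : ℝ}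
    (hβ : 0 < β) (hμ : 0 < μ) (t : ℝ) :
    ∫⁻ X, ∫⁻ η, k η * (u (t, X) * ψ (flow s (displacement s β α μ η) (t, X))) ≤
      ENNReal.ofReal (((β * μ) ^ d)⁻¹) ^ (1 - 1 / r) * (∫⁻ η, k η ^ r) ^ (1 / r) *
      ((∫⁻ X, u (t, X) ^ p) ^ (1 / p) * (∫⁻ X, ψ (t + s, X) ^ m) ^ (1 / m)) := by
  have hΛ0 := (continuous_displacement (d := d) 0 β α μ).measurable
  have ha : Measurable fun X => u (t, X) := hu.comp measurable_prodMk_left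
  have hb : Measurable fun Y : Space d × Space d => ψ (t + s, Y.1 + s • Y.2, Y.2) := by
    fun_prop
  have hbn : ∫⁻ Y : Space d × Space d, ψ (t + s, Y.1 + s • Y.2, Y.2) ^ m =
      ∫⁻ Y, ψ (t + s, Y) ^ m := by
    have h1 : Measurable fun Y : Space d × Space d => ψ (t + s, Y) ^ m := by fun_prop
    rw [Measure.volume_eq_prod, lintegral_prod_symm _ (hb.pow_const m).aemeasurable,
      lintegral_prod_symm _ h1.aemeasurable]
    refine lintegral_congr fun v => ?_
    exact lintegral_add_right_eq_self (fun x => ψ (t + s, x, v) ^ m) (s • v)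
  have := lintegral_trilinear_le (ν := (volume : Measure (Space d × Space d))) hΛ0
    (fun g hg => lintegral_comp_displacement (s := 0) (α := α) hβ hμ hg) hp hm hr h ha hb hk
  rw [hbn] at this
  refine le_trans (le_of_eq ?_) (this.trans (le_of_eq ?_))
  · refine lintegral_congr fun X => lintegral_congr fun η => ?_
    rw [flow_displacement]
    ring
  · ring

lemma lintegral_flow_average_le {d : ℕ} {p m r : ℝ} (hp : 1 ≤ p) (hm : 1 ≤ m) (hr : 1 ≤ r)
    (h : 1 / p + 1 / m + 1 / r = 2) {k : Space d × Space d → ℝ≥0∞} (hk : Measurable k)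
    {u ψ : Phase d → ℝ≥0∞} (hu : Measurable u) (hψ : Measurable ψ) {s β α μ : ℝ}
    (hβ : 0 < β) (hμ : 0 < μ) :
    ∫⁻ η, k η * ∫⁻ z, u z * ψ (flow s (displacement s β α μ η) z) ≤
      ENNReal.ofReal (((β * μ) ^ d)⁻¹) ^ (1 - 1 / r) * (∫⁻ η, k η ^ r) ^ (1 / r) *
      ∫⁻ t, (∫⁻ X, u (t, X) ^ p) ^ (1 / p) * (∫⁻ X, ψ (t + s, X) ^ m) ^ (1 / m) := by
  have hmeas := measurable_comp_flow_displacement hψ s β α μ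
  have hmeas0 : Measurable fun x : Phase d × (Space d × Space d) =>
      u x.1 * ψ (flow s (displacement s β α μ x.2) x.1) :=
    (hu.comp measurable_fst).mul hmeas
  have hmeas1 : Measurable fun x : Phase d × (Space d × Space d) =>
      k x.2 * (u x.1 * ψ (flow s (displacement s β α μ x.2) x.1)) :=
    (hk.comp measurable_snd).mul hmeas0
  have hmeas2 : Measurable fun z : Phase d =>
      ∫⁻ η, k η * (u z * ψ (flow s (displacement s β α μ η) z)) :=
    hmeas1.lintegral_prod_right'
  have h1 : Measurable fun t => ∫⁻ X, u (t, X) ^ p :=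
    Measurable.lintegral_prod_right' (f := fun z : Phase d => u z ^ p) (hu.pow_const p)
  have h2 : Measurable fun t => ∫⁻ X, ψ (t, X) ^ m :=
    Measurable.lintegral_prod_right' (f := fun z : Phase d => ψ z ^ m) (hψ.pow_const m)
  have e1 : ∫⁻ η, k η * ∫⁻ z, u z * ψ (flow s (displacement s β α μ η) z) =
      ∫⁻ z, ∫⁻ η, k η * (u z * ψ (flow s (displacement s β α μ η) z)) := by
    rw [lintegral_lintegral_swap hmeas1.aemeasurable]
    refine lintegral_congr fun η => ?_
    rw [lintegral_const_mul]
    exact hmeas0.comp measurable_prodMk_right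
  have e2 := lintegral_prod (μ := (volume : Measure ℝ))
    (ν := (volume : Measure (Space d × Space d))) _ hmeas2.aemeasurable
  rw [← Measure.volume_eq_prod] at e2
  rw [e1, e2, ← lintegral_const_mul]
  · exact lintegral_mono fun t => lintegral_flow_average_slice_le hp hm hr h hk hu hψ hβ hμ t
  · exact (h1.pow_const _).mul ((h2.comp (measurable_add_const s)).pow_const _)

/-- Integrability in the time lag of the averages of `ψ` along the random trajectories, at the
critical decay rate. -/
theorem exists_lintegral_flow_average_le {d : ℕ} {p m δ : ℝ} (hp : 1 < p) (hm : 1 < m)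
    (hδ : 0 < δ) (hδ1 : δ < 1) (h : 1 / p + 1 / m = 1 + δ) {k : Space d × Space d → ℝ≥0∞}
    (hk : Measurable k) (hkr : ∫⁻ η, k η ^ (1 / (1 - δ)) ≠ ⊤) :
    ∃ C : ℝ≥0∞, C ≠ ⊤ ∧ ∀ u ψ : Phase d → ℝ≥0∞, Measurable u → Measurable ψ →
      ∀ β α μ : ℝ → ℝ, (∀ s, 0 < s → 0 < β s) → (∀ s, 0 < s → 0 < μ s) →
      ∫⁻ s in Ioi (0 : ℝ), ENNReal.ofReal (s ^ (δ - 1) * ((β s * μ s) ^ d) ^ δ) *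
        ∫⁻ η, k η * ∫⁻ z, u z * ψ (flow s (displacement s (β s) (α s) (μ s) η) z) ≤
      C * (∫⁻ z, u z ^ p) ^ (1 / p) * (∫⁻ z, ψ z ^ m) ^ (1 / m) := by
  obtain ⟨C, hC, H⟩ := exists_lintegral_fractional_le hp hm hδ hδ1 h
  have h1δ : 0 < 1 - δ := by linarith
  set r := 1 / (1 - δ) with hr
  have hr1 : 1 / r = 1 - δ := by rw [hr, one_div_one_div]
  have hr' : 1 ≤ r := by rw [hr, le_div_iff₀ h1δ]; linarith
  have hkT : (∫⁻ η, k η ^ r) ^ (1 / r) ≠ ⊤ :=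
    ENNReal.rpow_ne_top_of_nonneg (by positivity) hkr
  refine ⟨(∫⁻ η, k η ^ r) ^ (1 / r) * C, ENNReal.mul_ne_top hkT hC, ?_⟩
  intro u ψ hu hψ β α μ hβ hμ
  set A : ℝ → ℝ≥0∞ := fun t => (∫⁻ X, u (t, X) ^ p) ^ (1 / p) with hA
  set B : ℝ → ℝ≥0∞ := fun t => (∫⁻ X, ψ (t, X) ^ m) ^ (1 / m) with hB
  have hAm : Measurable A := (Measurable.lintegral_prod_right' (f := fun z : Phase d => u z ^ p)
    (by fun_prop)).pow_const _
  have hBm : Measurable B := (Measurable.lintegral_prod_right' (f := fun z : Phase d => ψ z ^ m)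
    (by fun_prop)).pow_const _
  have hAp : ∫⁻ t, A t ^ p = ∫⁻ z, u z ^ p := by
    rw [Measure.volume_eq_prod ℝ (Space d × Space d), lintegral_prod _ (by fun_prop)]
    refine lintegral_congr fun t => ?_
    rw [hA, ← ENNReal.rpow_mul, one_div_mul_cancel (by linarith), ENNReal.rpow_one]
  have hBp : ∫⁻ t, B t ^ m = ∫⁻ z, ψ z ^ m := by
    rw [Measure.volume_eq_prod ℝ (Space d × Space d), lintegral_prod _ (by fun_prop)]
    refine lintegral_congr fun t => ?_
    rw [hB, ← ENNReal.rpow_mul, one_div_mul_cancel (by linarith), ENNReal.rpow_one]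
  -- Since `1 - 1/r = δ`, the weight `((βμ)^d)^δ` cancels the Jacobian factor from Young's
  -- inequality. What is left is the kernel `s^(δ-1)` acting between the time profiles `A` and `B`
  -- of the spatial norms.
  calc _ ≤ ∫⁻ s in Ioi (0 : ℝ), (∫⁻ η, k η ^ r) ^ (1 / r) *
        (ENNReal.ofReal (s ^ (δ - 1)) * ∫⁻ t, A t * B (t + s)) := by
        refine setLIntegral_mono' measurableSet_Ioi fun s hs => ?_
        have hs0 : (0 : ℝ) < s := hs
        have hbm : 0 < (β s * μ s) ^ d := pow_pos (mul_pos (hβ s hs) (hμ s hs)) d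
        have h1 := lintegral_flow_average_le hp.le hm.le hr' (by rw [hr1]; linarith) hk hu hψ
          (s := s) (α := α s) (hβ s hs) (hμ s hs)
        rw [hr1, sub_sub_cancel] at h1
        refine (mul_le_mul' le_rfl h1).trans (le_of_eq ?_)
        rw [ENNReal.ofReal_rpow_of_pos (by positivity), hr1,
          ENNReal.ofReal_mul (Real.rpow_nonneg hs0.le _)]
        have h2 : ENNReal.ofReal (((β s * μ s) ^ d) ^ δ) *
            ENNReal.ofReal ((((β s * μ s) ^ d)⁻¹) ^ δ) = 1 := by
          rw [← ENNReal.ofReal_mul (by positivity), ← Real.mul_rpow hbm.le (by positivity),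
            mul_inv_cancel₀ hbm.ne']
          simp
        calc _ = (ENNReal.ofReal (((β s * μ s) ^ d) ^ δ) *
            ENNReal.ofReal ((((β s * μ s) ^ d)⁻¹) ^ δ)) * ((∫⁻ η, k η ^ r) ^ (1 - δ) *
              (ENNReal.ofReal (s ^ (δ - 1)) * ∫⁻ t, A t * B (t + s))) := by ring
          _ = _ := by rw [h2, one_mul]
    _ = (∫⁻ η, k η ^ r) ^ (1 / r) * ∫⁻ s in Ioi (0 : ℝ), ∫⁻ t,
        A t * B (t + s) * ENNReal.ofReal (s ^ (δ - 1)) := by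
        rw [lintegral_const_mul' _ _ hkT]
        congr 1
        refine lintegral_congr fun s => ?_
        rw [lintegral_mul_const _ (by fun_prop), mul_comm]
    _ = (∫⁻ η, k η ^ r) ^ (1 / r) * ∫⁻ t, ∫⁻ s in Ioi (0 : ℝ),
        A t * B (t + s) * ENNReal.ofReal (s ^ (δ - 1)) := by
        rw [lintegral_lintegral_swap]
        exact Measurable.aemeasurable (by fun_prop)
    _ ≤ (∫⁻ η, k η ^ r) ^ (1 / r) * (C * (∫⁻ t, A t ^ p) ^ (1 / p) *
          (∫⁻ t, B t ^ m) ^ (1 / m)) := by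
        gcongr
        exact H A B hAm hBm
    _ = _ := by rw [hAp, hBp]; ring

end Young

/-! ### Gaussian kernels and their fractional derivatives. -/

section Kernels

/-- The Gaussian `exp (-π |h|²)`, which is its own Fourier transform. -/
noncomputable def gauss {d : ℕ} (h : Space d) : ℝ := Real.exp (-Real.pi * ‖h‖ ^ 2)

/-- The Laplacian of `gauss`, divided by `2 π`. -/
noncomputable def gaussLap {d : ℕ} (h : Space d) : ℝ := (2 * Real.pi * ‖h‖ ^ 2 - d) * gauss h

lemma continuous_gauss {d : ℕ} : Continuous (gauss (d := d)) := by unfold gauss; fun_prop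

lemma continuous_gaussLap {d : ℕ} : Continuous (gaussLap (d := d)) := by
  have := continuous_gauss (d := d)
  unfold gaussLap; fun_prop

lemma gauss_pos {d : ℕ} (h : Space d) : 0 < gauss h := Real.exp_pos _

lemma gauss_le_one {d : ℕ} (h : Space d) : gauss h ≤ 1 := by
  unfold gauss
  rw [Real.exp_le_one_iff, neg_mul, neg_nonpos]
  positivity

lemma integrable_exp_neg_mul_sq_norm {d : ℕ} {b : ℝ} (hb : 0 < b) :
    Integrable fun h : Space d => Real.exp (-b * ‖h‖ ^ 2) := by
  have := GaussianFourier.integrable_cexp_neg_mul_sq_norm_add (V := Space d) (b := (b : ℂ))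
    (by simpa using hb) 0 0
  refine this.norm.congr (Filter.Eventually.of_forall fun h => ?_)
  simp [Complex.norm_exp, ← Complex.ofReal_pow]

lemma integrable_gauss {d : ℕ} : Integrable (gauss (d := d)) :=
  integrable_exp_neg_mul_sq_norm Real.pi_pos

lemma integral_gauss {d : ℕ} : ∫ h : Space d, gauss h = 1 := by
  unfold gauss
  rw [GaussianFourier.integral_rexp_neg_mul_sq_norm Real.pi_pos, div_self Real.pi_ne_zero,
    Real.one_rpow]

lemma sq_mul_exp_neg_le {b x : ℝ} (hb : 0 < b) :
    x ^ 2 * Real.exp (-b * x ^ 2) ≤ 2 / b * Real.exp (-(b / 2) * x ^ 2) := by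
  have h1 : b / 2 * x ^ 2 ≤ Real.exp (b / 2 * x ^ 2) := by
    linarith [Real.add_one_le_exp (b / 2 * x ^ 2)]
  have h2 : Real.exp (-(b / 2) * x ^ 2) = Real.exp (b / 2 * x ^ 2) * Real.exp (-b * x ^ 2) := by
    rw [← Real.exp_add]; congr 1; ring
  rw [h2]
  have h3 : x ^ 2 ≤ 2 / b * Real.exp (b / 2 * x ^ 2) := by
    rw [div_mul_eq_mul_div, le_div_iff₀ hb]; linarith
  calc _ ≤ 2 / b * Real.exp (b / 2 * x ^ 2) * Real.exp (-b * x ^ 2) := by gcongr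
    _ = _ := by ring

lemma integrable_sq_norm_mul_exp {d : ℕ} {b : ℝ} (hb : 0 < b) :
    Integrable fun h : Space d => ‖h‖ ^ 2 * Real.exp (-b * ‖h‖ ^ 2) := by
  refine ((integrable_exp_neg_mul_sq_norm (half_pos hb)).const_mul (2 / b)).mono'
    (by fun_prop) (Filter.Eventually.of_forall fun h => ?_)
  rw [Real.norm_of_nonneg (by positivity)]
  exact sq_mul_exp_neg_le hb

lemma integrable_gaussLap {d : ℕ} : Integrable (gaussLap (d := d)) := by
  have h1 := (integrable_sq_norm_mul_exp (d := d) Real.pi_pos).const_mul (2 * Real.pi)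
  have h2 := (integrable_gauss (d := d)).const_mul (d : ℝ)
  refine (h1.sub h2).congr (Filter.Eventually.of_forall fun h => ?_)
  simp only [gaussLap, gauss, Pi.sub_apply]; ring

lemma integrable_cexp_mul_I_smul {α : Type*} [MeasurableSpace α] {ν : Measure α} {φ g : α → ℝ}
    (hφ : Measurable φ) (hg : Integrable g ν) :
    Integrable (fun x => Complex.exp ((φ x : ℂ) * Complex.I) • (g x : ℂ)) ν := by
  have h1 : Measurable fun x => Complex.exp ((φ x : ℂ) * Complex.I) := by fun_prop
  refine hg.norm.mono' (h1.aestronglyMeasurable.smul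
    (Complex.continuous_ofReal.comp_aestronglyMeasurable hg.aestronglyMeasurable))
    (Filter.Eventually.of_forall fun x => ?_)
  rw [norm_smul, Complex.norm_exp_ofReal_mul_I, one_mul, Complex.norm_real]

/-- The Fourier transform of the Gaussian `exp (-b |h|²)`. -/
lemma fourier_exp_neg_mul_sq_norm {d : ℕ} {b : ℝ} (hb : 0 < b) (ξ : Space d) :
    𝓕 (fun h : Space d => ((Real.exp (-b * ‖h‖ ^ 2) : ℝ) : ℂ)) ξ =
      (((Real.pi / b) ^ (d / 2 : ℝ) * Real.exp (-Real.pi ^ 2 * ‖ξ‖ ^ 2 / b) : ℝ) : ℂ) := by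
  have := fourier_gaussian_innerProductSpace (V := Space d) (b := (b : ℂ)) (by simpa using hb) ξ
  rw [finrank_euclideanSpace_fin] at this
  have h2 : (fun h : Space d => ((Real.exp (-b * ‖h‖ ^ 2) : ℝ) : ℂ)) =
      fun h : Space d => Complex.exp (-b * ‖h‖ ^ 2) := by
    ext h; push_cast; rfl
  rw [h2, this]
  push_cast [Complex.ofReal_cpow (div_pos Real.pi_pos hb).le]
  rfl

/-- Differentiation of the Gaussian formula in the parameter `b`, which brings down `-‖h‖²` under
the integral. -/
lemma fourier_sq_norm_mul_exp {d : ℕ} {b : ℝ} (hb : 0 < b) (ξ : Space d) :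
    𝓕 (fun h : Space d => ((‖h‖ ^ 2 * Real.exp (-b * ‖h‖ ^ 2) : ℝ) : ℂ)) ξ =
      (((d / (2 * b) - Real.pi ^ 2 * ‖ξ‖ ^ 2 / b ^ 2) *
        ((Real.pi / b) ^ (d / 2 : ℝ) * Real.exp (-Real.pi ^ 2 * ‖ξ‖ ^ 2 / b)) : ℝ) : ℂ) := by
  have hder := (hasDerivAt_integral_of_dominated_loc_of_deriv_le (𝕜 := ℝ) (μ := volume)
    (F := fun (b : ℝ) (h : Space d) =>
      Complex.exp (((-2 * Real.pi * inner ℝ h ξ : ℝ) : ℂ) * Complex.I) •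
        ((Real.exp (-b * ‖h‖ ^ 2) : ℝ) : ℂ))
    (F' := fun (b : ℝ) (h : Space d) =>
      Complex.exp (((-2 * Real.pi * inner ℝ h ξ : ℝ) : ℂ) * Complex.I) •
        ((-(‖h‖ ^ 2 * Real.exp (-b * ‖h‖ ^ 2)) : ℝ) : ℂ)) (x₀ := b) (s := Metric.ball b (b / 2))
    (bound := fun h => ‖h‖ ^ 2 * Real.exp (-(b / 2) * ‖h‖ ^ 2))
    (Metric.ball_mem_nhds b (half_pos hb)) ?_ ?_ ?_ ?_ ?_ ?_).2
  · have hA : HasDerivAt (fun b : ℝ => (((Real.pi / b) ^ (d / 2 : ℝ) *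
        Real.exp (-Real.pi ^ 2 * ‖ξ‖ ^ 2 / b) : ℝ) : ℂ))
        ((-((d / (2 * b) - Real.pi ^ 2 * ‖ξ‖ ^ 2 / b ^ 2) *
        ((Real.pi / b) ^ (d / 2 : ℝ) * Real.exp (-Real.pi ^ 2 * ‖ξ‖ ^ 2 / b))) : ℝ) : ℂ) b := by
      apply HasDerivAt.ofReal_comp
      have hpb : 0 < Real.pi / b := div_pos Real.pi_pos hb
      have e1 : HasDerivAt (fun b : ℝ => Real.pi / b) (-Real.pi / b ^ 2) b := by
        simpa using (hasDerivAt_const b Real.pi).fun_div (hasDerivAt_id' b) hb.ne'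
      have e2 := e1.rpow_const (p := (d / 2 : ℝ)) (Or.inl hpb.ne')
      have e3 : HasDerivAt (fun b : ℝ => -Real.pi ^ 2 * ‖ξ‖ ^ 2 / b)
          (-(-Real.pi ^ 2 * ‖ξ‖ ^ 2) / b ^ 2) b := by
        exact ((hasDerivAt_const b (-Real.pi ^ 2 * ‖ξ‖ ^ 2)).fun_div (hasDerivAt_id' b)
          hb.ne').congr_deriv (by ring)
      refine (e2.mul e3.exp).congr_deriv ?_
      rw [Real.rpow_sub_one hpb.ne']
      field_simp
      ring
    have hEq : (fun b : ℝ => ∫ h : Space d,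
        Complex.exp (((-2 * Real.pi * inner ℝ h ξ : ℝ) : ℂ) * Complex.I) •
        ((Real.exp (-b * ‖h‖ ^ 2) : ℝ) : ℂ)) =ᶠ[nhds b] fun b : ℝ => (((Real.pi / b) ^ (d / 2 : ℝ) *
        Real.exp (-Real.pi ^ 2 * ‖ξ‖ ^ 2 / b) : ℝ) : ℂ) := by
      filter_upwards [lt_mem_nhds hb] with c hc
      rw [← fourier_exp_neg_mul_sq_norm hc, Real.fourier_eq']
    have h3 := hder.unique (hA.congr_of_eventuallyEq hEq)
    rw [Real.fourier_eq']
    rw [← neg_inj, ← integral_neg, ← Complex.ofReal_neg, ← h3]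
    congr 1
    ext h
    simp
  · exact Filter.Eventually.of_forall fun c => by fun_prop
  · exact integrable_cexp_mul_I_smul (by fun_prop) (integrable_exp_neg_mul_sq_norm hb)
  · fun_prop
  · refine Filter.Eventually.of_forall fun h c hc => ?_
    rw [norm_smul, Complex.norm_exp_ofReal_mul_I, one_mul, Complex.norm_real, norm_neg,
      Real.norm_of_nonneg (by positivity)]
    gcongr
    rw [Metric.mem_ball, Real.dist_eq, abs_lt] at hc
    linarith
  · exact integrable_sq_norm_mul_exp (half_pos hb)
  · refine Filter.Eventually.of_forall fun h c hc => ?_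
    simp only [smul_eq_mul]
    apply HasDerivAt.const_mul
    apply HasDerivAt.ofReal_comp
    have e1 : HasDerivAt (fun c : ℝ => -c * ‖h‖ ^ 2) (-1 * ‖h‖ ^ 2) c :=
      ((hasDerivAt_id c).neg).mul_const _
    refine e1.exp.congr_deriv ?_
    ring

/-- The inverse Fourier transform of `|ξ|² exp (-π τ |ξ|²)`. -/
noncomputable def heatLap {d : ℕ} (τ : ℝ) (h : Space d) : ℝ :=
  τ ^ (-(d / 2 : ℝ) - 1) * ((d / (2 * Real.pi) - ‖h‖ ^ 2 / τ) * Real.exp (-(Real.pi / τ) * ‖h‖ ^ 2))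

lemma fourier_heatLap {d : ℕ} {τ : ℝ} (hτ : 0 < τ) (ξ : Space d) :
    𝓕 (fun h : Space d => ((heatLap τ h : ℝ) : ℂ)) ξ =
      ((‖ξ‖ ^ 2 * Real.exp (-(Real.pi * τ) * ‖ξ‖ ^ 2) : ℝ) : ℂ) := by
  have hb : 0 < Real.pi / τ := div_pos Real.pi_pos hτ
  have h0 := fourier_exp_neg_mul_sq_norm hb ξ
  have h1 := fourier_sq_norm_mul_exp hb ξ
  rw [Real.fourier_eq'] at h0 h1 ⊢
  have i0 := (integrable_cexp_mul_I_smul (φ := fun h : Space d => -2 * Real.pi * inner ℝ h ξ) (by fun_prop)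
    (integrable_exp_neg_mul_sq_norm hb)).const_mul
    ((τ ^ (-(d / 2 : ℝ) - 1) * (d / (2 * Real.pi)) : ℝ) : ℂ)
  have i1 := (integrable_cexp_mul_I_smul (φ := fun h : Space d => -2 * Real.pi * inner ℝ h ξ) (by fun_prop)
    (integrable_sq_norm_mul_exp hb)).const_mul
    ((τ ^ (-(d / 2 : ℝ) - 1) * (1 / τ) : ℝ) : ℂ)
  calc _ = ∫ h : Space d, (((τ ^ (-(d / 2 : ℝ) - 1) * (d / (2 * Real.pi)) : ℝ) : ℂ) *
        (Complex.exp (((-2 * Real.pi * inner ℝ h ξ : ℝ) : ℂ) * Complex.I) •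
          ((Real.exp (-(Real.pi / τ) * ‖h‖ ^ 2) : ℝ) : ℂ)) -
        ((τ ^ (-(d / 2 : ℝ) - 1) * (1 / τ) : ℝ) : ℂ) *
        (Complex.exp (((-2 * Real.pi * inner ℝ h ξ : ℝ) : ℂ) * Complex.I) •
          ((‖h‖ ^ 2 * Real.exp (-(Real.pi / τ) * ‖h‖ ^ 2) : ℝ) : ℂ))) := by
        refine integral_congr_ae (Filter.Eventually.of_forall fun h => ?_)
        simp only [heatLap, smul_eq_mul]
        push_cast
        ring
    _ = _ := by
        rw [integral_sub i0 i1, integral_const_mul, integral_const_mul, h0, h1, ← Complex.ofReal_mul,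
          ← Complex.ofReal_mul, ← Complex.ofReal_sub]
        congr 1
        have e1 : Real.pi / (Real.pi / τ) = τ := by field_simp
        have e2 : -Real.pi ^ 2 * ‖ξ‖ ^ 2 / (Real.pi / τ) = -(Real.pi * τ) * ‖ξ‖ ^ 2 := by
          field_simp
        have e3 : τ ^ (-(d / 2 : ℝ) - 1) * τ ^ (d / 2 : ℝ) = τ⁻¹ := by
          rw [← Real.rpow_add hτ, ← Real.rpow_neg_one]; congr 1; ring
        rw [e1, e2]
        set E := Real.exp (-(Real.pi * τ) * ‖ξ‖ ^ 2)
        calc _ = (τ ^ (-(d / 2 : ℝ) - 1) * τ ^ (d / 2 : ℝ)) * E * (d / (2 * Real.pi) -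
              1 / τ * (d / (2 * (Real.pi / τ)) - Real.pi ^ 2 * ‖ξ‖ ^ 2 / (Real.pi / τ) ^ 2)) := by
              ring
          _ = _ := by
              rw [e3]; field_simp; ring

/-- A Gaussian bound for `heatLap`. -/
lemma abs_heatLap_le {d : ℕ} {τ : ℝ} (hτ : 0 < τ) (h : Space d) :
    |heatLap τ h| ≤ τ ^ (-(d / 2 : ℝ) - 1) *
      ((d + 1) * Real.exp (-(Real.pi / τ / 2) * ‖h‖ ^ 2)) := by
  have hb : 0 < Real.pi / τ := div_pos Real.pi_pos hτ
  have h1 := sq_mul_exp_neg_le (x := ‖h‖) hb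
  have hpi : 3 < Real.pi := Real.pi_gt_three
  set E := Real.exp (-(Real.pi / τ) * ‖h‖ ^ 2) with hE
  set E' := Real.exp (-(Real.pi / τ / 2) * ‖h‖ ^ 2) with hE'
  have hEE : E ≤ E' := by
    rw [hE, hE']
    apply Real.exp_le_exp.2
    have : 0 ≤ Real.pi / τ * ‖h‖ ^ 2 := by positivity
    nlinarith
  have hE0 : 0 < E := Real.exp_pos _
  unfold heatLap
  rw [abs_mul, abs_of_pos (Real.rpow_pos_of_pos hτ _)]
  gcongr
  have h2 : ‖h‖ ^ 2 / τ * E ≤ E' := by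
    calc _ = 1 / τ * (‖h‖ ^ 2 * E) := by ring
      _ ≤ 1 / τ * (2 / (Real.pi / τ) * E') := by gcongr
      _ = 2 / Real.pi * E' := by field_simp
      _ ≤ 1 * E' := by
          gcongr
          rw [div_le_one (by linarith)]; linarith
      _ = E' := one_mul _
  have h3 : (d : ℝ) / (2 * Real.pi) * E ≤ d * E' := by
    have : (d : ℝ) / (2 * Real.pi) ≤ d := div_le_self (Nat.cast_nonneg d) (by linarith)
    gcongr
  have h4 : 0 ≤ (d : ℝ) / (2 * Real.pi) * E := by positivity
  have h5 : 0 ≤ ‖h‖ ^ 2 / τ * E := by positivity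
  rw [← hE, sub_mul, abs_le]
  constructor <;> nlinarith

lemma integral_heatLap_bound {d : ℕ} {τ : ℝ} (hτ : 0 < τ) :
    ∫ h : Space d, τ ^ (-(d / 2 : ℝ) - 1) *
      ((d + 1) * Real.exp (-(Real.pi / τ / 2) * ‖h‖ ^ 2)) = (d + 1) * 2 ^ (d / 2 : ℝ) * τ⁻¹ := by
  have hb : 0 < Real.pi / τ / 2 := by positivity
  rw [integral_const_mul, integral_const_mul, GaussianFourier.integral_rexp_neg_mul_sq_norm hb,
    finrank_euclideanSpace_fin]
  have e1 : Real.pi / (Real.pi / τ / 2) = 2 * τ := by field_simp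
  have e3 : τ ^ (-(d / 2 : ℝ) - 1) * τ ^ (d / 2 : ℝ) = τ⁻¹ := by
    rw [← Real.rpow_add hτ, ← Real.rpow_neg_one]; congr 1; ring
  rw [e1, Real.mul_rpow (by norm_num) hτ.le, ← e3]
  ring

/-- Integrable at `0` because `a < 2`, at infinity because `a > 0`. The factor `(1 + r)⁻¹` is the
`L¹` size in `h` of `heatLap (1 + r)`, up to a constant. -/
lemma integrableOn_rpow_mul_inv {a : ℝ} (ha0 : 0 < a) (ha2 : a < 2) :
    IntegrableOn (fun r : ℝ => r ^ (-(a / 2)) * (1 + r)⁻¹) (Ioi 0) := by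
  rw [← Ioc_union_Ioi_eq_Ioi (zero_le_one' ℝ)]
  refine IntegrableOn.union ?_ ?_
  · have h1 : IntegrableOn (fun r : ℝ => r ^ (-(a / 2))) (Ioc 0 1) :=
      (intervalIntegrable_iff_integrableOn_Ioc_of_le zero_le_one).1
        (intervalIntegral.intervalIntegrable_rpow' (by linarith))
    refine h1.mono' (by fun_prop) ?_
    filter_upwards [ae_restrict_mem measurableSet_Ioc] with r hr
    have h0 : 0 < r := hr.1
    rw [Real.norm_of_nonneg (by positivity)]
    exact mul_le_of_le_one_right (by positivity) (inv_le_one_of_one_le₀ (by linarith))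
  · have h1 : IntegrableOn (fun r : ℝ => r ^ (-(a / 2) - 1)) (Ioi 1) :=
      integrableOn_Ioi_rpow_of_lt (by linarith) one_pos
    refine h1.mono' (by fun_prop) ?_
    filter_upwards [ae_restrict_mem measurableSet_Ioi] with r hr
    have h0 : 0 < r := one_pos.trans hr
    rw [Real.norm_of_nonneg (by positivity), Real.rpow_sub_one h0.ne',
      div_eq_mul_inv (r ^ _) r]
    gcongr
    linarith

lemma integrable_rpow_mul_heatLap {d : ℕ} {a : ℝ} (ha0 : 0 < a) (ha2 : a < 2) :
    Integrable (fun x : ℝ × Space d => x.1 ^ (-(a / 2)) * heatLap (1 + x.1) x.2)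
      ((volume.restrict (Ioi (0 : ℝ))).prod volume) := by
  have hm : Measurable fun x : ℝ × Space d => x.1 ^ (-(a / 2)) * ((1 + x.1) ^ (-(d / 2 : ℝ) - 1) *
      ((d + 1) * Real.exp (-(Real.pi / (1 + x.1) / 2) * ‖x.2‖ ^ 2))) := by fun_prop
  have hm' : Measurable fun x : ℝ × Space d => x.1 ^ (-(a / 2)) * heatLap (1 + x.1) x.2 := by
    unfold heatLap; fun_prop
  have hpos : ∀ᵐ x : ℝ × Space d ∂((volume.restrict (Ioi (0 : ℝ))).prod volume), 0 < x.1 := by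
    refine Measure.quasiMeasurePreserving_fst.ae ?_
    exact ae_restrict_mem measurableSet_Ioi
  have hI : Integrable (fun x : ℝ × Space d => x.1 ^ (-(a / 2)) * ((1 + x.1) ^ (-(d / 2 : ℝ) - 1) *
      ((d + 1) * Real.exp (-(Real.pi / (1 + x.1) / 2) * ‖x.2‖ ^ 2))))
      ((volume.restrict (Ioi (0 : ℝ))).prod volume) := by
    rw [integrable_prod_iff hm.aestronglyMeasurable]
    constructor
    · filter_upwards [ae_restrict_mem measurableSet_Ioi] with r hr
      have h0 : (0 : ℝ) < r := hr
      exact (((integrable_exp_neg_mul_sq_norm (by positivity)).const_mul _).const_mul _).const_mul _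
    · refine ((integrableOn_rpow_mul_inv ha0 ha2).const_mul
        ((d + 1) * 2 ^ (d / 2 : ℝ))).congr ?_
      filter_upwards [ae_restrict_mem measurableSet_Ioi] with r hr
      have h0 : (0 : ℝ) < r := hr
      calc _ = r ^ (-(a / 2)) * ((d + 1) * 2 ^ (d / 2 : ℝ) * (1 + r)⁻¹) := by ring
        _ = _ := by
          rw [← integral_heatLap_bound (d := d) (by linarith : 0 < 1 + r), ← integral_const_mul]
          refine integral_congr_ae (Filter.Eventually.of_forall fun h => ?_)
          simp only
          rw [Real.norm_of_nonneg (by positivity)]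
  refine hI.mono' hm'.aestronglyMeasurable ?_
  filter_upwards [hpos] with x hx
  rw [norm_mul, Real.norm_of_nonneg (Real.rpow_nonneg hx.le _), Real.norm_eq_abs]
  gcongr
  exact abs_heatLap_le (by linarith) _

/-- For `0 < a < 2` the Gaussian has a fractional derivative of order `a` that is bounded and
integrable. -/
theorem exists_kernel {d : ℕ} {a : ℝ} (ha0 : 0 < a) (ha2 : a < 2) :
    ∃ K : Space d → ℝ, Measurable K ∧ Integrable K ∧ (∃ M : ℝ, ∀ h, |K h| ≤ M) ∧
      ∀ ξ, 𝓕 (fun h => (K h : ℂ)) ξ = (((2 * Real.pi * ‖ξ‖) ^ a * gauss ξ : ℝ) : ℂ) := by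
  have hI := integrable_rpow_mul_heatLap (d := d) ha0 ha2
  have hg : 0 < 1 - a / 2 := by linarith
  set c : ℝ := Real.Gamma (1 - a / 2) * Real.pi ^ (a / 2 - 1) with hc
  have hc0 : 0 < c := mul_pos (Real.Gamma_pos_of_pos hg) (Real.rpow_pos_of_pos Real.pi_pos _)
  -- By the Gamma integral, `c |ξ|^a = ∫ r^(-a/2) |ξ|² exp(-π r |ξ|²) dr` over `r > 0`.
  -- Multiplication by the Gaussian replaces `r` by `1 + r` in the exponential, which keeps the heat
  -- kernels away from their singular time and makes `K₀` bounded and integrable.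
  set K₀ : Space d → ℝ := fun h => ∫ r in Ioi (0 : ℝ), r ^ (-(a / 2)) * heatLap (1 + r) h with hK₀
  have hm' : Measurable fun x : ℝ × Space d => x.1 ^ (-(a / 2)) * heatLap (1 + x.1) x.2 := by
    unfold heatLap; fun_prop
  have hKm : Measurable K₀ := by
    have := (hm'.comp measurable_swap).stronglyMeasurable.integral_prod_right'
      (ν := volume.restrict (Ioi (0 : ℝ)))
    exact this.measurable
  have hK₀I : Integrable K₀ := hI.integral_prod_right
  have hF : ∀ ξ, 𝓕 (fun h => (K₀ h : ℂ)) ξ = ((c * (‖ξ‖ ^ a * gauss ξ) : ℝ) : ℂ) := by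
    intro ξ
    rw [Real.fourier_eq']
    have hI2 : Integrable (fun x : ℝ × Space d =>
        Complex.exp (((-2 * Real.pi * inner ℝ x.2 ξ : ℝ) : ℂ) * Complex.I) •
        ((x.1 ^ (-(a / 2)) * heatLap (1 + x.1) x.2 : ℝ) : ℂ))
        ((volume.restrict (Ioi (0 : ℝ))).prod volume) :=
      integrable_cexp_mul_I_smul (by fun_prop) hI
    calc _ = ∫ h : Space d, ∫ r in Ioi (0 : ℝ),
          Complex.exp (((-2 * Real.pi * inner ℝ h ξ : ℝ) : ℂ) * Complex.I) •
          ((r ^ (-(a / 2)) * heatLap (1 + r) h : ℝ) : ℂ) := by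
          refine integral_congr_ae (Filter.Eventually.of_forall fun h => ?_)
          simp only
          rw [integral_smul, integral_complex_ofReal]
      _ = ∫ r in Ioi (0 : ℝ), ∫ h : Space d,
          Complex.exp (((-2 * Real.pi * inner ℝ h ξ : ℝ) : ℂ) * Complex.I) •
          ((r ^ (-(a / 2)) * heatLap (1 + r) h : ℝ) : ℂ) :=
          (integral_integral_swap hI2).symm
      _ = ∫ r in Ioi (0 : ℝ), ((r ^ ((1 - a / 2) - 1) *
          Real.exp (-((Real.pi * ‖ξ‖ ^ 2) * r)) * (‖ξ‖ ^ 2 * gauss ξ) : ℝ) : ℂ) := by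
          refine setIntegral_congr_fun measurableSet_Ioi fun r hr => ?_
          have h0 : (0 : ℝ) < r := hr
          have h1 := fourier_heatLap (d := d) (by linarith : 0 < 1 + r) ξ
          rw [Real.fourier_eq'] at h1
          calc _ = ((r ^ (-(a / 2)) : ℝ) : ℂ) * ∫ h : Space d,
                Complex.exp (((-2 * Real.pi * inner ℝ h ξ : ℝ) : ℂ) * Complex.I) •
                ((heatLap (1 + r) h : ℝ) : ℂ) := by
                rw [← integral_const_mul]
                refine integral_congr_ae (Filter.Eventually.of_forall fun h => ?_)
                simp only [smul_eq_mul]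
                push_cast
                ring
            _ = _ := by
                rw [h1, ← Complex.ofReal_mul]
                congr 1
                have e1 : Real.exp (-(Real.pi * (1 + r)) * ‖ξ‖ ^ 2) =
                    Real.exp (-((Real.pi * ‖ξ‖ ^ 2) * r)) * gauss ξ := by
                  unfold gauss
                  rw [← Real.exp_add]; congr 1; ring
                have e2 : -(a / 2) = (1 - a / 2) - 1 := by ring
                rw [e1, e2]; ring
      _ = _ := by
          rw [integral_complex_ofReal]
          congr 1
          rw [integral_mul_const]
          by_cases hξ : ‖ξ‖ = 0
          · simp [hξ, Real.zero_rpow ha0.ne']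
          have hξ0 : 0 < ‖ξ‖ := lt_of_le_of_ne (norm_nonneg _) (Ne.symm hξ)
          rw [Real.integral_rpow_mul_exp_neg_mul_Ioi hg (by positivity)]
          have e1 : (1 / (Real.pi * ‖ξ‖ ^ 2)) ^ (1 - a / 2) =
              Real.pi ^ (a / 2 - 1) * ‖ξ‖ ^ (a - 2) := by
            rw [one_div, Real.inv_rpow (by positivity), ← Real.rpow_neg (by positivity),
              Real.mul_rpow Real.pi_pos.le (by positivity), ← Real.rpow_natCast ‖ξ‖ 2,
              ← Real.rpow_mul hξ0.le]
            congr 2 <;> push_cast <;> ring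
          have e2 : ‖ξ‖ ^ (a - 2) * ‖ξ‖ ^ 2 = ‖ξ‖ ^ a := by
            rw [← Real.rpow_natCast ‖ξ‖ 2, ← Real.rpow_add hξ0]
            congr 1; push_cast; ring
          rw [e1, hc, ← e2]; ring
  refine ⟨fun h => (2 * Real.pi) ^ a / c * K₀ h, hKm.const_mul _, hK₀I.const_mul _, ?_, ?_⟩
  · refine ⟨(2 * Real.pi) ^ a / c * ∫ r in Ioi (0 : ℝ), (d + 1) * (r ^ (-(a / 2)) * (1 + r)⁻¹),
      fun h => ?_⟩
    rw [abs_mul, abs_of_nonneg (by positivity)]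
    gcongr
    rw [hK₀, ← Real.norm_eq_abs]
    refine norm_integral_le_of_norm_le ((integrableOn_rpow_mul_inv ha0 ha2).const_mul _) ?_
    filter_upwards [ae_restrict_mem measurableSet_Ioi] with r hr
    have h0 : (0 : ℝ) < r := hr
    rw [norm_mul, Real.norm_of_nonneg (by positivity), Real.norm_eq_abs]
    have h1 := abs_heatLap_le (by linarith : 0 < 1 + r) h
    have h2 : (1 + r) ^ (-(d / 2 : ℝ) - 1) ≤ (1 + r)⁻¹ := by
      rw [← Real.rpow_neg_one]
      apply Real.rpow_le_rpow_of_exponent_le (by linarith)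
      have : (0 : ℝ) ≤ d / 2 := by positivity
      linarith
    have h3 : Real.exp (-(Real.pi / (1 + r) / 2) * ‖h‖ ^ 2) ≤ 1 := by
      rw [Real.exp_le_one_iff, neg_mul, neg_nonpos]; positivity
    calc r ^ (-(a / 2)) * |heatLap (1 + r) h|
        ≤ r ^ (-(a / 2)) * ((1 + r)⁻¹ * ((d + 1) * 1)) := by
          gcongr
          refine h1.trans ?_
          gcongr
      _ = _ := by ring
  · intro ξ
    have h1 := hF ξ
    rw [Real.fourier_eq'] at h1 ⊢
    calc _ = (((2 * Real.pi) ^ a / c : ℝ) : ℂ) * ∫ h : Space d,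
          Complex.exp (((-2 * Real.pi * inner ℝ h ξ : ℝ) : ℂ) * Complex.I) • (K₀ h : ℂ) := by
          rw [← integral_const_mul]
          refine integral_congr_ae (Filter.Eventually.of_forall fun h => ?_)
          simp only [smul_eq_mul]
          push_cast
          ring
      _ = _ := by
          rw [h1, ← Complex.ofReal_mul]
          congr 1
          rw [Real.mul_rpow (by positivity) (norm_nonneg _)]
          field_simp

lemma fourier_gauss {d : ℕ} (ξ : Space d) :
    𝓕 (fun h : Space d => (gauss h : ℂ)) ξ = (gauss ξ : ℂ) := by
  have := fourier_exp_neg_mul_sq_norm Real.pi_pos ξ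
  unfold gauss
  rw [this, div_self Real.pi_ne_zero, Real.one_rpow, one_mul]
  congr 3
  field_simp

lemma fourier_gaussLap {d : ℕ} (ξ : Space d) :
    𝓕 (fun h : Space d => (gaussLap h : ℂ)) ξ =
      ((-((2 * Real.pi * ‖ξ‖) ^ 2 / (2 * Real.pi) * gauss ξ) : ℝ) : ℂ) := by
  have h1 := fourier_heatLap one_pos ξ
  rw [Real.fourier_eq'] at h1 ⊢
  calc _ = ((-(2 * Real.pi) : ℝ) : ℂ) * ∫ h : Space d,
          Complex.exp (((-2 * Real.pi * inner ℝ h ξ : ℝ) : ℂ) * Complex.I) •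
            ((heatLap 1 h : ℝ) : ℂ) := by
          rw [← integral_const_mul]
          refine integral_congr_ae (Filter.Eventually.of_forall fun h => ?_)
          have : gaussLap h = -(2 * Real.pi) * heatLap 1 h := by
            simp only [gaussLap, heatLap, gauss, Real.one_rpow, div_one]
            field_simp
            ring
          simp only [smul_eq_mul, this]
          push_cast
          ring
    _ = _ := by
        rw [h1, ← Complex.ofReal_mul]
        congr 1
        unfold gauss
        field_simp

end Kernels

/-! ### The fractional derivative of a test function of the velocity. -/

section RieszDerivative

/-- Averaging an inverse Fourier transform against a kernel. -/
lemma integral_mul_fourierInv {d : ℕ} {K M : Space d → ℂ} (hK : Integrable K) (hM : Integrable M)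
    (v : Space d) (β : ℝ) :
    ∫ h, K h * 𝓕⁻ M (v + β • h) =
      ∫ ξ, Complex.exp (((2 * Real.pi * inner ℝ ξ v : ℝ) : ℂ) * Complex.I) * M ξ *
        𝓕 K (-(β • ξ)) := by
  have hI : Integrable (fun x : Space d × Space d =>
      Complex.exp (((2 * Real.pi * inner ℝ x.2 (v + β • x.1) : ℝ) : ℂ) * Complex.I) *
        (K x.1 * M x.2)) (volume.prod volume) := by
    have h1 := hK.mul_prod hM
    refine h1.norm.mono' (AEStronglyMeasurable.mul (by fun_prop) h1.aestronglyMeasurable)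
      (Filter.Eventually.of_forall fun x => ?_)
    rw [norm_mul, Complex.norm_exp_ofReal_mul_I, one_mul]
  calc _ = ∫ h, ∫ ξ, Complex.exp (((2 * Real.pi * inner ℝ ξ (v + β • h) : ℝ) : ℂ) * Complex.I) *
        (K h * M ξ) := by
        refine integral_congr_ae (Filter.Eventually.of_forall fun h => ?_)
        simp only
        rw [Real.fourierInv_eq', ← integral_const_mul]
        refine integral_congr_ae (Filter.Eventually.of_forall fun ξ => ?_)
        simp only [smul_eq_mul]
        ring
    _ = ∫ ξ, ∫ h, Complex.exp (((2 * Real.pi * inner ℝ ξ (v + β • h) : ℝ) : ℂ) * Complex.I) *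
        (K h * M ξ) := integral_integral_swap hI
    _ = _ := by
        refine integral_congr_ae (Filter.Eventually.of_forall fun ξ => ?_)
        simp only
        rw [Real.fourier_eq', ← integral_const_mul]
        refine integral_congr_ae (Filter.Eventually.of_forall fun h => ?_)
        simp only [smul_eq_mul]
        have : Complex.exp (((2 * Real.pi * inner ℝ ξ (v + β • h) : ℝ) : ℂ) * Complex.I) =
            Complex.exp (((2 * Real.pi * inner ℝ ξ v : ℝ) : ℂ) * Complex.I) *
            Complex.exp (((-2 * Real.pi * inner ℝ h (-(β • ξ)) : ℝ) : ℂ) * Complex.I) := by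
          rw [← Complex.exp_add, ← add_mul, ← Complex.ofReal_add]
          congr 3
          rw [inner_add_right, inner_neg_right, inner_smul_right, inner_smul_right,
            real_inner_comm ξ h]
          ring
        rw [this]
        ring

variable {d : ℕ} {u : Space d → ℝ}

lemma exists_schwartz (hu : ContDiff ℝ ∞ u) (hc : HasCompactSupport u) :
    ∃ f : SchwartzMap (Space d) ℂ, ∀ v, f v = (u v : ℂ) :=
  ⟨(hc.comp_left Complex.ofReal_zero : HasCompactSupport (Complex.ofReal ∘ u)).toSchwartzMap
    (Complex.ofRealCLM.contDiff.comp hu), fun _ => rfl⟩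

lemma integrable_fourier_of_test (hu : ContDiff ℝ ∞ u) (hc : HasCompactSupport u) :
    Integrable (𝓕 fun v => (u v : ℂ)) := by
  obtain ⟨f, hf⟩ := exists_schwartz hu hc
  have : (fun v => (u v : ℂ)) = f := funext fun v => (hf v).symm
  rw [this, ← SchwartzMap.fourier_coe]
  exact (𝓕 f).integrable

lemma fourierInv_fourier_of_test (hu : ContDiff ℝ ∞ u) (hc : HasCompactSupport u) :
    𝓕⁻ (𝓕 fun v => (u v : ℂ)) = fun v => (u v : ℂ) := by
  have hcont : Continuous fun v => (u v : ℂ) := Complex.continuous_ofReal.comp hu.continuous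
  refine hcont.fourierInv_fourier_eq ?_ (integrable_fourier_of_test hu hc)
  exact hcont.integrable_of_hasCompactSupport (hc.comp_left Complex.ofReal_zero)

lemma integrable_rpow_mul_fourier_of_test {σ : ℝ} (hσ0 : 0 < σ) (hσ1 : σ < 1)
    (hu : ContDiff ℝ ∞ u) (hc : HasCompactSupport u) :
    Integrable fun ξ : Space d =>
      (((2 * Real.pi * ‖ξ‖) ^ σ : ℝ) : ℂ) * 𝓕 (fun v => (u v : ℂ)) ξ := by
  obtain ⟨f, hf⟩ := exists_schwartz hu hc
  have : (fun v => (u v : ℂ)) = f := funext fun v => (hf v).symm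
  rw [this, ← SchwartzMap.fourier_coe]
  have h0 := (𝓕 f).integrable (μ := volume)
  have h1 := (𝓕 f).integrable_pow_mul volume 1
  have hm : Continuous fun ξ : Space d => (2 * Real.pi * ‖ξ‖) ^ σ :=
    Continuous.rpow_const (by fun_prop) fun _ => Or.inr hσ0.le
  refine (h0.norm.add (h1.const_mul (2 * Real.pi))).mono'
    ((Complex.continuous_ofReal.comp hm).mul (𝓕 f).continuous).aestronglyMeasurable
    (Filter.Eventually.of_forall fun ξ => ?_)
  have hx : 0 ≤ 2 * Real.pi * ‖ξ‖ := by positivity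
  have h2 : (2 * Real.pi * ‖ξ‖) ^ σ ≤ 1 + 2 * Real.pi * ‖ξ‖ := by
    rcases le_total (2 * Real.pi * ‖ξ‖) 1 with h | h
    · exact (Real.rpow_le_one hx h hσ0.le).trans (by linarith)
    · calc _ ≤ (2 * Real.pi * ‖ξ‖) ^ (1 : ℝ) := Real.rpow_le_rpow_of_exponent_le h hσ1.le
        _ ≤ _ := by rw [Real.rpow_one]; linarith
  rw [norm_mul, Complex.norm_real, Real.norm_of_nonneg (by positivity)]
  simp only [Pi.add_apply, pow_one]
  calc _ ≤ (1 + 2 * Real.pi * ‖ξ‖) * ‖(𝓕 f) ξ‖ := by gcongr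
    _ = _ := by ring

/-- A fractional derivative can be moved from the test function to the averaging kernel. -/
lemma integral_mul_rieszDeriv {σ β : ℝ} (hσ0 : 0 < σ) (hσ1 : σ < 1) (hβ : 0 < β)
    (hu : ContDiff ℝ ∞ u) (hc : HasCompactSupport u) {K K' : Space d → ℝ} (hK : Integrable K)
    (hK' : Integrable K') (hKK' : ∀ ξ, 𝓕 (fun h => (K' h : ℂ)) ξ =
      (((2 * Real.pi * ‖ξ‖) ^ σ : ℝ) : ℂ) * 𝓕 (fun h => (K h : ℂ)) ξ) (v : Space d) :
    ∫ h, K h * (rieszDeriv σ (fun w => (u w : ℂ)) (v + β • h)).re =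
      β ^ (-σ) * ∫ h, K' h * u (v + β • h) := by
  have hKc : Integrable fun h => (K h : ℂ) := hK.ofReal
  have hKc' : Integrable fun h => (K' h : ℂ) := hK'.ofReal
  have e1 := integral_mul_fourierInv hKc (integrable_rpow_mul_fourier_of_test hσ0 hσ1 hu hc)
    v β
  have e2 := integral_mul_fourierInv hKc' (integrable_fourier_of_test hu hc) v β
  rw [fourierInv_fourier_of_test hu hc] at e2
  beta_reduce at e2
  have hre : ∀ w, rieszDeriv σ (fun w => (u w : ℂ)) w =
      ((rieszDeriv σ (fun w => (u w : ℂ)) w).re : ℂ) := fun w =>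
    Complex.ext rfl (by rw [rieszDeriv_ofReal_im, Complex.ofReal_im])
  have e3 : ((∫ h, K h * (rieszDeriv σ (fun w => (u w : ℂ)) (v + β • h)).re : ℝ) : ℂ) =
      ((β ^ (-σ) * ∫ h, K' h * u (v + β • h) : ℝ) : ℂ) := by
    rw [Complex.ofReal_mul, ← integral_complex_ofReal, ← integral_complex_ofReal]
    calc _ = ∫ h, (K h : ℂ) * 𝓕⁻ (fun ξ : Space d =>
          (((2 * Real.pi * ‖ξ‖) ^ σ : ℝ) : ℂ) * 𝓕 (fun v => (u v : ℂ)) ξ) (v + β • h) := by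
          refine integral_congr_ae (Filter.Eventually.of_forall fun h => ?_)
          simp only
          rw [Complex.ofReal_mul, ← hre]
          rfl
      _ = _ := e1
      -- The transform of the dilated kernel is evaluated at `-β ξ`, and `|β ξ|^σ = β^σ |ξ|^σ`; this
      -- is the source of `β^(-σ)`.
      _ = ((β ^ (-σ) : ℝ) : ℂ) * ∫ ξ, Complex.exp (((2 * Real.pi * inner ℝ ξ v : ℝ) : ℂ) *
          Complex.I) * 𝓕 (fun v => (u v : ℂ)) ξ * 𝓕 (fun h => (K' h : ℂ)) (-(β • ξ)) := by
          rw [← integral_const_mul]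
          refine integral_congr_ae (Filter.Eventually.of_forall fun ξ => ?_)
          simp only
          rw [hKK', norm_neg, norm_smul, Real.norm_of_nonneg hβ.le]
          have : (2 * Real.pi * (β * ‖ξ‖)) ^ σ = β ^ σ * (2 * Real.pi * ‖ξ‖) ^ σ := by
            rw [← Real.mul_rpow hβ.le (by positivity)]; congr 1; ring
          rw [this, Complex.ofReal_mul (β ^ σ)]
          have h2 : ((β ^ (-σ) : ℝ) : ℂ) * ((β ^ σ : ℝ) : ℂ) = 1 := by
            rw [← Complex.ofReal_mul, ← Real.rpow_add hβ]; simp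
          linear_combination (-(Complex.exp (((2 * Real.pi * inner ℝ ξ v : ℝ) : ℂ) *
            Complex.I) * 𝓕 (fun v => (u v : ℂ)) ξ * (((2 * Real.pi * ‖ξ‖) ^ σ : ℝ) : ℂ) *
              𝓕 (fun h => (K h : ℂ)) (-(β • ξ)))) * h2
      _ = ((β ^ (-σ) : ℝ) : ℂ) * ∫ h, (K' h : ℂ) * (u (v + β • h) : ℂ) := by rw [e2]
      _ = _ := by
          congr 1
          refine integral_congr_ae (Filter.Eventually.of_forall fun h => ?_)
          simp only
          rw [Complex.ofReal_mul]
  exact_mod_cast e3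

/-- The factor `min (√r) 1` is the size of a first difference of a bounded Lipschitz function at
scale `√r`. Integrability at `0` is `σ < 1`, at infinity it is `σ > 0`. -/
lemma integrableOn_rpow_mul_min {σ : ℝ} (hσ0 : 0 < σ) (hσ1 : σ < 1) :
    IntegrableOn (fun r : ℝ => r ^ (-1 - σ / 2) * min (Real.sqrt r) 1) (Ioi 0) := by
  rw [← Ioc_union_Ioi_eq_Ioi (zero_le_one' ℝ)]
  refine IntegrableOn.union ?_ ?_
  · have h1 : IntegrableOn (fun r : ℝ => r ^ (-1 / 2 - σ / 2)) (Ioc 0 1) :=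
      (intervalIntegrable_iff_integrableOn_Ioc_of_le zero_le_one).1
        (intervalIntegral.intervalIntegrable_rpow' (by linarith))
    refine h1.mono' (by fun_prop) ?_
    filter_upwards [ae_restrict_mem measurableSet_Ioc] with r hr
    have h0 : 0 < r := hr.1
    rw [Real.norm_of_nonneg (by positivity)]
    calc _ ≤ r ^ (-1 - σ / 2) * Real.sqrt r := by gcongr; exact min_le_left _ _
      _ = _ := by rw [Real.sqrt_eq_rpow, ← Real.rpow_add h0]; congr 1; ring
  · have h1 : IntegrableOn (fun r : ℝ => r ^ (-1 - σ / 2)) (Ioi 1) :=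
      integrableOn_Ioi_rpow_of_lt (by linarith) one_pos
    refine h1.mono' (by fun_prop) ?_
    filter_upwards [ae_restrict_mem measurableSet_Ioi] with r hr
    have h0 : 0 < r := one_pos.trans hr
    rw [Real.norm_of_nonneg (by positivity)]
    exact mul_le_of_le_one_right (by positivity) (min_le_right _ _)

lemma one_sub_exp_nonneg {x : ℝ} (hx : 0 ≤ x) : 0 ≤ 1 - Real.exp (-x) := by
  rw [sub_nonneg, Real.exp_le_one_iff]; linarith

lemma integrableOn_rpow_mul_one_sub_exp {σ : ℝ} (hσ0 : 0 < σ) (hσ1 : σ < 1) :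
    IntegrableOn (fun r : ℝ => r ^ (-1 - σ / 2) * (1 - Real.exp (-r))) (Ioi 0) := by
  refine (integrableOn_rpow_mul_min hσ0 hσ1).mono' (by fun_prop) ?_
  filter_upwards [ae_restrict_mem measurableSet_Ioi] with r hr
  have h0 : (0 : ℝ) < r := hr
  have h1 := one_sub_exp_nonneg h0.le
  rw [Real.norm_of_nonneg (by positivity)]
  gcongr
  have h2 : 1 - Real.exp (-r) ≤ 1 := by linarith [Real.exp_pos (-r)]
  refine le_min ?_ h2
  rcases le_total r 1 with h | h
  · have h3 : 1 - Real.exp (-r) ≤ r := by linarith [Real.add_one_le_exp (-r)]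
    refine h3.trans (Real.le_sqrt_of_sq_le ?_)
    nlinarith
  · exact h2.trans (Real.one_le_sqrt.2 h)

lemma integral_rpow_mul_one_sub_exp_pos {σ : ℝ} (hσ0 : 0 < σ) (hσ1 : σ < 1) :
    0 < ∫ r in Ioi (0 : ℝ), r ^ (-1 - σ / 2) * (1 - Real.exp (-r)) := by
  rw [setIntegral_pos_iff_support_of_nonneg_ae]
  · have : Ioi (0 : ℝ) ⊆ Function.support (fun r : ℝ => r ^ (-1 - σ / 2) * (1 - Real.exp (-r))) := by
      intro r hr
      have h0 : (0 : ℝ) < r := hr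
      refine mul_ne_zero (Real.rpow_pos_of_pos h0 _).ne' ?_
      have : Real.exp (-r) < 1 := by rw [Real.exp_lt_one_iff]; linarith
      linarith
    rw [inter_eq_right.2 this]
    simp
  · filter_upwards [ae_restrict_mem measurableSet_Ioi] with r hr
    have h0 : (0 : ℝ) < r := hr
    have h1 := one_sub_exp_nonneg h0.le
    simp only [Pi.zero_apply]
    positivity
  · exact integrableOn_rpow_mul_one_sub_exp hσ0 hσ1

lemma integral_rpow_mul_one_sub_exp_mul {σ a : ℝ} (hσ0 : 0 < σ) (ha : 0 ≤ a) :
    ∫ r in Ioi (0 : ℝ), r ^ (-1 - σ / 2) * (1 - Real.exp (-(a * r))) =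
      a ^ (σ / 2) * ∫ r in Ioi (0 : ℝ), r ^ (-1 - σ / 2) * (1 - Real.exp (-r)) := by
  rcases ha.eq_or_lt with rfl | ha
  · simp [Real.zero_rpow (by positivity : σ / 2 ≠ 0)]
  have h1 := integral_comp_mul_left_Ioi
    (fun r : ℝ => r ^ (-1 - σ / 2) * (1 - Real.exp (-r))) 0 ha
  rw [mul_zero, smul_eq_mul] at h1
  have h2 : ∫ r in Ioi (0 : ℝ), (a * r) ^ (-1 - σ / 2) * (1 - Real.exp (-(a * r))) =
      a ^ (-1 - σ / 2) * ∫ r in Ioi (0 : ℝ), r ^ (-1 - σ / 2) * (1 - Real.exp (-(a * r))) := by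
    rw [← integral_const_mul]
    refine setIntegral_congr_fun measurableSet_Ioi fun r hr => ?_
    rw [Real.mul_rpow ha.le (le_of_lt hr), mul_assoc]
  rw [h2] at h1
  have h3 : a ^ (σ / 2) * a * a ^ (-1 - σ / 2) = 1 := by
    rw [← Real.rpow_add_one ha.ne', ← Real.rpow_add ha]
    ring_nf; simp
  calc _ = (a ^ (σ / 2) * a * a ^ (-1 - σ / 2)) *
        ∫ r in Ioi (0 : ℝ), r ^ (-1 - σ / 2) * (1 - Real.exp (-(a * r))) := by rw [h3, one_mul]
    _ = a ^ (σ / 2) * a * (a⁻¹ * ∫ r in Ioi (0 : ℝ), r ^ (-1 - σ / 2) * (1 - Real.exp (-r))) := by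
        rw [← h1]; ring
    _ = _ := by field_simp

lemma integrableOn_rpow_mul_one_sub_exp_mul {σ a : ℝ} (hσ0 : 0 < σ) (hσ1 : σ < 1) (ha : 0 ≤ a) :
    IntegrableOn (fun r : ℝ => r ^ (-1 - σ / 2) * (1 - Real.exp (-(a * r)))) (Ioi 0) := by
  rcases ha.eq_or_lt with rfl | ha
  · simp
  have h1 := (integrableOn_Ioi_comp_mul_left_iff
    (fun r : ℝ => r ^ (-1 - σ / 2) * (1 - Real.exp (-r))) 0 ha).2
    (by rw [mul_zero]; exact integrableOn_rpow_mul_one_sub_exp hσ0 hσ1)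
  refine (h1.const_mul ((a ^ (-1 - σ / 2))⁻¹)).congr ?_
  filter_upwards [ae_restrict_mem measurableSet_Ioi] with r hr
  have : a ^ (-1 - σ / 2) ≠ 0 := (Real.rpow_pos_of_pos ha _).ne'
  rw [Real.mul_rpow ha.le (le_of_lt hr)]
  field_simp

/-- The fractional derivative as a superposition of Gaussian averages of first differences. -/
lemma exists_rieszDeriv_eq (d : ℕ) {σ : ℝ} (hσ0 : 0 < σ) (hσ1 : σ < 1) :
    ∃ c : ℝ, ∀ u : Space d → ℝ, ContDiff ℝ ∞ u → HasCompactSupport u → ∀ v,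
      (rieszDeriv σ (fun w => (u w : ℂ)) v).re =
        c * ∫ r in Ioi (0 : ℝ), r ^ (-1 - σ / 2) * ∫ k, gauss k * (u v - u (v + Real.sqrt r • k)) := by
  set I₁ : ℝ := ∫ r in Ioi (0 : ℝ), r ^ (-1 - σ / 2) * (1 - Real.exp (-r)) with hI₁
  have hI₁0 : 0 < I₁ := integral_rpow_mul_one_sub_exp_pos hσ0 hσ1
  -- `1 - exp(-π r |ξ|²)` is the symbol of the identity minus the Gaussian average at scale `√r`. By
  -- scaling, its integral against `r^(-1-σ/2)` is a multiple of `|ξ|^σ`, and `c` normalises it to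
  -- `(2π|ξ|)^σ`.
  set c : ℝ := (2 * Real.pi) ^ σ / (Real.pi ^ (σ / 2) * I₁) with hcdef
  refine ⟨c, fun u hu hc v => ?_⟩
  have hc0 : 0 < c := by positivity
  have hsymb : ∀ ξ : Space d, c * ∫ r in Ioi (0 : ℝ), r ^ (-1 - σ / 2) *
      (1 - Real.exp (-((Real.pi * ‖ξ‖ ^ 2) * r))) = (2 * Real.pi * ‖ξ‖) ^ σ := by
    intro ξ
    rw [integral_rpow_mul_one_sub_exp_mul hσ0 (by positivity), ← hI₁, hcdef,
      Real.mul_rpow Real.pi_pos.le (by positivity), Real.mul_rpow (by positivity) (norm_nonneg _),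
      ← Real.rpow_natCast ‖ξ‖ 2, ← Real.rpow_mul (norm_nonneg _)]
    have : ((2 : ℕ) : ℝ) * (σ / 2) = σ := by push_cast; ring
    rw [this]
    field_simp
  set U : Space d → ℂ := 𝓕 (fun w => (u w : ℂ)) with hU
  have hUI : Integrable U := integrable_fourier_of_test hu hc
  have hcont : Continuous u := hu.continuous
  have hinner : ∀ r : ℝ, 0 < r → ((∫ k, gauss k * (u v - u (v + Real.sqrt r • k)) : ℝ) : ℂ) =
      ∫ ξ, Complex.exp (((2 * Real.pi * inner ℝ ξ v : ℝ) : ℂ) * Complex.I) * U ξ *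
        ((1 - Real.exp (-((Real.pi * ‖ξ‖ ^ 2) * r)) : ℝ) : ℂ) := by
    intro r hr
    have hgc : Integrable fun k : Space d => (gauss k : ℂ) := integrable_gauss.ofReal
    have h1 := integral_mul_fourierInv hgc hUI v (Real.sqrt r)
    rw [hU, fourierInv_fourier_of_test hu hc] at h1
    have h2 : (u v : ℂ) = ∫ ξ, Complex.exp (((2 * Real.pi * inner ℝ ξ v : ℝ) : ℂ) * Complex.I) *
        U ξ := by
      have := congrFun (fourierInv_fourier_of_test hu hc) v
      rw [← this, Real.fourierInv_eq']
      rfl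
    obtain ⟨M, hM⟩ := hc.exists_bound_of_continuous hcont
    have i1 : Integrable fun k : Space d => gauss k * u v := integrable_gauss.mul_const _
    have i2 : Integrable fun k : Space d => gauss k * u (v + Real.sqrt r • k) :=
      integrable_gauss.mul_bdd (c := M) (by fun_prop)
        (Filter.Eventually.of_forall fun k => hM _)
    have j1 : Integrable fun ξ : Space d =>
        Complex.exp (((2 * Real.pi * inner ℝ ξ v : ℝ) : ℂ) * Complex.I) * U ξ := by
      refine hUI.norm.mono' (AEStronglyMeasurable.mul (by fun_prop) hUI.aestronglyMeasurable)
        (Filter.Eventually.of_forall fun ξ => ?_)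
      rw [norm_mul, Complex.norm_exp_ofReal_mul_I, one_mul]
    have hg : ∀ ξ : Space d, 𝓕 (fun h : Space d => (gauss h : ℂ)) (-(Real.sqrt r • ξ)) =
        (Real.exp (-((Real.pi * ‖ξ‖ ^ 2) * r)) : ℂ) := by
      intro ξ
      rw [fourier_gauss, gauss, norm_neg, norm_smul, Real.norm_of_nonneg (Real.sqrt_nonneg r),
        mul_pow, Real.sq_sqrt hr.le]
      push_cast
      congr 1
      ring
    have j2 : Integrable fun ξ : Space d =>
        Complex.exp (((2 * Real.pi * inner ℝ ξ v : ℝ) : ℂ) * Complex.I) * U ξ *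
          (Real.exp (-((Real.pi * ‖ξ‖ ^ 2) * r)) : ℂ) := by
      refine j1.mul_bdd (c := 1) (by fun_prop) (Filter.Eventually.of_forall fun ξ => ?_)
      rw [Complex.norm_real, Real.norm_of_nonneg (Real.exp_pos _).le, Real.exp_le_one_iff,
        neg_nonpos]
      positivity
    calc _ = ((u v - ∫ k, gauss k * u (v + Real.sqrt r • k) : ℝ) : ℂ) := by
          congr 1
          simp_rw [mul_sub]
          rw [integral_sub i1 i2, integral_mul_const, integral_gauss, one_mul]
      _ = (u v : ℂ) - ∫ k, (gauss k : ℂ) * (u (v + Real.sqrt r • k) : ℂ) := by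
          rw [Complex.ofReal_sub, ← integral_complex_ofReal]
          congr 2
          ext k
          push_cast
          rfl
      _ = (∫ ξ, Complex.exp (((2 * Real.pi * inner ℝ ξ v : ℝ) : ℂ) * Complex.I) * U ξ) -
          ∫ ξ, Complex.exp (((2 * Real.pi * inner ℝ ξ v : ℝ) : ℂ) * Complex.I) * U ξ *
            (Real.exp (-((Real.pi * ‖ξ‖ ^ 2) * r)) : ℂ) := by
          rw [h2]
          congr 1
          refine Eq.trans h1 ?_
          refine integral_congr_ae (Filter.Eventually.of_forall fun ξ => ?_)
          simp only
          rw [hg]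
      _ = _ := by
          rw [← integral_sub j1 j2]
          refine integral_congr_ae (Filter.Eventually.of_forall fun ξ => ?_)
          simp only
          push_cast
          ring
  have hprod : Integrable (fun x : Space d × ℝ =>
      (Complex.exp (((2 * Real.pi * inner ℝ x.1 v : ℝ) : ℂ) * Complex.I) * U x.1) *
        ((x.2 ^ (-1 - σ / 2) * (1 - Real.exp (-((Real.pi * ‖x.1‖ ^ 2) * x.2))) : ℝ) : ℂ))
      (volume.prod (volume.restrict (Ioi (0 : ℝ)))) := by
    have hUm : AEStronglyMeasurable (fun x : Space d × ℝ => U x.1)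
        (volume.prod (volume.restrict (Ioi (0 : ℝ)))) := hUI.aestronglyMeasurable.comp_fst
    have hm1 : Measurable fun x : Space d × ℝ =>
        Complex.exp (((2 * Real.pi * inner ℝ x.1 v : ℝ) : ℂ) * Complex.I) := by fun_prop
    have hm2 : Measurable fun x : Space d × ℝ =>
        ((x.2 ^ (-1 - σ / 2) * (1 - Real.exp (-((Real.pi * ‖x.1‖ ^ 2) * x.2))) : ℝ) : ℂ) := by
      fun_prop
    refine (integrable_prod_iff
      (by exact (hm1.aestronglyMeasurable.mul hUm).mul hm2.aestronglyMeasurable)).2 ⟨?_, ?_⟩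
    · refine Filter.Eventually.of_forall fun ξ => ?_
      have h1 : Integrable (fun r : ℝ => ((r ^ (-1 - σ / 2) *
          (1 - Real.exp (-((Real.pi * ‖ξ‖ ^ 2) * r))) : ℝ) : ℂ)) (volume.restrict (Ioi 0)) :=
        Integrable.ofReal (integrableOn_rpow_mul_one_sub_exp_mul hσ0 hσ1 (by positivity))
      exact h1.const_mul (Complex.exp (((2 * Real.pi * inner ℝ ξ v : ℝ) : ℂ) * Complex.I) * U ξ)
    · have h1 := (integrable_rpow_mul_fourier_of_test hσ0 hσ1 hu hc).norm.const_mul c⁻¹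
      refine h1.congr (Filter.Eventually.of_forall fun ξ => ?_)
      simp only
      rw [norm_mul, Complex.norm_real, Real.norm_of_nonneg (by positivity), ← hsymb ξ]
      calc _ = ‖U ξ‖ * ∫ r in Ioi (0 : ℝ), r ^ (-1 - σ / 2) *
            (1 - Real.exp (-((Real.pi * ‖ξ‖ ^ 2) * r))) := by field_simp; rfl
        _ = _ := by
          rw [← integral_const_mul]
          refine setIntegral_congr_fun measurableSet_Ioi fun r hr => ?_
          have h0 : (0 : ℝ) < r := hr
          have h2 := one_sub_exp_nonneg (x := Real.pi * ‖ξ‖ ^ 2 * r) (by positivity)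
          rw [norm_mul, norm_mul, Complex.norm_exp_ofReal_mul_I, one_mul, Complex.norm_real,
            Real.norm_of_nonneg (by positivity)]
  have hre : rieszDeriv σ (fun w => (u w : ℂ)) v =
      ((rieszDeriv σ (fun w => (u w : ℂ)) v).re : ℂ) :=
    Complex.ext rfl (by rw [rieszDeriv_ofReal_im, Complex.ofReal_im])
  have key : ((rieszDeriv σ (fun w => (u w : ℂ)) v).re : ℂ) = ((c * ∫ r in Ioi (0 : ℝ),
      r ^ (-1 - σ / 2) * ∫ k, gauss k * (u v - u (v + Real.sqrt r • k)) : ℝ) : ℂ) := by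
    rw [← hre, rieszDeriv, Real.fourierInv_eq', Complex.ofReal_mul, ← integral_complex_ofReal]
    calc _ = (c : ℂ) * ∫ ξ, ∫ r in Ioi (0 : ℝ),
          (Complex.exp (((2 * Real.pi * inner ℝ ξ v : ℝ) : ℂ) * Complex.I) * U ξ) *
          ((r ^ (-1 - σ / 2) * (1 - Real.exp (-((Real.pi * ‖ξ‖ ^ 2) * r))) : ℝ) : ℂ) := by
          rw [← integral_const_mul]
          refine integral_congr_ae (Filter.Eventually.of_forall fun ξ => ?_)
          simp only
          rw [integral_const_mul, integral_complex_ofReal, ← hsymb ξ, Complex.ofReal_mul c,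
            smul_eq_mul]
          ring
      _ = (c : ℂ) * ∫ r in Ioi (0 : ℝ), ∫ ξ,
          (Complex.exp (((2 * Real.pi * inner ℝ ξ v : ℝ) : ℂ) * Complex.I) * U ξ) *
          ((r ^ (-1 - σ / 2) * (1 - Real.exp (-((Real.pi * ‖ξ‖ ^ 2) * r))) : ℝ) : ℂ) := by
          rw [integral_integral_swap hprod]
      _ = _ := by
          congr 1
          refine setIntegral_congr_fun measurableSet_Ioi fun r hr => ?_
          rw [Complex.ofReal_mul, hinner r hr, ← integral_const_mul]
          refine integral_congr_ae (Filter.Eventually.of_forall fun ξ => ?_)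
          simp only
          rw [Complex.ofReal_mul (r ^ (-1 - σ / 2))]
          ring
  exact_mod_cast key

end RieszDerivative

/-! ### Measurability, boundedness and integrability of `velDeriv`. -/

section VelocityDerivative

variable {d : ℕ} {φ : Phase d → ℝ}

lemma IsTest.continuous (hφ : IsTest φ) : Continuous φ := hφ.1.continuous

lemma IsTest.memLp (hφ : IsTest φ) (r : ℝ≥0∞) : MemLp φ r :=
  hφ.continuous.memLp_of_hasCompactSupport hφ.2

lemma isClosedEmbedding_velocity (t : ℝ) (x : Space d) :
    Topology.IsClosedEmbedding fun w : Space d => ((t, x, w) : Phase d) := by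
  exact Function.LeftInverse.isClosedEmbedding (f := fun z : Phase d => z.2.2) (fun _ => rfl)
    (by fun_prop) (by fun_prop)

lemma IsTest.slice (hφ : IsTest φ) (t : ℝ) (x : Space d) :
    ContDiff ℝ ∞ (fun w => φ (t, x, w)) ∧ HasCompactSupport fun w => φ (t, x, w) :=
  ⟨hφ.1.comp (by fun_prop), hφ.2.comp_isClosedEmbedding (isClosedEmbedding_velocity t x)⟩

/-- This pointwise formula, not the Fourier definition, is what yields measurability, translation
covariance, boundedness and integrability jointly in `(t, x, v)`. -/
lemma exists_velDeriv_eq (d : ℕ) {σ : ℝ} (hσ0 : 0 < σ) (hσ1 : σ < 1) :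
    ∃ c : ℝ, ∀ φ : Phase d → ℝ, IsTest φ → ∀ z, velDeriv σ φ z =
      c * ∫ r in Ioi (0 : ℝ), r ^ (-1 - σ / 2) *
        ∫ k, gauss k * (φ z - φ (z + (0, 0, Real.sqrt r • k))) := by
  obtain ⟨c, hc⟩ := exists_rieszDeriv_eq d hσ0 hσ1
  refine ⟨c, fun φ hφ z => ?_⟩
  obtain ⟨h1, h2⟩ := hφ.slice z.1 z.2.1
  rw [velDeriv, hc _ h1 h2]
  simp [Prod.add_def]

lemma IsTest.comp_add (hφ : IsTest φ) (X : Phase d) : IsTest fun z => φ (z + X) :=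
  ⟨hφ.1.comp (by fun_prop), hφ.2.comp_homeomorph (Homeomorph.addRight X)⟩

lemma velDeriv_comp_add {σ : ℝ} (hσ0 : 0 < σ) (hσ1 : σ < 1) (hφ : IsTest φ) (X z : Phase d) :
    velDeriv σ (fun z => φ (z + X)) z = velDeriv σ φ (z + X) := by
  obtain ⟨c, hc⟩ := exists_velDeriv_eq d hσ0 hσ1
  rw [hc _ (hφ.comp_add X), hc _ hφ]
  simp_rw [add_right_comm z X]

lemma measurable_velDeriv {σ : ℝ} (hσ0 : 0 < σ) (hσ1 : σ < 1) (hφ : IsTest φ) :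
    Measurable (velDeriv σ φ) := by
  obtain ⟨c, hc⟩ := exists_velDeriv_eq d hσ0 hσ1
  have hcont := hφ.continuous
  have hg := continuous_gauss (d := d)
  have h1 : StronglyMeasurable fun x : (Phase d × ℝ) × Space d =>
      gauss x.2 * (φ x.1.1 - φ (x.1.1 + (0, 0, Real.sqrt x.1.2 • x.2))) :=
    Continuous.stronglyMeasurable (by fun_prop)
  have h2 : StronglyMeasurable fun x : Phase d × ℝ => x.2 ^ (-1 - σ / 2) *
      ∫ k, gauss k * (φ x.1 - φ (x.1 + (0, 0, Real.sqrt x.2 • k))) :=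
    StronglyMeasurable.mul (Measurable.stronglyMeasurable (by fun_prop)) h1.integral_prod_right
  have h3 : StronglyMeasurable fun z : Phase d => ∫ r in Ioi (0 : ℝ), r ^ (-1 - σ / 2) *
      ∫ k, gauss k * (φ z - φ (z + (0, 0, Real.sqrt r • k))) := h2.integral_prod_right
  rw [funext (hc φ hφ)]
  exact h3.measurable.const_mul c

lemma IsTest.exists_abs_sub_le (hφ : IsTest φ) : ∃ C : ℝ, 0 ≤ C ∧ ∀ (z : Phase d) (r : ℝ)
    (k : Space d), |φ z - φ (z + (0, 0, Real.sqrt r • k))| ≤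
      C * (min (Real.sqrt r) 1 * (2 + ‖k‖ ^ 2)) := by
  obtain ⟨L, hL⟩ := hφ.1.lipschitzWith_of_hasCompactSupport hφ.2 (by simp)
  obtain ⟨M, hM⟩ := hφ.2.exists_bound_of_continuous hφ.continuous
  have hM0 : 0 ≤ M := (norm_nonneg _).trans (hM 0)
  refine ⟨L + 2 * M, by positivity, fun z r k => ?_⟩
  have h0 := Real.sqrt_nonneg r
  have hk : ‖k‖ ≤ 2 + ‖k‖ ^ 2 := by nlinarith [sq_nonneg (‖k‖ - 1)]
  rcases le_total (Real.sqrt r) 1 with h | h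
  · rw [min_eq_left h, ← Real.norm_eq_abs, ← dist_eq_norm]
    calc _ ≤ L * dist z (z + (0, 0, Real.sqrt r • k)) := hL.dist_le_mul _ _
      _ = L * (Real.sqrt r * ‖k‖) := by
        rw [dist_self_add_right]
        simp [Prod.norm_def, norm_smul, abs_of_nonneg h0]
        left
        positivity
      _ ≤ (L + 2 * M) * (Real.sqrt r * (2 + ‖k‖ ^ 2)) := by gcongr; linarith
  · rw [min_eq_right h, one_mul, ← Real.norm_eq_abs]
    calc _ ≤ ‖φ z‖ + ‖φ (z + (0, 0, Real.sqrt r • k))‖ := norm_sub_le _ _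
      _ ≤ (0 + 2 * M) * (1 + 0) := by linarith [hM z, hM (z + (0, 0, Real.sqrt r • k))]
      _ ≤ _ := by
        gcongr
        · exact L.2
        · norm_num
        · positivity

lemma lintegral_rpow_gauss_ne_top {σ : ℝ} (hσ0 : 0 < σ) (hσ1 : σ < 1) :
    ∫⁻ x : ℝ × Space d, ENNReal.ofReal (x.1 ^ (-1 - σ / 2) * min (Real.sqrt x.1) 1 *
      ((2 + ‖x.2‖ ^ 2) * gauss x.2)) ∂((volume.restrict (Ioi (0 : ℝ))).prod volume) ≠ ⊤ := by
  have h1 : Integrable fun k : Space d => (2 + ‖k‖ ^ 2) * gauss k :=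
    ((integrable_gauss.const_mul 2).add (integrable_sq_norm_mul_exp Real.pi_pos)).congr
      (Filter.Eventually.of_forall fun k => by simp only [Pi.add_apply, gauss]; ring)
  exact ((integrableOn_rpow_mul_min hσ0 hσ1).mul_prod h1).lintegral_lt_top.ne

lemma exists_enorm_velDeriv_le (d : ℕ) {σ : ℝ} (hσ0 : 0 < σ) (hσ1 : σ < 1) :
    ∃ c : ℝ≥0∞, c ≠ ⊤ ∧ ∀ φ : Phase d → ℝ, IsTest φ → ∀ z, ‖velDeriv σ φ z‖ₑ ≤
      c * ∫⁻ x : ℝ × Space d, ENNReal.ofReal (x.1 ^ (-1 - σ / 2) * gauss x.2) *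
        ‖φ z - φ (z + (0, 0, Real.sqrt x.1 • x.2))‖ₑ
          ∂((volume.restrict (Ioi (0 : ℝ))).prod volume) := by
  obtain ⟨c, hc⟩ := exists_velDeriv_eq d hσ0 hσ1
  refine ⟨‖c‖ₑ, enorm_ne_top, fun φ hφ z => ?_⟩
  have hcont := hφ.continuous
  have hg := continuous_gauss (d := d)
  rw [hc φ hφ, enorm_mul, lintegral_prod _ (by fun_prop)]
  gcongr
  refine (enorm_integral_le_lintegral_enorm _).trans
    (setLIntegral_mono' measurableSet_Ioi fun r hr => ?_)
  have hr0 : (0 : ℝ) < r := hr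
  rw [enorm_mul, Real.enorm_of_nonneg (by positivity)]
  calc _ ≤ ENNReal.ofReal (r ^ (-1 - σ / 2)) *
        ∫⁻ k, ‖gauss k * (φ z - φ (z + (0, 0, Real.sqrt r • k)))‖ₑ := by
        gcongr; exact enorm_integral_le_lintegral_enorm _
    _ = _ := by
        rw [← lintegral_const_mul' _ _ ENNReal.ofReal_ne_top]
        refine lintegral_congr fun k => ?_
        rw [enorm_mul, ENNReal.ofReal_mul (by positivity), Real.enorm_of_nonneg (gauss_pos k).le,
          mul_assoc]

lemma exists_abs_velDeriv_le {σ : ℝ} (hσ0 : 0 < σ) (hσ1 : σ < 1) (hφ : IsTest φ) :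
    ∃ M : ℝ, ∀ z, |velDeriv σ φ z| ≤ M := by
  obtain ⟨c, hc, H⟩ := exists_enorm_velDeriv_le d hσ0 hσ1
  obtain ⟨C, hC0, hC⟩ := hφ.exists_abs_sub_le
  have hW := lintegral_rpow_gauss_ne_top (d := d) hσ0 hσ1
  set W := ∫⁻ x : ℝ × Space d, ENNReal.ofReal (x.1 ^ (-1 - σ / 2) * min (Real.sqrt x.1) 1 *
      ((2 + ‖x.2‖ ^ 2) * gauss x.2)) ∂((volume.restrict (Ioi (0 : ℝ))).prod volume) with hWdef
  have hT : c * (ENNReal.ofReal C * W) ≠ ⊤ :=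
    ENNReal.mul_ne_top hc (ENNReal.mul_ne_top ENNReal.ofReal_ne_top hW)
  refine ⟨(c * (ENNReal.ofReal C * W)).toReal, fun z => ?_⟩
  rw [← Real.norm_eq_abs, ← toReal_enorm]
  refine ENNReal.toReal_mono hT ((H φ hφ z).trans ?_)
  gcongr
  rw [hWdef, ← lintegral_const_mul' _ _ ENNReal.ofReal_ne_top]
  refine lintegral_mono_ae ?_
  have : ∀ᵐ x : ℝ × Space d ∂((volume.restrict (Ioi (0 : ℝ))).prod volume), 0 < x.1 :=
    Measure.quasiMeasurePreserving_fst.ae (ae_restrict_mem measurableSet_Ioi)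
  filter_upwards [this] with x hx
  have := gauss_pos x.2
  rw [Real.enorm_eq_ofReal_abs, ← ENNReal.ofReal_mul (by positivity),
    ← ENNReal.ofReal_mul hC0]
  refine ENNReal.ofReal_le_ofReal ?_
  calc _ ≤ x.1 ^ (-1 - σ / 2) * gauss x.2 *
        (C * (min (Real.sqrt x.1) 1 * (2 + ‖x.2‖ ^ 2))) := by gcongr; exact hC _ _ _
    _ = _ := by ring

/-- A first difference of `φ` vanishes unless one of its two points lies in the support. Its
integral in `z` is therefore at most twice the volume of the support times its supremum, and no
pointwise decay in `v` is required. -/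
lemma integrable_velDeriv {σ : ℝ} (hσ0 : 0 < σ) (hσ1 : σ < 1) (hφ : IsTest φ) :
    Integrable (velDeriv σ φ) := by
  obtain ⟨c, hc, H⟩ := exists_enorm_velDeriv_le d hσ0 hσ1
  obtain ⟨C, hC0, hC⟩ := hφ.exists_abs_sub_le
  have hcont := hφ.continuous
  have hg := continuous_gauss (d := d)
  have hW := lintegral_rpow_gauss_ne_top (d := d) hσ0 hσ1
  set W := ∫⁻ x : ℝ × Space d, ENNReal.ofReal (x.1 ^ (-1 - σ / 2) * min (Real.sqrt x.1) 1 *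
      ((2 + ‖x.2‖ ^ 2) * gauss x.2)) ∂((volume.restrict (Ioi (0 : ℝ))).prod volume) with hWdef
  have hKm : MeasurableSet (tsupport φ) := (isClosed_tsupport φ).measurableSet
  have hKv : volume (tsupport φ) ≠ ⊤ := hφ.2.isCompact.measure_lt_top.ne
  set I : Phase d → ℝ≥0∞ := (tsupport φ).indicator 1 with hI
  have hIm : Measurable I := measurable_one.indicator hKm
  have hI1 : ∫⁻ z, I z = volume (tsupport φ) := by
    rw [hI, lintegral_indicator_one hKm]
  have hT : c * ((2 * volume (tsupport φ) * ENNReal.ofReal C) * W) ≠ ⊤ := by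
    refine ENNReal.mul_ne_top hc (ENNReal.mul_ne_top (ENNReal.mul_ne_top
      (ENNReal.mul_ne_top (by simp) hKv) ENNReal.ofReal_ne_top) hW)
  refine ⟨(measurable_velDeriv hσ0 hσ1 hφ).aestronglyMeasurable, lt_of_le_of_lt ?_ hT.lt_top⟩
  have hdiff : ∀ z X : Phase d, ‖φ z - φ (z + X)‖ₑ ≤ ‖φ z - φ (z + X)‖ₑ * (I z + I (z + X)) := by
    intro z X
    by_cases h1 : z ∈ tsupport φ
    · refine le_mul_of_one_le_right' ?_
      rw [hI, indicator_of_mem h1]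
      exact le_self_add
    by_cases h2 : z + X ∈ tsupport φ
    · refine le_mul_of_one_le_right' ?_
      rw [hI, indicator_of_mem h2]
      exact le_add_self
    · rw [image_eq_zero_of_notMem_tsupport h1, image_eq_zero_of_notMem_tsupport h2]
      simp
  calc ∫⁻ z, ‖velDeriv σ φ z‖ₑ
      ≤ ∫⁻ z, c * ∫⁻ x : ℝ × Space d, ENNReal.ofReal (x.1 ^ (-1 - σ / 2) * gauss x.2) *
        ‖φ z - φ (z + (0, 0, Real.sqrt x.1 • x.2))‖ₑ
          ∂((volume.restrict (Ioi (0 : ℝ))).prod volume) := lintegral_mono (H φ hφ)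
    _ = c * ∫⁻ x : ℝ × Space d, (∫⁻ z, ENNReal.ofReal (x.1 ^ (-1 - σ / 2) * gauss x.2) *
        ‖φ z - φ (z + (0, 0, Real.sqrt x.1 • x.2))‖ₑ)
          ∂((volume.restrict (Ioi (0 : ℝ))).prod volume) := by
        rw [lintegral_const_mul' _ _ hc, lintegral_lintegral_swap]
        exact Measurable.aemeasurable (by fun_prop)
    _ ≤ c * ∫⁻ x : ℝ × Space d, (2 * volume (tsupport φ) * ENNReal.ofReal C) *
          ENNReal.ofReal (x.1 ^ (-1 - σ / 2) * min (Real.sqrt x.1) 1 *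
          ((2 + ‖x.2‖ ^ 2) * gauss x.2)) ∂((volume.restrict (Ioi (0 : ℝ))).prod volume) := by
        refine mul_le_mul' le_rfl (lintegral_mono_ae ?_)
        have : ∀ᵐ x : ℝ × Space d ∂((volume.restrict (Ioi (0 : ℝ))).prod volume), 0 < x.1 :=
          Measure.quasiMeasurePreserving_fst.ae (ae_restrict_mem measurableSet_Ioi)
        filter_upwards [this] with x hx
        have hgp := gauss_pos x.2
        calc _ ≤ ∫⁻ z, ENNReal.ofReal (x.1 ^ (-1 - σ / 2) * gauss x.2) * (ENNReal.ofReal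
              (C * (min (Real.sqrt x.1) 1 * (2 + ‖x.2‖ ^ 2))) *
                (I z + I (z + (0, 0, Real.sqrt x.1 • x.2)))) := by
              refine lintegral_mono fun z => mul_le_mul' le_rfl ((hdiff _ _).trans ?_)
              gcongr
              rw [Real.enorm_eq_ofReal_abs]
              exact ENNReal.ofReal_le_ofReal (hC _ _ _)
          _ = ENNReal.ofReal (x.1 ^ (-1 - σ / 2) * gauss x.2) * (ENNReal.ofReal
              (C * (min (Real.sqrt x.1) 1 * (2 + ‖x.2‖ ^ 2))) *
                (volume (tsupport φ) + volume (tsupport φ))) := by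
              rw [lintegral_const_mul' _ _ ENNReal.ofReal_ne_top,
                lintegral_const_mul' _ _ ENNReal.ofReal_ne_top, lintegral_add_left hIm,
                lintegral_add_right_eq_self I, hI1]
          _ = (volume (tsupport φ) + volume (tsupport φ)) * (ENNReal.ofReal
              (x.1 ^ (-1 - σ / 2) * gauss x.2) * ENNReal.ofReal
              (C * (min (Real.sqrt x.1) 1 * (2 + ‖x.2‖ ^ 2)))) := by ring
          _ = _ := by
              rw [← ENNReal.ofReal_mul (by positivity), ← two_mul, mul_assoc (2 * _),
                ← ENNReal.ofReal_mul hC0]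
              congr 2
              ring
    _ = _ := by rw [lintegral_const_mul' _ _ (by finiteness)]

lemma memLp_of_integrable_of_abs_le {α : Type*} [MeasurableSpace α] {ν : Measure α} {u : α → ℝ}
    (hu : Integrable u ν) {M : ℝ} (hM : ∀ x, |u x| ≤ M) {r : ℝ} (hr : 1 ≤ r) :
    MemLp u (ENNReal.ofReal r) ν := by
  have hr0 : 0 < r := by linarith
  refine ⟨hu.aestronglyMeasurable, ?_⟩
  rw [eLpNorm_lt_top_iff_lintegral_rpow_enorm_lt_top (by simpa using hr0) ENNReal.ofReal_ne_top,
    ENNReal.toReal_ofReal hr0.le]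
  calc _ ≤ ∫⁻ x, ENNReal.ofReal M ^ (r - 1) * ‖u x‖ₑ ∂ν := by
        refine lintegral_mono fun x => ?_
        have : ‖u x‖ₑ ^ r = ‖u x‖ₑ ^ (r - 1) * ‖u x‖ₑ := by
          have h1 := ENNReal.rpow_add_of_nonneg (x := ‖u x‖ₑ) (r - 1) 1 (by linarith) zero_le_one
          rwa [sub_add_cancel, ENNReal.rpow_one] at h1
        simp only
        rw [this]
        refine mul_le_mul' (ENNReal.rpow_le_rpow ?_ (by linarith)) le_rfl
        rw [Real.enorm_eq_ofReal_abs]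
        exact ENNReal.ofReal_le_ofReal (hM x)
    _ = ENNReal.ofReal M ^ (r - 1) * ∫⁻ x, ‖u x‖ₑ ∂ν :=
        lintegral_const_mul' _ _ (ENNReal.rpow_ne_top_of_nonneg (by linarith) ENNReal.ofReal_ne_top)
    _ < ⊤ := ENNReal.mul_lt_top (ENNReal.rpow_lt_top_of_nonneg (by linarith)
        ENNReal.ofReal_ne_top) hu.2

lemma IsTest.memLp_velDeriv {σ : ℝ} (hσ0 : 0 < σ) (hσ1 : σ < 1) (hφ : IsTest φ) {r : ℝ}
    (hr : 1 ≤ r) : MemLp (velDeriv σ φ) (ENNReal.ofReal r) := by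
  obtain ⟨M, hM⟩ := exists_abs_velDeriv_le hσ0 hσ1 hφ
  exact memLp_of_integrable_of_abs_le (integrable_velDeriv hσ0 hσ1 hφ) hM hr

end VelocityDerivative

/-! ### The flow, and transfer of the velocity derivative to the averaging kernel. -/

section Transfer

variable {d : ℕ} {φ ψ : Phase d → ℝ}

/-- The displacement of `flow` read at its starting point. -/
def shift {d : ℕ} (β α μ : ℝ) (η : Space d × Space d) : Phase d :=
  (0, -(μ • η.2), β • η.1 + α • η.2)

lemma continuous_shift (β α μ : ℝ) : Continuous (shift (d := d) β α μ) := by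
  unfold shift; fun_prop

/-- Displacing before the transport instead of after it. In this form `η.1` enters the velocity
alone, which is why averaging over it can absorb a derivative in `v`. -/
lemma flow_displacement_eq_shift (s β α μ : ℝ) (η : Space d × Space d) (z : Phase d) :
    flow s (displacement s β α μ η) z = flow s 0 (z + shift β α μ η) := by
  simp only [flow, displacement, shift, Prod.fst_add, Prod.snd_add, Prod.fst_zero, Prod.snd_zero,
    add_zero, smul_add]
  congr 2
  abel

lemma contDiff_flow (s : ℝ) (X : Space d × Space d) : ContDiff ℝ ∞ (flow s X) := by
  unfold flow; fun_prop

lemma isClosedEmbedding_flow (s : ℝ) (X : Space d × Space d) :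
    Topology.IsClosedEmbedding (flow s X) := by
  refine Function.LeftInverse.isClosedEmbedding
    (f := fun y : Phase d => (y.1 - s, y.2.1 - s • (y.2.2 - X.2) - X.1, y.2.2 - X.2))
    (fun z => ?_) (by fun_prop) (continuous_flow s X)
  simp [flow, add_sub_right_comm]

lemma IsTest.comp_flow (hψ : IsTest ψ) (s : ℝ) (X : Space d × Space d) :
    IsTest fun z => ψ (flow s X z) :=
  ⟨hψ.1.comp (contDiff_flow s X), hψ.2.comp_isClosedEmbedding (isClosedEmbedding_flow s X)⟩

/-- The inverse of the flow is jointly continuous in time, displacement and endpoint. The resulting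
compact set supports the dominating functions used for differentiation and limits in `s`. -/
lemma exists_isCompact_of_flow_mem {K : Set (Phase d)} (hK : IsCompact K) (R : ℝ) :
    ∃ K' : Set (Phase d), IsCompact K' ∧ ∀ s X z, |s| ≤ R → ‖X‖ ≤ R → flow s X z ∈ K → z ∈ K' := by
  refine ⟨(fun x : ℝ × (Space d × Space d) × Phase d =>
    (x.2.2.1 - x.1, x.2.2.2.1 - x.1 • (x.2.2.2.2 - x.2.1.2) - x.2.1.1, x.2.2.2.2 - x.2.1.2)) ''
      (Metric.closedBall 0 R ×ˢ Metric.closedBall 0 R ×ˢ K),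
    ((isCompact_closedBall _ _).prod ((isCompact_closedBall _ _).prod hK)).image (by fun_prop), ?_⟩
  intro s X z hs hX hz
  refine ⟨(s, X, flow s X z), ⟨by simpa using hs, by simpa using hX, hz⟩, ?_⟩
  simp [flow, add_sub_right_comm]

lemma lintegral_comp_flow {g : Phase d → ℝ≥0∞} (hg : Measurable g) (s : ℝ)
    (X : Space d × Space d) : ∫⁻ z, g (flow s X z) = ∫⁻ z, g z := by
  have hm : Measurable fun z => g (flow s X z) := hg.comp (continuous_flow s X).measurable
  rw [Measure.volume_eq_prod ℝ (Space d × Space d), lintegral_prod_symm _ hm.aemeasurable,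
    lintegral_prod_symm _ hg.aemeasurable]
  have h1 : ∀ Y : Space d × Space d, ∫⁻ t : ℝ, g (flow s X (t, Y)) =
      ∫⁻ t : ℝ, g (t, Y.1 + s • Y.2 + X.1, Y.2 + X.2) := fun Y =>
    lintegral_add_right_eq_self (fun t : ℝ => g (t, Y.1 + s • Y.2 + X.1, Y.2 + X.2)) s
  simp_rw [h1]
  have hG : Measurable fun Y : Space d × Space d => ∫⁻ t : ℝ, g (t, Y) := by
    exact hg.lintegral_prod_left'
  have hG' : Measurable fun Y : Space d × Space d =>
      ∫⁻ t : ℝ, g (t, Y.1 + s • Y.2 + X.1, Y.2 + X.2) := by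
    have : Measurable fun Y : Space d × Space d => (Y.1 + s • Y.2 + X.1, Y.2 + X.2) := by fun_prop
    exact hG.comp this
  rw [Measure.volume_eq_prod, lintegral_prod_symm _ hG'.aemeasurable,
    lintegral_prod_symm _ hG.aemeasurable]
  have h2 : ∀ v : Space d, ∫⁻ x : Space d, ∫⁻ t : ℝ, g (t, x + s • v + X.1, v + X.2) =
      ∫⁻ x : Space d, ∫⁻ t : ℝ, g (t, x, v + X.2) := fun v => by
    simp_rw [add_assoc]
    exact lintegral_add_right_eq_self (fun x : Space d => ∫⁻ t : ℝ, g (t, x, v + X.2)) _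
  simp_rw [h2]
  exact lintegral_add_right_eq_self (fun v : Space d => ∫⁻ x : Space d, ∫⁻ t : ℝ, g (t, x, v)) _

section Hoelder

variable {p p' : ℝ} {a b : Phase d → ℝ}

lemma eLpNorm_ofReal_eq {α : Type*} [MeasurableSpace α] {ν : Measure α} {u : α → ℝ} {p : ℝ}
    (hp : 0 < p) : eLpNorm u (ENNReal.ofReal p) ν = (∫⁻ z, ‖u z‖ₑ ^ p ∂ν) ^ (1 / p) := by
  rw [eLpNorm_eq_lintegral_rpow_enorm_toReal (by simpa using hp) ENNReal.ofReal_ne_top,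
    ENNReal.toReal_ofReal hp.le]

lemma lintegral_mul_comp_le (hpp : p.HolderConjugate p') (ha : Measurable a) (hb : Measurable b)
    {T : Phase d → Phase d} (hT : Measurable T)
    (hTi : ∀ g : Phase d → ℝ≥0∞, Measurable g → ∫⁻ z, g (T z) = ∫⁻ z, g z) :
    ∫⁻ z, ‖a z‖ₑ * ‖b (T z)‖ₑ ≤ eLpNorm a (ENNReal.ofReal p) volume *
      eLpNorm b (ENNReal.ofReal p') volume := by
  have hb' : Measurable fun z => b (T z) := hb.comp hT
  refine (ENNReal.lintegral_mul_le_Lp_mul_Lq volume hpp ha.enorm.aemeasurable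
    hb'.enorm.aemeasurable).trans ?_
  rw [eLpNorm_ofReal_eq hpp.pos, eLpNorm_ofReal_eq hpp.symm.pos,
    hTi (fun z => ‖b z‖ₑ ^ p') (hb.enorm.pow_const _)]

lemma integrable_mul_comp (hpp : p.HolderConjugate p') (ha : Measurable a) (hb : Measurable b)
    (hap : MemLp a (ENNReal.ofReal p)) (hbp : MemLp b (ENNReal.ofReal p'))
    {T : Phase d → Phase d} (hT : Measurable T)
    (hTi : ∀ g : Phase d → ℝ≥0∞, Measurable g → ∫⁻ z, g (T z) = ∫⁻ z, g z) :
    Integrable fun z => a z * b (T z) := by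
  refine ⟨(ha.mul (hb.comp hT)).aestronglyMeasurable, ?_⟩
  refine lt_of_le_of_lt ?_ (ENNReal.mul_lt_top hap.2 hbp.2)
  refine le_trans (le_of_eq ?_) (lintegral_mul_comp_le hpp ha hb hT hTi)
  simp_rw [enorm_mul]

lemma norm_integral_mul_comp_le (hpp : p.HolderConjugate p') (ha : Measurable a)
    (hb : Measurable b) (hap : MemLp a (ENNReal.ofReal p)) (hbp : MemLp b (ENNReal.ofReal p'))
    {T : Phase d → Phase d} (hT : Measurable T)
    (hTi : ∀ g : Phase d → ℝ≥0∞, Measurable g → ∫⁻ z, g (T z) = ∫⁻ z, g z) :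
    ∫ z, ‖a z * b (T z)‖ ≤ (eLpNorm a (ENNReal.ofReal p) volume *
      eLpNorm b (ENNReal.ofReal p') volume).toReal := by
  have h1 := integrable_mul_comp hpp ha hb hap hbp hT hTi
  rw [integral_norm_eq_lintegral_enorm h1.1]
  refine ENNReal.toReal_mono (ENNReal.mul_lt_top hap.2 hbp.2).ne ?_
  refine le_trans (le_of_eq ?_) (lintegral_mul_comp_le hpp ha hb hT hTi)
  simp_rw [enorm_mul]

lemma integrable_prod_mul_comp_add (hpp : p.HolderConjugate p') (ha : Measurable a)
    (hb : Measurable b) (hap : MemLp a (ENNReal.ofReal p)) (hbp : MemLp b (ENNReal.ofReal p'))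
    {k : Space d × Space d → ℝ} (hk : Integrable k) {X : Space d × Space d → Phase d}
    (hX : Continuous X) :
    Integrable (fun x : (Space d × Space d) × Phase d => k x.1 * (a x.2 * b (x.2 + X x.1)))
      (volume.prod volume) := by
  have hXm := hX.measurable
  have hm : Measurable fun x : (Space d × Space d) × Phase d => a x.2 * b (x.2 + X x.1) := by
    fun_prop
  have hmk : AEStronglyMeasurable (fun x : (Space d × Space d) × Phase d =>
      k x.1 * (a x.2 * b (x.2 + X x.1))) (volume.prod volume) :=
    hk.aestronglyMeasurable.comp_fst.mul hm.aestronglyMeasurable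
  have hT : ∀ η, Measurable fun z : Phase d => z + X η := fun η => measurable_add_const _
  have hTi : ∀ η, ∀ g : Phase d → ℝ≥0∞, Measurable g → ∫⁻ z, g (z + X η) = ∫⁻ z, g z :=
    fun η g _ => lintegral_add_right_eq_self g (X η)
  refine (integrable_prod_iff hmk).2 ⟨Filter.Eventually.of_forall fun η =>
    (integrable_mul_comp hpp ha hb hap hbp (hT η) (hTi η)).const_mul (k η), ?_⟩
  refine (hk.norm.mul_const (eLpNorm a (ENNReal.ofReal p) volume *
      eLpNorm b (ENNReal.ofReal p') volume).toReal).mono' hmk.norm.integral_prod_right'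
      (Filter.Eventually.of_forall fun η => ?_)
  rw [Real.norm_of_nonneg (integral_nonneg fun _ => norm_nonneg _)]
  simp_rw [norm_mul (k η)]
  rw [integral_const_mul]
  gcongr
  exact norm_integral_mul_comp_le hpp ha hb hap hbp (hT η) (hTi η)

/-- The fractional derivative in an average over displacements is moved to the kernel. -/
lemma integral_kernel_mul_velDeriv {σ β α μ : ℝ} (hσ0 : 0 < σ) (hσ1 : σ < 1) (hβ : 0 < β)
    (hpp : p.HolderConjugate p') (ha : Measurable a) (hap : MemLp a (ENNReal.ofReal p))
    (hφ : IsTest φ) {K K' : Space d → ℝ} (hK : Integrable K)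
    (hK' : Integrable K') (hKK' : ∀ ξ, 𝓕 (fun h => (K' h : ℂ)) ξ =
      (((2 * Real.pi * ‖ξ‖) ^ σ : ℝ) : ℂ) * 𝓕 (fun h => (K h : ℂ)) ξ) :
    ∫ η : Space d × Space d, K η.1 * gauss η.2 * ∫ z, a z * velDeriv σ φ (z + shift β α μ η) =
      β ^ (-σ) * ∫ η : Space d × Space d, K' η.1 * gauss η.2 *
        ∫ z, a z * φ (z + shift β α μ η) := by
  have hφm := hφ.continuous.measurable
  have hvm := measurable_velDeriv hσ0 hσ1 hφ
  have hvp := hφ.memLp_velDeriv hσ0 hσ1 hpp.symm.lt.le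
  have hX := continuous_shift (d := d) β α μ
  have hk : Integrable fun η : Space d × Space d => K η.1 * gauss η.2 := hK.mul_prod integrable_gauss
  have hk' : Integrable fun η : Space d × Space d => K' η.1 * gauss η.2 :=
    hK'.mul_prod integrable_gauss
  have h1 := integrable_prod_mul_comp_add hpp ha hvm hap hvp hk hX
  have h2 := integrable_prod_mul_comp_add hpp ha hφm hap (hφ.memLp _) hk' hX
  have hinner : ∀ z : Phase d, ∫ η : Space d × Space d, K η.1 * gauss η.2 *
      velDeriv σ φ (z + shift β α μ η) = β ^ (-σ) * ∫ η : Space d × Space d,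
        K' η.1 * gauss η.2 * φ (z + shift β α μ η) := by
    intro z
    obtain ⟨M, hM⟩ := exists_abs_velDeriv_le hσ0 hσ1 hφ
    obtain ⟨N, hN⟩ := hφ.2.exists_bound_of_continuous hφ.continuous
    have i1 : Integrable fun η : Space d × Space d => K η.1 * gauss η.2 *
        velDeriv σ φ (z + shift β α μ η) :=
      hk.mul_bdd (c := M) (hvm.comp (by fun_prop)).aestronglyMeasurable
        (Filter.Eventually.of_forall fun η => hM _)
    have i2 : Integrable fun η : Space d × Space d => K' η.1 * gauss η.2 *
        φ (z + shift β α μ η) :=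
      hk'.mul_bdd (c := N) (hφm.comp (by fun_prop)).aestronglyMeasurable
        (Filter.Eventually.of_forall fun η => hN _)
    rw [Measure.volume_eq_prod] at i1 i2 ⊢
    rw [integral_prod_symm _ i1, integral_prod_symm _ i2, ← integral_const_mul]
    refine integral_congr_ae (Filter.Eventually.of_forall fun n => ?_)
    -- With `n` fixed, the position is frozen and only the velocity varies with `h`, so
    -- `integral_mul_rieszDeriv` applies on this slice.
    obtain ⟨s1, s2⟩ := hφ.slice z.1 (z.2.1 + -(μ • n))
    have h3 := integral_mul_rieszDeriv hσ0 hσ1 hβ s1 s2 hK hK' hKK' (z.2.2 + α • n)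
    have e1 : ∀ h : Space d, velDeriv σ φ (z + shift β α μ (h, n)) =
        (rieszDeriv σ (fun w => (φ (z.1, z.2.1 + -(μ • n), w) : ℂ))
          (z.2.2 + α • n + β • h)).re := by
      intro h
      simp only [velDeriv, shift, Prod.fst_add, Prod.snd_add, add_zero]
      congr 2
      abel
    have e2 : ∀ h : Space d, φ (z + shift β α μ (h, n)) =
        φ (z.1, z.2.1 + -(μ • n), z.2.2 + α • n + β • h) := by
      intro h
      congr 1
      simp only [shift, Prod.add_def, add_zero]
      congr 2
      abel
    simp only
    calc _ = gauss n * ∫ h, K h * (rieszDeriv σ (fun w => (φ (z.1, z.2.1 + -(μ • n), w) : ℂ))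
          (z.2.2 + α • n + β • h)).re := by
          rw [← integral_const_mul]
          congr 1
          ext h
          rw [e1]; ring
      _ = _ := by
          rw [h3, mul_left_comm, ← integral_const_mul]
          congr 2
          ext h
          rw [e2]; ring
  calc _ = ∫ η : Space d × Space d, ∫ z, K η.1 * gauss η.2 *
        (a z * velDeriv σ φ (z + shift β α μ η)) := by simp_rw [integral_const_mul]
    _ = ∫ z, ∫ η : Space d × Space d, K η.1 * gauss η.2 *
        (a z * velDeriv σ φ (z + shift β α μ η)) := integral_integral_swap h1
    _ = ∫ z, β ^ (-σ) * ∫ η : Space d × Space d, K' η.1 * gauss η.2 *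
        (a z * φ (z + shift β α μ η)) := by
        congr 1
        ext z
        simp_rw [mul_left_comm _ (a z)]
        rw [integral_const_mul, integral_const_mul, hinner]
        ring
    _ = β ^ (-σ) * ∫ η : Space d × Space d, ∫ z, K' η.1 * gauss η.2 *
        (a z * φ (z + shift β α μ η)) := by
        rw [integral_const_mul, ← integral_integral_swap h2]
    _ = _ := by simp_rw [integral_const_mul]

end Hoelder

end Transfer

/-! ### The pairing of `f` with the transported test function, as a function of time at fixed
displacement. -/

section FlowAverage

variable {d : ℕ} {f ψ : Phase d → ℝ}

/-- The pairing of `f` with `ψ` transported by `flow`. -/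
noncomputable def flowAverage (f ψ : Phase d → ℝ) (s : ℝ) (X : Space d × Space d) : ℝ :=
  ∫ z, f z * ψ (flow s X z)

/-- The time derivative of `flowAverage`. -/
noncomputable def flowAverageDeriv (f ψ : Phase d → ℝ) (s : ℝ) (X : Space d × Space d) : ℝ :=
  ∫ z, f z * transport (fun z => ψ (flow s X z)) z

lemma IsTest.hasFDerivAt (hψ : IsTest ψ) (z : Phase d) : HasFDerivAt ψ (fderiv ℝ ψ z) z :=
  (hψ.1.differentiable (by simp) z).hasFDerivAt

lemma IsTest.continuous_fderiv (hψ : IsTest ψ) : Continuous (fderiv ℝ ψ) :=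
  hψ.1.continuous_fderiv (by simp)

lemma IsTest.transport_comp_flow (hψ : IsTest ψ) (s : ℝ) (X : Space d × Space d) (z : Phase d) :
    transport (fun z => ψ (flow s X z)) z = fderiv ℝ ψ (flow s X z) (1, z.2.2, 0) := by
  set L : Phase d →L[ℝ] Phase d := (ContinuousLinearMap.fst ℝ ℝ (Space d × Space d)).prod
    ((((ContinuousLinearMap.fst ℝ (Space d) (Space d)) + s • (ContinuousLinearMap.snd ℝ (Space d)
      (Space d))).comp (ContinuousLinearMap.snd ℝ ℝ (Space d × Space d))).prod
      ((ContinuousLinearMap.snd ℝ (Space d) (Space d)).comp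
        (ContinuousLinearMap.snd ℝ ℝ (Space d × Space d)))) with hL
  have h1 : HasFDerivAt (flow s X) L z := by
    have h2 : flow s X = fun z => L z + (s, X.1, X.2) := by
      ext z <;> simp [flow, hL]
    rw [h2]
    exact L.hasFDerivAt.add_const _
  have h3 := (hψ.hasFDerivAt (flow s X z)).comp z h1
  rw [transport]
  have h4 : fderiv ℝ (fun z => ψ (flow s X z)) z = (fderiv ℝ ψ (flow s X z)).comp L := h3.fderiv
  rw [h4]
  simp [hL]

/-- Increasing `s` at fixed `X` has the same effect as moving the starting point in the direction
`(1, v, 0)`. This turns the time derivative of the pairing into the left side of the weak equation.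
-/
lemma IsTest.hasDerivAt_comp_flow (hψ : IsTest ψ) (s : ℝ) (X : Space d × Space d) (z : Phase d) :
    HasDerivAt (fun s => ψ (flow s X z)) (transport (fun z => ψ (flow s X z)) z) s := by
  have h1 : HasDerivAt (fun s => flow s X z) (1, z.2.2, 0) s := by
    unfold flow
    refine HasDerivAt.prodMk ((hasDerivAt_id s).const_add _) (HasDerivAt.prodMk ?_
      (hasDerivAt_const _ _))
    have := (((hasDerivAt_id s).smul_const z.2.2).const_add z.2.1).add_const X.1
    simpa using this
  rw [hψ.transport_comp_flow]
  exact (hψ.hasFDerivAt (flow s X z)).comp_hasDerivAt s h1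

/-- A majorant of the transport derivatives of `ψ`. -/
noncomputable def gradBound (ψ : Phase d → ℝ) (z : Phase d) : ℝ :=
  ‖fderiv ℝ ψ z‖ * (1 + ‖z.2.2‖)

lemma IsTest.continuous_gradBound (hψ : IsTest ψ) : Continuous (gradBound ψ) := by
  have := hψ.continuous_fderiv
  unfold gradBound
  fun_prop

lemma IsTest.hasCompactSupport_gradBound (hψ : IsTest ψ) : HasCompactSupport (gradBound ψ) :=
  HasCompactSupport.mul_right (hψ.2.fderiv ℝ).norm

lemma gradBound_nonneg (z : Phase d) : 0 ≤ gradBound ψ z := by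
  unfold gradBound; positivity

/-- The transport direction contains the velocity of the starting point, whereas the support of `ψ`
controls that of the endpoint; the two differ by `X.2`. -/
lemma IsTest.abs_transport_comp_flow_le (hψ : IsTest ψ) (s : ℝ) (X : Space d × Space d)
    (z : Phase d) :
    |transport (fun z => ψ (flow s X z)) z| ≤ gradBound ψ (flow s X z) * (1 + ‖X.2‖) := by
  rw [hψ.transport_comp_flow, ← Real.norm_eq_abs]
  have h1 : ‖((1, z.2.2, 0) : Phase d)‖ ≤ 1 + ‖z.2.2‖ := by
    have := norm_nonneg z.2.2
    simp only [Prod.norm_def, norm_one, norm_zero, sup_le_iff]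
    refine ⟨by linarith, by linarith, by linarith⟩
  have h2 : 1 + ‖z.2.2‖ ≤ (1 + ‖(flow s X z).2.2‖) * (1 + ‖X.2‖) := by
    have h3 : z.2.2 = (flow s X z).2.2 - X.2 := by simp [flow]
    have h4 : ‖z.2.2‖ ≤ ‖(flow s X z).2.2‖ + ‖X.2‖ := by
      rw [h3]; exact norm_sub_le _ _
    nlinarith [norm_nonneg X.2, norm_nonneg (flow s X z).2.2]
  calc _ ≤ ‖fderiv ℝ ψ (flow s X z)‖ * ‖((1, z.2.2, 0) : Phase d)‖ :=
        ContinuousLinearMap.le_opNorm _ _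
    _ ≤ ‖fderiv ℝ ψ (flow s X z)‖ * ((1 + ‖(flow s X z).2.2‖) * (1 + ‖X.2‖)) := by
        gcongr; exact h1.trans h2
    _ = _ := by rw [gradBound]; ring

lemma IsTest.continuous_transport_comp_flow (hψ : IsTest ψ) :
    Continuous fun x : (ℝ × Space d × Space d) × Phase d =>
      transport (fun z => ψ (flow x.1.1 x.1.2 z)) x.2 := by
  have h0 := hψ.continuous_fderiv
  have h1 : Continuous fun x : (ℝ × Space d × Space d) × Phase d => flow x.1.1 x.1.2 x.2 := by
    unfold flow; fun_prop
  simp_rw [hψ.transport_comp_flow]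
  exact (h0.comp h1).clm_apply (by fun_prop)

lemma exists_abs_mul_comp_flow_le {b : Phase d → ℝ} (hb : Continuous b) (hc : HasCompactSupport b)
    (hf : Continuous f) (R : ℝ) : ∃ B : Phase d → ℝ, Integrable B ∧
      ∀ s X z, |s| ≤ R → ‖X‖ ≤ R → |f z| * |b (flow s X z)| ≤ B z := by
  obtain ⟨K, hK, H⟩ := exists_isCompact_of_flow_mem hc.isCompact R
  obtain ⟨M, hM⟩ := hc.exists_bound_of_continuous hb
  refine ⟨K.indicator fun z => |f z| * M, ?_, fun s X z hs hX => ?_⟩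
  · exact (integrable_indicator_iff hK.measurableSet).2
      ((hf.abs.mul continuous_const).continuousOn.integrableOn_compact hK)
  by_cases hz : flow s X z ∈ tsupport b
  · rw [indicator_of_mem (H s X z hs hX hz)]
    gcongr
    exact hM _
  · rw [image_eq_zero_of_notMem_tsupport hz, abs_zero, mul_zero]
    exact indicator_nonneg (fun z _ => mul_nonneg (abs_nonneg _) ((norm_nonneg _).trans (hM 0))) _

lemma hasDerivAt_flowAverage (hf : Continuous f) (hψ : IsTest ψ) (s : ℝ) (X : Space d × Space d) :
    HasDerivAt (fun s => flowAverage f ψ s X) (flowAverageDeriv f ψ s X) s := by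
  set R : ℝ := |s| + 1 + ‖X‖ with hR
  have hX : ‖X‖ ≤ R := by have := abs_nonneg s; linarith
  have hs : ∀ r ∈ Metric.ball s 1, |r| ≤ R := by
    intro r hr
    rw [Metric.mem_ball, Real.dist_eq] at hr
    have := abs_sub_abs_le_abs_sub r s
    linarith [norm_nonneg X]
  obtain ⟨B, hB, hBle⟩ := exists_abs_mul_comp_flow_le hψ.continuous_gradBound
    hψ.hasCompactSupport_gradBound hf R
  obtain ⟨B', hB', hBle'⟩ := exists_abs_mul_comp_flow_le hψ.continuous hψ.2 hf R
  have hcont : ∀ r, Continuous fun z => f z * ψ (flow r X z) := fun r =>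
    hf.mul (hψ.continuous.comp (continuous_flow r X))
  have hcont' : Continuous fun z => f z * transport (fun z => ψ (flow s X z)) z := by
    have := hψ.continuous_transport_comp_flow.comp
      (by fun_prop : Continuous fun z : Phase d => ((s, X), z))
    exact hf.mul this
  refine (hasDerivAt_integral_of_dominated_loc_of_deriv_le (Metric.ball_mem_nhds s one_pos)
    (F' := fun r z => f z * transport (fun z => ψ (flow r X z)) z)
    (bound := fun z => B z * (1 + ‖X.2‖))
    (Filter.Eventually.of_forall fun r => (hcont r).aestronglyMeasurable) ?_
    hcont'.aestronglyMeasurable ?_ (hB.mul_const _) ?_).2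
  · refine hB'.mono' (hcont s).aestronglyMeasurable (Filter.Eventually.of_forall fun z => ?_)
    rw [norm_mul]
    exact hBle' s X z (hs s (Metric.mem_ball_self one_pos)) hX
  · refine Filter.Eventually.of_forall fun z r hr => ?_
    rw [norm_mul]
    calc _ ≤ |f z| * (gradBound ψ (flow r X z) * (1 + ‖X.2‖)) := by
          rw [Real.norm_eq_abs]
          gcongr
          exact hψ.abs_transport_comp_flow_le r X z
      _ = |f z| * |gradBound ψ (flow r X z)| * (1 + ‖X.2‖) := by
          rw [abs_of_nonneg (gradBound_nonneg _)]; ring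
      _ ≤ _ := by
          gcongr
          exact hBle r X z (hs r hr) hX
  · exact Filter.Eventually.of_forall fun z r _ =>
      (hψ.hasDerivAt_comp_flow r X z).const_mul (f z)

lemma tendsto_flowAverage (hf : Continuous f) (hψ : IsTest ψ) {X : ℝ → Space d × Space d}
    (hX : Filter.Tendsto X (nhdsWithin 0 (Ioi 0)) (nhds 0)) :
    Filter.Tendsto (fun s => flowAverage f ψ s (X s)) (nhdsWithin 0 (Ioi 0))
      (nhds (∫ z, f z * ψ z)) := by
  obtain ⟨B, hB, hBle⟩ := exists_abs_mul_comp_flow_le hψ.continuous hψ.2 hf 1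
  have hid : Filter.Tendsto (fun s : ℝ => s) (nhdsWithin 0 (Ioi 0)) (nhds 0) :=
    Filter.tendsto_id.mono_left nhdsWithin_le_nhds
  refine tendsto_integral_filter_of_dominated_convergence B (Filter.Eventually.of_forall fun s =>
    (hf.mul (hψ.continuous.comp (continuous_flow s (X s)))).aestronglyMeasurable) ?_ hB
    (Filter.Eventually.of_forall fun z => ?_)
  · have h1 : ∀ᶠ s in nhdsWithin (0 : ℝ) (Ioi 0), |s| ≤ 1 := by
      filter_upwards [hid (Metric.closedBall_mem_nhds 0 one_pos)] with s hs
      simpa using hs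
    have h2 : ∀ᶠ s in nhdsWithin (0 : ℝ) (Ioi 0), ‖X s‖ ≤ 1 := by
      filter_upwards [hX (Metric.closedBall_mem_nhds 0 one_pos)] with s hs
      simpa using hs
    filter_upwards [h1, h2] with s hs hXs
    refine Filter.Eventually.of_forall fun z => ?_
    rw [norm_mul]
    exact hBle s (X s) z hs hXs
  · have h3 : Continuous fun x : ℝ × (Space d × Space d) => f z * ψ (flow x.1 x.2 z) := by
      have : Continuous fun x : ℝ × (Space d × Space d) => flow x.1 x.2 z := by
        unfold flow; fun_prop
      exact continuous_const.mul (hψ.continuous.comp this)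
    have h4 := (h3.tendsto (0, 0)).comp (hid.prodMk_nhds hX)
    simpa [flow, Function.comp_def] using h4

section Bounds

variable {p p' : ℝ}

lemma exists_abs_flowAverage_le (hpp : p.HolderConjugate p') (hf : Continuous f)
    (hfp : MemLp f (ENNReal.ofReal p)) (hψ : IsTest ψ) :
    ∃ M : ℝ, 0 ≤ M ∧ ∀ s X, |flowAverage f ψ s X| ≤ M := by
  refine ⟨(eLpNorm f (ENNReal.ofReal p) volume * eLpNorm ψ (ENNReal.ofReal p') volume).toReal,
    ENNReal.toReal_nonneg, fun s X => ?_⟩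
  exact (norm_integral_le_integral_norm _).trans (norm_integral_mul_comp_le hpp hf.measurable
    hψ.continuous.measurable hfp (hψ.memLp _) (continuous_flow s X).measurable
    fun g hg => lintegral_comp_flow hg s X)

lemma exists_abs_flowAverageDeriv_le (hpp : p.HolderConjugate p') (hf : Continuous f)
    (hfp : MemLp f (ENNReal.ofReal p)) (hψ : IsTest ψ) :
    ∃ M : ℝ, 0 ≤ M ∧ ∀ s X, |flowAverageDeriv f ψ s X| ≤ M * (1 + ‖X.2‖) := by
  have hb : MemLp (gradBound ψ) (ENNReal.ofReal p') :=
    hψ.continuous_gradBound.memLp_of_hasCompactSupport hψ.hasCompactSupport_gradBound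
  have hbm := hψ.continuous_gradBound.measurable
  refine ⟨(eLpNorm f (ENNReal.ofReal p) volume *
    eLpNorm (gradBound ψ) (ENNReal.ofReal p') volume).toReal,
    ENNReal.toReal_nonneg, fun s X => ?_⟩
  have hT := (continuous_flow s X).measurable
  have hTi : ∀ g : Phase d → ℝ≥0∞, Measurable g → ∫⁻ z, g (flow s X z) = ∫⁻ z, g z :=
    fun g hg => lintegral_comp_flow hg s X
  calc _ ≤ ∫ z, ‖f z * transport (fun z => ψ (flow s X z)) z‖ := norm_integral_le_integral_norm _
    _ ≤ ∫ z, ‖f z * gradBound ψ (flow s X z)‖ * (1 + ‖X.2‖) := by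
        refine integral_mono_of_nonneg (Filter.Eventually.of_forall fun z => norm_nonneg _)
          ((integrable_mul_comp hpp hf.measurable hbm hfp hb hT hTi).norm.mul_const _)
          (Filter.Eventually.of_forall fun z => ?_)
        simp only [norm_mul, mul_assoc]
        gcongr
        rw [Real.norm_of_nonneg (gradBound_nonneg _)]
        exact hψ.abs_transport_comp_flow_le s X z
    _ ≤ _ := by
        rw [integral_mul_const]
        gcongr
        exact norm_integral_mul_comp_le hpp hf.measurable hbm hfp hb hT hTi

end Bounds

lemma stronglyMeasurable_flowAverage (hf : Continuous f) (hψ : IsTest ψ) :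
    StronglyMeasurable fun x : ℝ × Space d × Space d => flowAverage f ψ x.1 x.2 := by
  have h1 : Continuous fun x : (ℝ × Space d × Space d) × Phase d =>
      f x.2 * ψ (flow x.1.1 x.1.2 x.2) := by
    have : Continuous fun x : (ℝ × Space d × Space d) × Phase d => flow x.1.1 x.1.2 x.2 := by
      unfold flow; fun_prop
    exact (hf.comp continuous_snd).mul (hψ.continuous.comp this)
  exact h1.stronglyMeasurable.integral_prod_right

lemma stronglyMeasurable_flowAverageDeriv (hf : Continuous f) (hψ : IsTest ψ) :
    StronglyMeasurable fun x : ℝ × Space d × Space d => flowAverageDeriv f ψ x.1 x.2 := by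
  have h1 := (hf.comp continuous_snd).mul hψ.continuous_transport_comp_flow
  exact h1.stronglyMeasurable.integral_prod_right

end FlowAverage

/-! ### Gaussian coordinates of the displacement and the evolution of its density. -/

section Scaling

variable {d : ℕ} {e ν κ s : ℝ}

/-- First Gaussian coordinate of a displacement at time `s`. -/
noncomputable def fstCoord (κ e s : ℝ) (X : Space d × Space d) : Space d :=
  ((e + 1) / κ * s ^ (-e - 1)) • X.1 - (e / κ * s ^ (-e)) • X.2

/-- Second Gaussian coordinate of a displacement at time `s`. -/
noncomputable def sndCoord (κ e ν s : ℝ) (X : Space d × Space d) : Space d :=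
  (ν / κ * s ^ (-e)) • X.2 - (ν / κ * s ^ (-e - 1)) • X.1

/-- The displacement at time `s` with Gaussian coordinates `η`. -/
noncomputable def scaledDisplacement (κ e ν s : ℝ) (η : Space d × Space d) : Space d × Space d :=
  displacement s (κ * s ^ e) ((e + 1) / ν * (κ * s ^ e)) (κ / ν * s ^ (e + 1)) η

/-- The law of the random displacement at time `s`. -/
noncomputable def density (κ e ν s : ℝ) (X : Space d × Space d) : ℝ :=
  ((κ * s ^ e * (κ / ν * s ^ (e + 1))) ^ d)⁻¹ *
    (gauss (fstCoord κ e s X) * gauss (sndCoord κ e ν s X))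

lemma fstCoord_scaledDisplacement (hκ : 0 < κ) (hν : ν ≠ 0) (hs : 0 < s) (η : Space d × Space d) :
    fstCoord κ e s (scaledDisplacement κ e ν s η) = η.1 := by
  have h1 : s ^ (-e - 1) = (s ^ e)⁻¹ * s⁻¹ := by
    rw [Real.rpow_sub hs, Real.rpow_neg hs.le, Real.rpow_one]; rfl
  have h2 : s ^ (e + 1) = s ^ e * s := Real.rpow_add_one hs.ne' e
  have h3 : 0 < s ^ e := Real.rpow_pos_of_pos hs e
  simp only [fstCoord, scaledDisplacement, displacement, h1, h2, Real.rpow_neg hs.le]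
  match_scalars <;> field_simp <;> ring

lemma sndCoord_scaledDisplacement (hκ : 0 < κ) (hν : ν ≠ 0) (hs : 0 < s) (η : Space d × Space d) :
    sndCoord κ e ν s (scaledDisplacement κ e ν s η) = η.2 := by
  have h1 : s ^ (-e - 1) = (s ^ e)⁻¹ * s⁻¹ := by
    rw [Real.rpow_sub hs, Real.rpow_neg hs.le, Real.rpow_one]; rfl
  have h2 : s ^ (e + 1) = s ^ e * s := Real.rpow_add_one hs.ne' e
  have h3 : 0 < s ^ e := Real.rpow_pos_of_pos hs e
  simp only [sndCoord, scaledDisplacement, displacement, h1, h2, Real.rpow_neg hs.le]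
  match_scalars <;> field_simp <;> ring

/-- At fixed `X` the coordinates solve `s h' = -(2e+1) h - ν n` and `s n' = ν h`. The choice of `ν`
makes the coupling antisymmetric. -/
lemma hasDerivAt_fstCoord (hs : 0 < s) (hν : ν ^ 2 = e * (e + 1)) (X : Space d × Space d) :
    HasDerivAt (fun s => fstCoord κ e s X)
      (s⁻¹ • (-(2 * e + 1) • fstCoord κ e s X - ν • sndCoord κ e ν s X)) s := by
  have h1 : HasDerivAt (fun s : ℝ => s ^ (-e - 1)) ((-e - 1) * s ^ (-e - 1 - 1)) s :=
    Real.hasDerivAt_rpow_const (Or.inl hs.ne')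
  have h2 : HasDerivAt (fun s : ℝ => s ^ (-e)) (-e * s ^ (-e - 1)) s :=
    Real.hasDerivAt_rpow_const (Or.inl hs.ne')
  refine (((h1.const_mul ((e + 1) / κ)).smul_const X.1).sub
    ((h2.const_mul (e / κ)).smul_const X.2)).congr_deriv ?_
  have h3 : s ^ (-e - 1) = s ^ (-e) * s⁻¹ := by rw [Real.rpow_sub_one hs.ne']; rfl
  have h4 : s ^ (-e - 1 - 1) = s ^ (-e) * s⁻¹ * s⁻¹ := by
    rw [Real.rpow_sub_one hs.ne', h3]; rfl
  simp only [fstCoord, sndCoord, h3, h4]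
  match_scalars
  · linear_combination (-s ^ (-e) * s⁻¹ * s⁻¹ / κ) * hν
  · linear_combination (s ^ (-e) * s⁻¹ / κ) * hν

lemma hasDerivAt_sndCoord (hs : 0 < s) (X : Space d × Space d) :
    HasDerivAt (fun s => sndCoord κ e ν s X) (s⁻¹ • ν • fstCoord κ e s X) s := by
  have h1 : HasDerivAt (fun s : ℝ => s ^ (-e - 1)) ((-e - 1) * s ^ (-e - 1 - 1)) s :=
    Real.hasDerivAt_rpow_const (Or.inl hs.ne')
  have h2 : HasDerivAt (fun s : ℝ => s ^ (-e)) (-e * s ^ (-e - 1)) s :=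
    Real.hasDerivAt_rpow_const (Or.inl hs.ne')
  refine (((h2.const_mul (ν / κ)).smul_const X.2).sub
    ((h1.const_mul (ν / κ)).smul_const X.1)).congr_deriv ?_
  have h3 : s ^ (-e - 1) = s ^ (-e) * s⁻¹ := by rw [Real.rpow_sub_one hs.ne']; rfl
  have h4 : s ^ (-e - 1 - 1) = s ^ (-e) * s⁻¹ * s⁻¹ := by
    rw [Real.rpow_sub_one hs.ne', h3]; rfl
  simp only [fstCoord, h3, h4]
  match_scalars <;> ring

/-- The evolution of the law of the displacement at a fixed point. -/
lemma hasDerivAt_density (hκ : 0 < κ) (hν0 : 0 < ν) (hs : 0 < s) (hν : ν ^ 2 = e * (e + 1))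
    (X : Space d × Space d) :
    HasDerivAt (fun s => density κ e ν s X) ((2 * e + 1) / s *
      (2 * Real.pi * ‖fstCoord κ e s X‖ ^ 2 - d) * density κ e ν s X) s := by
  have hse : 0 < s ^ (2 * e + 1) := Real.rpow_pos_of_pos hs _
  have hpre : ∀ r : ℝ, 0 < r → ((κ * r ^ e * (κ / ν * r ^ (e + 1))) ^ d)⁻¹ =
      ((κ ^ 2 / ν) ^ d)⁻¹ * r ^ (-(2 * e + 1) * d) := by
    intro r hr
    have h1 : κ * r ^ e * (κ / ν * r ^ (e + 1)) = κ ^ 2 / ν * r ^ (2 * e + 1) := by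
      rw [show 2 * e + 1 = e + (e + 1) by ring, Real.rpow_add hr e (e + 1)]; ring
    rw [h1, mul_pow, mul_inv, neg_mul, Real.rpow_neg hr.le, Real.rpow_mul hr.le, Real.rpow_natCast]
  have h1 : HasDerivAt (fun r : ℝ => ((κ ^ 2 / ν) ^ d)⁻¹ * r ^ (-(2 * e + 1) * d))
      (((κ ^ 2 / ν) ^ d)⁻¹ * (-(2 * e + 1) * d * s ^ (-(2 * e + 1) * d - 1))) s :=
    (Real.hasDerivAt_rpow_const (Or.inl hs.ne')).const_mul _
  have hh := (hasDerivAt_fstCoord (κ := κ) hs hν X).norm_sq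
  have hn := (hasDerivAt_sndCoord (κ := κ) (e := e) (ν := ν) hs X).norm_sq
  have h2 := ((hh.const_mul (-Real.pi)).exp).fun_mul ((hn.const_mul (-Real.pi)).exp)
  have h3 := h1.fun_mul h2
  have h4 : (fun r => density κ e ν r X) =ᶠ[nhds s] fun r : ℝ => ((κ ^ 2 / ν) ^ d)⁻¹ *
      r ^ (-(2 * e + 1) * d) * (Real.exp (-Real.pi * ‖fstCoord κ e r X‖ ^ 2) *
        Real.exp (-Real.pi * ‖sndCoord κ e ν r X‖ ^ 2)) := by
    filter_upwards [lt_mem_nhds hs] with r hr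
    rw [density, hpre r hr, gauss, gauss]
  refine (h3.congr_of_eventuallyEq h4).congr_deriv ?_
  rw [density, hpre s hs, gauss, gauss, Real.rpow_sub_one hs.ne']
  -- The terms `ν ⟨h, n⟩` coming from the two Gaussians cancel and only `‖h‖²` survives. The
  -- prefactor `s^(-(2e+1)d)` contributes the `-d` that completes `gaussLap`.
  simp only [inner_smul_right, inner_sub_right, real_inner_self_eq_norm_sq,
    real_inner_comm (fstCoord κ e s X) (sndCoord κ e ν s X)]
  field_simp
  ring

end Scaling

/-! ### Change of variables, and the two terms of the time derivative. -/

section Evolution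

variable {d : ℕ} {f g S ψ : Phase d → ℝ} {e ν κ s : ℝ}

lemma continuous_fstCoord : Continuous (fstCoord (d := d) κ e s) := by unfold fstCoord; fun_prop

lemma continuous_sndCoord : Continuous (sndCoord (d := d) κ e ν s) := by unfold sndCoord; fun_prop

lemma continuous_scaledDisplacement : Continuous (scaledDisplacement (d := d) κ e ν s) :=
  continuous_displacement _ _ _ _

lemma measurableEmbedding_scaledDisplacement (hκ : 0 < κ) (hν : 0 < ν) (hs : 0 < s) :
    MeasurableEmbedding (scaledDisplacement (d := d) κ e ν s) := by
  refine (Function.LeftInverse.isClosedEmbedding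
    (f := fun X => (fstCoord κ e s X, sndCoord κ e ν s X)) (fun η => ?_)
    (continuous_fstCoord.prodMk continuous_sndCoord)
    continuous_scaledDisplacement).measurableEmbedding
  simp only
  rw [fstCoord_scaledDisplacement hκ hν.ne' hs, sndCoord_scaledDisplacement hκ hν.ne' hs]

section ChangeOfVariables

/-- The time dependence of the displacement is moved into the weight, so that derivatives in `s` can
be taken at fixed `X`. The function `q` will be a product of `gauss` or `gaussLap` with `gauss`. -/
lemma integral_scaledDisplacement (hκ : 0 < κ) (hν : 0 < ν) (hs : 0 < s)
    (u : Space d × Space d → ℝ) (q : Space d → Space d → ℝ) :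
    ∫ η : Space d × Space d, q η.1 η.2 * u (scaledDisplacement κ e ν s η) =
      ∫ X, u X * (((κ * s ^ e * (κ / ν * s ^ (e + 1))) ^ d)⁻¹ *
        q (fstCoord κ e s X) (sndCoord κ e ν s X)) := by
  have hβ : 0 < κ * s ^ e := by positivity
  have hμ : 0 < κ / ν * s ^ (e + 1) := by positivity
  have h1 := (measurableEmbedding_scaledDisplacement (d := d) (e := e) hκ hν hs).integral_map
    (μ := volume) (fun X => q (fstCoord κ e s X) (sndCoord κ e ν s X) * u X)
  have h2 := map_displacement (d := d) (s := s) (α := (e + 1) / ν * (κ * s ^ e)) hβ hμ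
  change Measure.map (scaledDisplacement κ e ν s) volume = _ at h2
  rw [h2, integral_smul_measure, ENNReal.toReal_ofReal (by positivity), smul_eq_mul,
    ← integral_const_mul] at h1
  simp only [fstCoord_scaledDisplacement hκ hν.ne' hs,
    sndCoord_scaledDisplacement hκ hν.ne' hs] at h1
  rw [← h1]
  congr 1
  ext X
  ring

lemma integrable_scaledDisplacement_iff (hκ : 0 < κ) (hν : 0 < ν) (hs : 0 < s)
    (u : Space d × Space d → ℝ) (q : Space d → Space d → ℝ) :
    (Integrable fun X => u X * (((κ * s ^ e * (κ / ν * s ^ (e + 1))) ^ d)⁻¹ *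
        q (fstCoord κ e s X) (sndCoord κ e ν s X))) ↔
    Integrable fun η : Space d × Space d => q η.1 η.2 * u (scaledDisplacement κ e ν s η) := by
  have hβ : 0 < κ * s ^ e := by positivity
  have hμ : 0 < κ / ν * s ^ (e + 1) := by positivity
  have h1 := (measurableEmbedding_scaledDisplacement (d := d) (e := e) hκ hν hs).integrable_map_iff
    (μ := volume) (g := fun X => q (fstCoord κ e s X) (sndCoord κ e ν s X) * u X)
  have h2 := map_displacement (d := d) (s := s) (α := (e + 1) / ν * (κ * s ^ e)) hβ hμ
  change Measure.map (scaledDisplacement κ e ν s) volume = _ at h2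
  have hc : 0 < ((κ * s ^ e * (κ / ν * s ^ (e + 1))) ^ d)⁻¹ := by positivity
  rw [h2, integrable_smul_measure (by simpa using hc) ENNReal.ofReal_ne_top] at h1
  have h3 : (Integrable fun X => u X * (((κ * s ^ e * (κ / ν * s ^ (e + 1))) ^ d)⁻¹ *
        q (fstCoord κ e s X) (sndCoord κ e ν s X))) ↔
      Integrable fun X => q (fstCoord κ e s X) (sndCoord κ e ν s X) * u X := by
    rw [← integrable_const_mul_iff (IsUnit.mk0 _ hc.ne')
      (fun X => q (fstCoord κ e s X) (sndCoord κ e ν s X) * u X)]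
    refine iff_of_eq ?_
    congr 1
    ext X
    ring
  rw [h3, h1]
  simp only [Function.comp_def, fstCoord_scaledDisplacement hκ hν.ne' hs,
    sndCoord_scaledDisplacement hκ hν.ne' hs]

end ChangeOfVariables

section Identities

variable {σ p p' : ℝ} {K : Space d → ℝ}

lemma comp_flow_scaledDisplacement (η : Space d × Space d) :
    (fun z => ψ (flow s (scaledDisplacement κ e ν s η) z)) =
      fun z => ψ (flow s 0 (z + shift (κ * s ^ e) ((e + 1) / ν * (κ * s ^ e))
        (κ / ν * s ^ (e + 1)) η)) := by
  ext z
  rw [scaledDisplacement, flow_displacement_eq_shift]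

/-- For each `η` the weak equation is tested with the transported `ψ`. The average over `η.1` then
moves `D_v^σ` onto the Gaussian, which becomes `K`. -/
lemma integral_gauss_mul_flowAverageDeriv (hσ0 : 0 < σ) (hσ1 : σ < 1) (hκ : 0 < κ) (hs : 0 < s)
    (hpp : p.HolderConjugate p') (hS : Measurable S) (hSp : MemLp S (ENNReal.ofReal p'))
    (hψ : IsTest ψ) (hfS : SolvesKinetic σ f S) (hK : Integrable K)
    (hKF : ∀ ξ, 𝓕 (fun h => (K h : ℂ)) ξ = (((2 * Real.pi * ‖ξ‖) ^ σ * gauss ξ : ℝ) : ℂ)) :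
    ∫ η : Space d × Space d, gauss η.1 * gauss η.2 *
        flowAverageDeriv f ψ s (scaledDisplacement κ e ν s η) =
      -((κ * s ^ e) ^ (-σ) * ∫ η : Space d × Space d, K η.1 * gauss η.2 *
        ∫ z, S z * ψ (flow s (scaledDisplacement κ e ν s η) z)) := by
  have hφ := hψ.comp_flow s 0
  have h1 := integral_kernel_mul_velDeriv (α := (e + 1) / ν * (κ * s ^ e))
    (μ := κ / ν * s ^ (e + 1)) hσ0 hσ1 (by positivity : 0 < κ * s ^ e)
    hpp.symm hS hSp hφ integrable_gauss hK
    (fun ξ => by rw [hKF, fourier_gauss, Complex.ofReal_mul])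
  have h2 : ∀ η, flowAverageDeriv f ψ s (scaledDisplacement κ e ν s η) =
      -∫ z, S z * velDeriv σ (fun z => ψ (flow s 0 z)) (z + shift (κ * s ^ e)
        ((e + 1) / ν * (κ * s ^ e)) (κ / ν * s ^ (e + 1)) η) := by
    intro η
    rw [flowAverageDeriv, ← neg_eq_iff_eq_neg, hfS _ (hψ.comp_flow s _),
      comp_flow_scaledDisplacement]
    congr 1
    ext z
    rw [velDeriv_comp_add hσ0 hσ1 hφ]
  have h3 : ∀ η z, ψ (flow s (scaledDisplacement κ e ν s η) z) =
      ψ (flow s 0 (z + shift (κ * s ^ e) ((e + 1) / ν * (κ * s ^ e)) (κ / ν * s ^ (e + 1)) η)) :=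
    fun η z => congrFun (comp_flow_scaledDisplacement η) z
  simp_rw [h2, h3, mul_neg]
  rw [integral_neg, h1]

/-- The transfer is used backwards. Since `-2π gaussLap` is `D^σ` of `K = D^(2-σ) gauss`, the factor
`D^σ` leaves the kernel, falls on the transported `ψ`, and by duality on `f`, where it gives `g`. -/
lemma integral_gaussLap_mul_flowAverage (hσ0 : 0 < σ) (hσ1 : σ < 1) (hκ : 0 < κ) (hs : 0 < s)
    (hpp : p.HolderConjugate p') (hf : Measurable f) (hfp : MemLp f (ENNReal.ofReal p))
    (hψ : IsTest ψ) (hfg : HasVelDeriv σ f g) (hK : Integrable K)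
    (hKF : ∀ ξ, 𝓕 (fun h => (K h : ℂ)) ξ = (((2 * Real.pi * ‖ξ‖) ^ (2 - σ) * gauss ξ : ℝ) : ℂ)) :
    ∫ η : Space d × Space d, gaussLap η.1 * gauss η.2 *
        flowAverage f ψ s (scaledDisplacement κ e ν s η) =
      -((κ * s ^ e) ^ σ / (2 * Real.pi) * ∫ η : Space d × Space d, K η.1 * gauss η.2 *
        ∫ z, g z * ψ (flow s (scaledDisplacement κ e ν s η) z)) := by
  have hφ := hψ.comp_flow s 0
  have hβ : 0 < κ * s ^ e := by positivity
  have h1 := integral_kernel_mul_velDeriv (α := (e + 1) / ν * (κ * s ^ e))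
    (μ := κ / ν * s ^ (e + 1)) hσ0 hσ1 hβ
    hpp hf hfp hφ hK (integrable_gaussLap.const_mul (-(2 * Real.pi)))
    (fun ξ => by
      have e1 : 𝓕 (fun h : Space d => ((-(2 * Real.pi) * gaussLap h : ℝ) : ℂ)) ξ =
          ((-(2 * Real.pi) : ℝ) : ℂ) * 𝓕 (fun h : Space d => (gaussLap h : ℂ)) ξ := by
        rw [Real.fourier_eq', Real.fourier_eq', ← integral_const_mul]
        congr 1
        ext h
        rw [Complex.ofReal_mul (-(2 * Real.pi)) (gaussLap h), smul_eq_mul, smul_eq_mul,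
          mul_left_comm]
      rw [e1, hKF, fourier_gaussLap, ← Complex.ofReal_mul, ← Complex.ofReal_mul, ← mul_assoc,
        ← Real.rpow_add_of_nonneg (by positivity) hσ0.le (by linarith),
        add_sub_cancel, Real.rpow_two]
      congr 1
      field_simp)
  have h2 : ∀ η, ∫ z, f z * velDeriv σ (fun z => ψ (flow s 0 z)) (z + shift (κ * s ^ e)
        ((e + 1) / ν * (κ * s ^ e)) (κ / ν * s ^ (e + 1)) η) =
      ∫ z, g z * ψ (flow s (scaledDisplacement κ e ν s η) z) := by
    intro η
    rw [hfg _ (hψ.comp_flow s _), comp_flow_scaledDisplacement]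
    congr 1
    ext z
    rw [velDeriv_comp_add hσ0 hσ1 hφ]
  have h3 : ∀ η z, ψ (flow s (scaledDisplacement κ e ν s η) z) =
      ψ (flow s 0 (z + shift (κ * s ^ e) ((e + 1) / ν * (κ * s ^ e)) (κ / ν * s ^ (e + 1)) η)) :=
    fun η z => congrFun (comp_flow_scaledDisplacement η) z
  simp_rw [h2] at h1
  rw [h1]
  simp_rw [flowAverage, h3, mul_assoc (-(2 * Real.pi))]
  rw [integral_const_mul]
  have h4 : (κ * s ^ e) ^ σ * (κ * s ^ e) ^ (-σ) = 1 := by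
    rw [← Real.rpow_add hβ, add_neg_cancel, Real.rpow_zero]
  have h5 : ∀ A B I : ℝ, A * B = 1 → I = -(A / (2 * Real.pi) * (B * (-(2 * Real.pi) * I))) := by
    intro A B I hAB
    calc I = A * B * I := by rw [hAB, one_mul]
      _ = _ := by field_simp
  exact h5 _ _ _ h4

end Identities

end Evolution

/-! ### The fundamental theorem of calculus for the Gaussian average, and its limit at time zero. -/

section FundamentalTheorem

variable {d : ℕ} {f g S ψ : Phase d → ℝ} {e ν κ : ℝ}

/-- The Gaussian average of `flowAverage` over the displacements at time `s`. -/
noncomputable def gaussAverage (κ e ν : ℝ) (f ψ : Phase d → ℝ) (s : ℝ) : ℝ :=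
  ∫ η : Space d × Space d, gauss η.1 * gauss η.2 *
    flowAverage f ψ s (scaledDisplacement κ e ν s η)

/-- A majorant independent of `s` is available in the Gaussian coordinates, where the weight no
longer depends on `s`. The integral in `X` is therefore changed back to `η` at each time before it
is dominated. -/
lemma integrable_prod_of_scaledDisplacement_le (hκ : 0 < κ) (hν : 0 < ν) {ε T : ℝ} (hε : 0 < ε)
    {u : ℝ × Space d × Space d → ℝ} (hu : Measurable u) {q : Space d → Space d → ℝ}
    (hq : Continuous fun η : Space d × Space d => q η.1 η.2) {W : Space d × Space d → ℝ}
    (hW : Integrable W) (hle : ∀ s ∈ Ioc ε T, ∀ η : Space d × Space d,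
      |q η.1 η.2 * u (s, scaledDisplacement κ e ν s η)| ≤ W η) :
    Integrable (fun x : ℝ × Space d × Space d =>
      u x * (((κ * x.1 ^ e * (κ / ν * x.1 ^ (e + 1))) ^ d)⁻¹ *
        q (fstCoord κ e x.1 x.2) (sndCoord κ e ν x.1 x.2)))
      ((volume.restrict (Ioc ε T)).prod volume) := by
  have hc : Measurable fun x : ℝ × Space d × Space d =>
      (fstCoord κ e x.1 x.2, sndCoord κ e ν x.1 x.2) := by
    unfold fstCoord sndCoord; fun_prop
  have hm : Measurable fun x : ℝ × Space d × Space d =>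
      u x * (((κ * x.1 ^ e * (κ / ν * x.1 ^ (e + 1))) ^ d)⁻¹ *
        q (fstCoord κ e x.1 x.2) (sndCoord κ e ν x.1 x.2)) :=
    hu.mul (Measurable.mul (by fun_prop) (hq.measurable.comp hc))
  have hslice : ∀ s ∈ Ioc ε T, Integrable fun η : Space d × Space d =>
      q η.1 η.2 * u (s, scaledDisplacement κ e ν s η) := by
    intro s hs
    have hus : Measurable fun η : Space d × Space d => u (s, scaledDisplacement κ e ν s η) :=
      hu.comp (measurable_const.prodMk continuous_scaledDisplacement.measurable)
    exact hW.mono' (hq.measurable.mul hus).aestronglyMeasurable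
      (Filter.Eventually.of_forall fun η => hle s hs η)
  refine (integrable_prod_iff hm.aestronglyMeasurable).2 ⟨?_, ?_⟩
  · filter_upwards [ae_restrict_mem measurableSet_Ioc] with s hs
    exact (integrable_scaledDisplacement_iff hκ hν (hε.trans hs.1) (fun X => u (s, X)) q).2
      (hslice s hs)
  · have hfin : Integrable (fun _ : ℝ => ∫ η, W η) (volume.restrict (Ioc ε T)) :=
      integrable_const _
    refine hfin.mono' hm.stronglyMeasurable.norm.integral_prod_right.aestronglyMeasurable ?_
    filter_upwards [ae_restrict_mem measurableSet_Ioc] with s hs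
    have hs0 : 0 < s := hε.trans hs.1
    rw [Real.norm_of_nonneg (integral_nonneg fun _ => norm_nonneg _)]
    have h1 := integral_scaledDisplacement (e := e) hκ hν hs0 (fun X => |u (s, X)|)
      (fun a b => |q a b|)
    have h2 : ∀ X : Space d × Space d, ‖u (s, X) * (((κ * s ^ e * (κ / ν * s ^ (e + 1))) ^ d)⁻¹ *
        q (fstCoord κ e s X) (sndCoord κ e ν s X))‖ =
        |u (s, X)| * (((κ * s ^ e * (κ / ν * s ^ (e + 1))) ^ d)⁻¹ *
        |q (fstCoord κ e s X) (sndCoord κ e ν s X)|) := by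
      intro X
      have h3 : 0 ≤ ((κ * s ^ e * (κ / ν * s ^ (e + 1))) ^ d)⁻¹ := by positivity
      rw [norm_mul, norm_mul, Real.norm_of_nonneg h3]
      rfl
    simp_rw [h2]
    rw [← h1]
    refine integral_mono ((hslice s hs).norm.congr (Filter.Eventually.of_forall fun η => ?_)) hW
      fun η => ?_
    · exact norm_mul _ _
    · rw [← abs_mul]; exact hle s hs η

lemma integrable_norm_mul_gauss : Integrable fun h : Space d => ‖h‖ * gauss h := by
  have h1 : Integrable fun k : Space d => (1 + ‖k‖ ^ 2) * gauss k :=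
    (integrable_gauss.add (integrable_sq_norm_mul_exp Real.pi_pos)).congr
      (Filter.Eventually.of_forall fun k => by simp only [Pi.add_apply, gauss]; ring)
  refine h1.mono' (continuous_norm.mul continuous_gauss).aestronglyMeasurable
    (Filter.Eventually.of_forall fun h => ?_)
  have := gauss_pos h
  rw [Real.norm_of_nonneg (by positivity)]
  gcongr
  nlinarith [sq_nonneg (‖h‖ - 1)]

lemma integrable_norm_add_mul_gauss : Integrable fun η : Space d × Space d =>
    (1 + ‖η.1‖ + ‖η.2‖) * (gauss η.1 * gauss η.2) := by
  have h0 : Integrable fun η : Space d × Space d => gauss η.1 * gauss η.2 :=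
    integrable_gauss.mul_prod integrable_gauss
  have h1 : Integrable fun η : Space d × Space d => (‖η.1‖ * gauss η.1) * gauss η.2 :=
    integrable_norm_mul_gauss.mul_prod integrable_gauss
  have h2 : Integrable fun η : Space d × Space d => gauss η.1 * (‖η.2‖ * gauss η.2) :=
    integrable_gauss.mul_prod integrable_norm_mul_gauss
  refine ((h0.add h1).add h2).congr (Filter.Eventually.of_forall fun η => ?_)
  simp only [Pi.add_apply]
  ring

section

variable {p p' : ℝ} {ε T : ℝ}

lemma integrable_prod_flowAverageDeriv (he : 0 < e) (hκ : 0 < κ) (hν : 0 < ν) (hε : 0 < ε)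
    (hpp : p.HolderConjugate p') (hf : Continuous f) (hfp : MemLp f (ENNReal.ofReal p))
    (hψ : IsTest ψ) :
    Integrable (fun x : ℝ × Space d × Space d => flowAverageDeriv f ψ x.1 x.2 *
      density κ e ν x.1 x.2) ((volume.restrict (Ioc ε T)).prod volume) := by
  obtain ⟨M, hM0, hM⟩ := exists_abs_flowAverageDeriv_le hpp hf hfp hψ
  set L : ℝ := 1 + κ * T ^ e + (e + 1) / ν * (κ * T ^ e) with hL
  refine integrable_prod_of_scaledDisplacement_le hκ hν hε
    (u := fun x => flowAverageDeriv f ψ x.1 x.2)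
    (stronglyMeasurable_flowAverageDeriv hf hψ).measurable
    (q := fun a b => gauss a * gauss b)
    ((continuous_gauss.comp continuous_fst).mul (continuous_gauss.comp continuous_snd))
    (integrable_norm_add_mul_gauss.const_mul (M * L)) fun s hs η => ?_
  have hs0 : 0 < s := hε.trans hs.1
  have hsT : s ^ e ≤ T ^ e := Real.rpow_le_rpow hs0.le hs.2 he.le
  have hse : 0 < s ^ e := Real.rpow_pos_of_pos hs0 e
  have h1 : 1 + ‖(scaledDisplacement κ e ν s η).2‖ ≤ L * (1 + ‖η.1‖ + ‖η.2‖) := by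
    have h2 : ‖(scaledDisplacement κ e ν s η).2‖ ≤ κ * T ^ e * ‖η.1‖ +
        (e + 1) / ν * (κ * T ^ e) * ‖η.2‖ := by
      simp only [scaledDisplacement, displacement]
      refine (norm_add_le _ _).trans ?_
      rw [norm_smul, norm_smul, Real.norm_of_nonneg (by positivity),
        Real.norm_of_nonneg (by positivity)]
      gcongr
    have h3 : 0 ≤ κ * T ^ e := by have := hse.trans_le hsT; positivity
    have h4 : 0 ≤ (e + 1) / ν * (κ * T ^ e) := by positivity
    have n1 := norm_nonneg η.1
    have n2 := norm_nonneg η.2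
    rw [hL]
    nlinarith [mul_nonneg h3 n2, mul_nonneg h4 n1]
  have hg := mul_pos (gauss_pos η.1) (gauss_pos η.2)
  simp only
  rw [abs_mul, abs_of_pos hg]
  calc _ ≤ gauss η.1 * gauss η.2 * (M * (L * (1 + ‖η.1‖ + ‖η.2‖))) := by
        gcongr
        exact (hM _ _).trans (by gcongr)
    _ = _ := by ring

lemma density_mul_eq (s : ℝ) (X : Space d × Space d) :
    (2 * Real.pi * ‖fstCoord κ e s X‖ ^ 2 - d) * density κ e ν s X =
      ((κ * s ^ e * (κ / ν * s ^ (e + 1))) ^ d)⁻¹ *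
        (gaussLap (fstCoord κ e s X) * gauss (sndCoord κ e ν s X)) := by
  rw [density, gaussLap]; ring

lemma integrable_prod_flowAverage (he : 0 < e) (hκ : 0 < κ) (hν : 0 < ν) (hε : 0 < ε)
    (hpp : p.HolderConjugate p') (hf : Continuous f) (hfp : MemLp f (ENNReal.ofReal p))
    (hψ : IsTest ψ) :
    Integrable (fun x : ℝ × Space d × Space d => flowAverage f ψ x.1 x.2 * ((2 * e + 1) / x.1 *
      (2 * Real.pi * ‖fstCoord κ e x.1 x.2‖ ^ 2 - d) * density κ e ν x.1 x.2))
      ((volume.restrict (Ioc ε T)).prod volume) := by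
  obtain ⟨M, hM0, hM⟩ := exists_abs_flowAverage_le hpp hf hfp hψ
  have hW : Integrable fun η : Space d × Space d => |gaussLap η.1| * gauss η.2 :=
    integrable_gaussLap.abs.mul_prod integrable_gauss
  have h0 := (stronglyMeasurable_flowAverage hf hψ).measurable
  refine (integrable_prod_of_scaledDisplacement_le (e := e) hκ hν hε
    (u := fun x => flowAverage f ψ x.1 x.2 * ((2 * e + 1) / x.1))
    (h0.mul (by fun_prop))
    (q := fun a b => gaussLap a * gauss b)
    ((continuous_gaussLap.comp continuous_fst).mul (continuous_gauss.comp continuous_snd))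
    (hW.const_mul (M * ((2 * e + 1) / ε))) fun s hs η => ?_).congr
      (Filter.Eventually.of_forall fun x => ?_)
  · have hs0 : 0 < s := hε.trans hs.1
    have hg := gauss_pos η.2
    simp only
    rw [abs_mul, abs_mul, abs_mul, abs_of_pos hg, abs_of_pos (by positivity : 0 < (2 * e + 1) / s)]
    calc _ ≤ |gaussLap η.1| * gauss η.2 * (M * ((2 * e + 1) / ε)) := by
          gcongr
          · exact hM _ _
          · exact hs.1.le
      _ = _ := by ring
  · simp only
    rw [mul_assoc ((2 * e + 1) / x.1), density_mul_eq, mul_assoc]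

lemma integrable_gauss_mul_flowAverage (hpp : p.HolderConjugate p') (hf : Continuous f)
    (hfp : MemLp f (ENNReal.ofReal p)) (hψ : IsTest ψ) (s : ℝ) :
    Integrable fun η : Space d × Space d => gauss η.1 * gauss η.2 *
      flowAverage f ψ s (scaledDisplacement κ e ν s η) := by
  obtain ⟨M, hM0, hM⟩ := exists_abs_flowAverage_le hpp hf hfp hψ
  have hg : Integrable fun η : Space d × Space d => gauss η.1 * gauss η.2 :=
    integrable_gauss.mul_prod integrable_gauss
  refine hg.mul_bdd (c := M) ?_ (Filter.Eventually.of_forall fun η => hM _ _)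
  exact ((stronglyMeasurable_flowAverage hf hψ).measurable.comp
    (measurable_const.prodMk continuous_scaledDisplacement.measurable)).aestronglyMeasurable

lemma gaussAverage_eq (hκ : 0 < κ) (hν : 0 < ν) {s : ℝ} (hs : 0 < s) :
    gaussAverage κ e ν f ψ s = ∫ X, flowAverage f ψ s X * density κ e ν s X :=
  integral_scaledDisplacement hκ hν hs (fun X => flowAverage f ψ s X) fun a b => gauss a * gauss b

/-- The product rule for `flowAverage` times `density` at fixed `X`, integrated in time and then in
`X`. The initial time is `ε > 0` because the law of the displacement concentrates at a point as `s →
0`. -/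
lemma gaussAverage_sub (he : 0 < e) (hκ : 0 < κ) (hν : 0 < ν) (hνe : ν ^ 2 = e * (e + 1))
    (hε : 0 < ε) (hεT : ε ≤ T)
    (hpp : p.HolderConjugate p') (hf : Continuous f) (hfp : MemLp f (ENNReal.ofReal p))
    (hψ : IsTest ψ) :
    gaussAverage κ e ν f ψ T - gaussAverage κ e ν f ψ ε =
      (∫ s in Ioc ε T, ∫ η : Space d × Space d, gauss η.1 * gauss η.2 *
        flowAverageDeriv f ψ s (scaledDisplacement κ e ν s η)) +
      ∫ s in Ioc ε T, (2 * e + 1) / s * ∫ η : Space d × Space d, gaussLap η.1 * gauss η.2 *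
        flowAverage f ψ s (scaledDisplacement κ e ν s η) := by
  have i1 := integrable_prod_flowAverageDeriv (T := T) he hκ hν hε hpp hf hfp hψ
  have i2 := integrable_prod_flowAverage (T := T) he hκ hν hε hpp hf hfp hψ
  have hT : 0 < T := hε.trans_le hεT
  have hslice : ∀ s, 0 < s → Integrable fun X => flowAverage f ψ s X * density κ e ν s X :=
    fun s hs => (integrable_scaledDisplacement_iff hκ hν hs (fun X => flowAverage f ψ s X)
      fun a b => gauss a * gauss b).2 (integrable_gauss_mul_flowAverage hpp hf hfp hψ s)
  have hftc : ∀ᵐ X : Space d × Space d, flowAverage f ψ T X * density κ e ν T X -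
      flowAverage f ψ ε X * density κ e ν ε X = ∫ s in Ioc ε T,
        (flowAverageDeriv f ψ s X * density κ e ν s X + flowAverage f ψ s X * ((2 * e + 1) / s *
      (2 * Real.pi * ‖fstCoord κ e s X‖ ^ 2 - d) * density κ e ν s X)) := by
    filter_upwards [(i1.add i2).prod_left_ae] with X hX
    rw [← intervalIntegral.integral_of_le hεT]
    refine (intervalIntegral.integral_eq_sub_of_hasDerivAt (f := fun s =>
      flowAverage f ψ s X * density κ e ν s X) (fun s hs => ?_) ?_).symm
    · rw [uIcc_of_le hεT] at hs
      have hs0 : 0 < s := hε.trans_le hs.1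
      exact (hasDerivAt_flowAverage hf hψ s X).mul (hasDerivAt_density hκ hν hs0 hνe X)
    · exact (intervalIntegrable_iff_integrableOn_Ioc_of_le hεT).2 hX
  rw [gaussAverage_eq hκ hν hT, gaussAverage_eq hκ hν hε,
    ← integral_sub (hslice T hT) (hslice ε hε), integral_congr_ae hftc,
    ← integral_integral_swap (i1.add i2)]
  have hsplit : ∫ s in Ioc ε T, ∫ X, (flowAverageDeriv f ψ s X * density κ e ν s X +
      flowAverage f ψ s X * ((2 * e + 1) / s *
      (2 * Real.pi * ‖fstCoord κ e s X‖ ^ 2 - d) * density κ e ν s X)) =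
      (∫ s in Ioc ε T, ∫ X, flowAverageDeriv f ψ s X * density κ e ν s X) +
      ∫ s in Ioc ε T, ∫ X, flowAverage f ψ s X * ((2 * e + 1) / s *
      (2 * Real.pi * ‖fstCoord κ e s X‖ ^ 2 - d) * density κ e ν s X) := by
    rw [← integral_add i1.integral_prod_left i2.integral_prod_left]
    refine integral_congr_ae ?_
    filter_upwards [i1.prod_right_ae, i2.prod_right_ae] with s h1 h2
    exact integral_add h1 h2
  rw [hsplit]
  congr 1
  · refine setIntegral_congr_fun measurableSet_Ioc fun s hs => ?_
    exact (integral_scaledDisplacement hκ hν (hε.trans hs.1)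
      (fun X => flowAverageDeriv f ψ s X) fun a b => gauss a * gauss b).symm
  · refine setIntegral_congr_fun measurableSet_Ioc fun s hs => ?_
    rw [← integral_const_mul]
    have h1 := integral_scaledDisplacement (e := e) hκ hν (hε.trans hs.1)
      (fun X => (2 * e + 1) / s * flowAverage f ψ s X) fun a b => gaussLap a * gauss b
    calc _ = _ := ?_
      _ = _ := h1.symm
      _ = _ := ?_
    · congr 1
      ext X
      rw [mul_assoc ((2 * e + 1) / s), density_mul_eq]
      ring
    · congr 1
      ext η
      ring

lemma tendsto_scaledDisplacement (he : 0 < e) (η : Space d × Space d) :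
    Filter.Tendsto (fun s => scaledDisplacement κ e ν s η) (nhdsWithin 0 (Ioi 0)) (nhds 0) := by
  have h1 : Continuous fun s : ℝ => s ^ e := Real.continuous_rpow_const he.le
  have h2 : Continuous fun s : ℝ => s ^ (e + 1) := Real.continuous_rpow_const (by linarith)
  have h3 : Continuous fun s => scaledDisplacement κ e ν s η := by
    unfold scaledDisplacement displacement
    fun_prop
  have h4 := (h3.tendsto 0).mono_left (nhdsWithin_le_nhds (s := Ioi 0))
  have h5 : scaledDisplacement κ e ν 0 η = 0 := by
    simp [scaledDisplacement, displacement, Real.zero_rpow he.ne',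
      Real.zero_rpow (by linarith : e + 1 ≠ 0)]
  rwa [h5] at h4

lemma tendsto_gaussAverage (he : 0 < e) (hpp : p.HolderConjugate p') (hf : Continuous f)
    (hfp : MemLp f (ENNReal.ofReal p)) (hψ : IsTest ψ) :
    Filter.Tendsto (gaussAverage κ e ν f ψ) (nhdsWithin 0 (Ioi 0)) (nhds (∫ z, f z * ψ z)) := by
  obtain ⟨M, hM0, hM⟩ := exists_abs_flowAverage_le hpp hf hfp hψ
  have hg : Integrable fun η : Space d × Space d => gauss η.1 * gauss η.2 :=
    integrable_gauss.mul_prod integrable_gauss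
  have h1 : ∫ η : Space d × Space d, gauss η.1 * gauss η.2 * ∫ z, f z * ψ z =
      ∫ z, f z * ψ z := by
    rw [integral_mul_const, Measure.volume_eq_prod, integral_prod_mul (fun h => gauss h)
      (fun h => gauss h), integral_gauss, one_mul, one_mul]
  rw [← h1]
  refine tendsto_integral_filter_of_dominated_convergence _ (Filter.Eventually.of_forall fun s =>
    (integrable_gauss_mul_flowAverage hpp hf hfp hψ s).aestronglyMeasurable)
    (Filter.Eventually.of_forall fun s => Filter.Eventually.of_forall fun η => ?_)
    (hg.mul_const M) (Filter.Eventually.of_forall fun η => ?_)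
  · rw [norm_mul, Real.norm_of_nonneg (mul_pos (gauss_pos _) (gauss_pos _)).le]
    have := mul_pos (gauss_pos η.1) (gauss_pos η.2)
    gcongr
    exact hM _ _
  · exact (tendsto_flowAverage hf hψ (tendsto_scaledDisplacement he η)).const_mul _

end

end FundamentalTheorem

/-! ### Matching of the powers of time, and the dual estimate with a free scale. -/

section Duality

variable {d : ℕ} {f g S ψ : Phase d → ℝ} {e ν κ σ : ℝ}

lemma enorm_integral_kernel_le (K : Space d → ℝ) (a : Phase d → ℝ) (X : Space d × Space d →
    Space d × Space d) (s : ℝ) :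
    ‖∫ η : Space d × Space d, K η.1 * gauss η.2 * ∫ z, a z * ψ (flow s (X η) z)‖ₑ ≤
      ∫⁻ η : Space d × Space d, ‖K η.1 * gauss η.2‖ₑ * ∫⁻ z, ‖a z‖ₑ * ‖ψ (flow s (X η) z)‖ₑ := by
  refine (enorm_integral_le_lintegral_enorm _).trans (lintegral_mono fun η => ?_)
  simp only
  rw [enorm_mul]
  gcongr
  refine (enorm_integral_le_lintegral_enorm _).trans (le_of_eq ?_)
  simp_rw [enorm_mul]

lemma lintegral_kernel_rpow_ne_top {K : Space d → ℝ} (hK : Integrable K)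
    (hKb : ∃ M, ∀ h, |K h| ≤ M) {r : ℝ} (hr : 1 ≤ r) :
    ∫⁻ η : Space d × Space d, ‖K η.1 * gauss η.2‖ₑ ^ r ≠ ⊤ := by
  obtain ⟨M, hM⟩ := hKb
  have h1 : Integrable fun η : Space d × Space d => K η.1 * gauss η.2 :=
    hK.mul_prod integrable_gauss
  have h2 := memLp_of_integrable_of_abs_le h1 (M := M) (fun η => by
    rw [abs_mul, abs_of_pos (gauss_pos _)]
    exact (mul_le_of_le_one_right (abs_nonneg _) (gauss_le_one _)).trans (hM _)) hr
  have h3 := lintegral_rpow_enorm_lt_top_of_eLpNorm_lt_top (by simp; linarith)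
    ENNReal.ofReal_ne_top h2.2
  rw [ENNReal.toReal_ofReal (by linarith)] at h3
  exact h3.ne

lemma scale_rpow_eq (hκ : 0 < κ) (hν : 0 < ν) {s : ℝ} (hs : 0 < s) (d : ℕ) (δ : ℝ) :
    s ^ (δ - 1) * ((κ * s ^ e * (κ / ν * s ^ (e + 1))) ^ d) ^ δ =
      (κ ^ (2 * d * δ) / ν ^ (d * δ)) * s ^ ((d * (2 * e + 1) + 1) * δ - 1) := by
  have h1 : κ * s ^ e * (κ / ν * s ^ (e + 1)) = κ ^ (2 : ℝ) * s ^ (2 * e + 1) / ν := by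
    rw [show 2 * e + 1 = e + (e + 1) by ring, Real.rpow_add hs e (e + 1), Real.rpow_two]; ring
  have hs1 := Real.rpow_pos_of_pos hs (2 * e + 1)
  have hk1 := Real.rpow_pos_of_pos hκ 2
  rw [h1, ← Real.rpow_natCast, ← Real.rpow_mul (by positivity), Real.div_rpow (by positivity) hν.le,
    Real.mul_rpow hk1.le hs1.le, ← Real.rpow_mul hκ.le, ← Real.rpow_mul hs.le,
    show (d * (2 * e + 1) + 1) * δ - 1 = (δ - 1) + (2 * e + 1) * (d * δ) by ring,
    Real.rpow_add hs]
  ring_nf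

/-- The hypothesis `h` makes the power of `s` in the `S` term equal to that of the weight in
`exists_lintegral_flow_average_le`, leaving only a power of `κ`. The next lemma does the same for
the `g` term. -/
lemma scale_rpow_neg_eq (hκ : 0 < κ) (hν : 0 < ν) {s : ℝ} (hs : 0 < s) (d : ℕ) {δ : ℝ}
    (h : e * σ + (d * (2 * e + 1) + 1) * δ = 1) :
    (κ * s ^ e) ^ (-σ) = (ν ^ (d * δ) * κ ^ (-(σ + 2 * d * δ))) *
      (s ^ (δ - 1) * ((κ * s ^ e * (κ / ν * s ^ (e + 1))) ^ d) ^ δ) := by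
  have hs1 := Real.rpow_pos_of_pos hs e
  have hk := Real.rpow_pos_of_pos hκ (2 * d * δ)
  have hn := Real.rpow_pos_of_pos hν (d * δ)
  rw [scale_rpow_eq hκ hν hs, Real.mul_rpow hκ.le hs1.le, ← Real.rpow_mul hs.le,
    show (d * (2 * e + 1) + 1) * δ - 1 = e * -σ by linear_combination h,
    show -σ = -(σ + 2 * d * δ) + 2 * d * δ by ring, Real.rpow_add hκ]
  field_simp

lemma scale_rpow_pos_eq (hκ : 0 < κ) (hν : 0 < ν) {s : ℝ} (hs : 0 < s) (d : ℕ) {δ : ℝ}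
    (h : e * σ = (d * (2 * e + 1) + 1) * δ) :
    s⁻¹ * (κ * s ^ e) ^ σ = (ν ^ (d * δ) * κ ^ (σ - 2 * d * δ)) *
      (s ^ (δ - 1) * ((κ * s ^ e * (κ / ν * s ^ (e + 1))) ^ d) ^ δ) := by
  have hs1 := Real.rpow_pos_of_pos hs e
  have hk := Real.rpow_pos_of_pos hκ (2 * d * δ)
  have hn := Real.rpow_pos_of_pos hν (d * δ)
  rw [scale_rpow_eq hκ hν hs, Real.mul_rpow hκ.le hs1.le, ← Real.rpow_mul hs.le, ← h,
    Real.rpow_sub_one hs.ne', Real.rpow_sub hκ]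
  field_simp

/-- The dual form of the estimate, with a free scaling parameter. -/
theorem exists_enorm_integral_mul_le (d : ℕ) {p p' m δ δ' : ℝ} (hσ0 : 0 < σ) (hσ1 : σ < 1)
    (hpp : p.HolderConjugate p') (hm : 1 < m) (hδ : 0 < δ) (hδ1 : δ < 1) (hδ' : 0 < δ')
    (hδ1' : δ' < 1) (h : 1 / p + 1 / m = 1 + δ) (h' : 1 / p' + 1 / m = 1 + δ') (he : 0 < e)
    (hs : e * σ = (d * (2 * e + 1) + 1) * δ) (hs' : e * σ + (d * (2 * e + 1) + 1) * δ' = 1) :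
    ∃ C : ℝ≥0∞, C ≠ ⊤ ∧ ∀ f g S : Phase d → ℝ, Continuous f → MemLp f (ENNReal.ofReal p) →
      Measurable g → Measurable S → MemLp S (ENNReal.ofReal p') → HasVelDeriv σ f g →
      SolvesKinetic σ f S → ∀ κ : ℝ, 0 < κ → ∀ ψ : Phase d → ℝ, IsTest ψ →
      ‖∫ z, f z * ψ z‖ₑ ≤ C * (ENNReal.ofReal (κ ^ (-(σ + 2 * d * δ'))) *
          eLpNorm S (ENNReal.ofReal p') volume +
        ENNReal.ofReal (κ ^ (σ - 2 * d * δ)) * eLpNorm g (ENNReal.ofReal p) volume) *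
        eLpNorm ψ (ENNReal.ofReal m) volume := by
  obtain ⟨K₁, hK₁m, hK₁, hK₁b, hK₁F⟩ := exists_kernel (d := d) hσ0 (by linarith)
  obtain ⟨K₂, hK₂m, hK₂, hK₂b, hK₂F⟩ := exists_kernel (d := d) (a := 2 - σ) (by linarith)
    (by linarith)
  have hr : 1 ≤ 1 / (1 - δ) := by rw [le_div_iff₀ (by linarith)]; linarith
  have hr' : 1 ≤ 1 / (1 - δ') := by rw [le_div_iff₀ (by linarith)]; linarith
  have hg0 := continuous_gauss (d := d)
  obtain ⟨C₁, hC₁, H₁⟩ := exists_lintegral_flow_average_le (d := d) hpp.symm.lt hm hδ' hδ1' h'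
    (k := fun η => ‖K₁ η.1 * gauss η.2‖ₑ) ((hK₁m.comp measurable_fst).mul (hg0.measurable.comp measurable_snd)).enorm
    (lintegral_kernel_rpow_ne_top hK₁ hK₁b hr')
  obtain ⟨C₂, hC₂, H₂⟩ := exists_lintegral_flow_average_le (d := d) hpp.lt hm hδ hδ1 h
    (k := fun η => ‖K₂ η.1 * gauss η.2‖ₑ) ((hK₂m.comp measurable_fst).mul (hg0.measurable.comp measurable_snd)).enorm
    (lintegral_kernel_rpow_ne_top hK₂ hK₂b hr)
  -- This application to `f` itself serves only to handle large times; its constant does not enter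
  -- the final bound.
  obtain ⟨C₃, hC₃, H₃⟩ := exists_lintegral_flow_average_le (d := d) hpp.lt hm hδ hδ1 h
    (k := fun η => ‖gauss η.1 * gauss η.2‖ₑ) (by fun_prop)
    (lintegral_kernel_rpow_ne_top integrable_gauss
      ⟨1, fun h => by rw [abs_of_pos (gauss_pos h)]; exact gauss_le_one h⟩ hr)
  -- The value for which the cross terms cancel in `hasDerivAt_density`.
  set ν : ℝ := Real.sqrt (e * (e + 1)) with hνdef
  have hν : 0 < ν := Real.sqrt_pos.2 (by positivity)
  have hνe : ν ^ 2 = e * (e + 1) := Real.sq_sqrt (by positivity)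
  set c₁ : ℝ := ν ^ (d * δ') with hc₁
  set c₂ : ℝ := (2 * e + 1) / (2 * Real.pi) * ν ^ (d * δ) with hc₂
  have hc₁0 : 0 < c₁ := by positivity
  have hc₂0 : 0 < c₂ := by positivity
  refine ⟨ENNReal.ofReal c₁ * C₁ + ENNReal.ofReal c₂ * C₂, by finiteness, ?_⟩
  intro f g S hf hfp hg hS hSp hfg hfS κ hκ ψ hψ
  have hβ : ∀ s : ℝ, 0 < s → 0 < κ * s ^ e := fun s hs => by positivity
  have hμ : ∀ s : ℝ, 0 < s → 0 < κ / ν * s ^ (e + 1) := fun s hs => by positivity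
  have hψe : Measurable fun z => ‖ψ z‖ₑ := hψ.continuous.measurable.enorm
  have G₁ := H₁ (fun z => ‖S z‖ₑ) (fun z => ‖ψ z‖ₑ) hS.enorm hψe (fun s => κ * s ^ e)
    (fun s => (e + 1) / ν * (κ * s ^ e)) (fun s => κ / ν * s ^ (e + 1)) hβ hμ
  have G₂ := H₂ (fun z => ‖g z‖ₑ) (fun z => ‖ψ z‖ₑ) hg.enorm hψe (fun s => κ * s ^ e)
    (fun s => (e + 1) / ν * (κ * s ^ e)) (fun s => κ / ν * s ^ (e + 1)) hβ hμ
  have G₃ := H₃ (fun z => ‖f z‖ₑ) (fun z => ‖ψ z‖ₑ) hf.measurable.enorm hψe (fun s => κ * s ^ e)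
    (fun s => (e + 1) / ν * (κ * s ^ e)) (fun s => κ / ν * s ^ (e + 1)) hβ hμ
  rw [← eLpNorm_ofReal_eq hpp.symm.pos, ← eLpNorm_ofReal_eq (by linarith : 0 < m)] at G₁
  rw [← eLpNorm_ofReal_eq hpp.pos, ← eLpNorm_ofReal_eq (by linarith : 0 < m)] at G₂ G₃
  set N := eLpNorm ψ (ENNReal.ofReal m) volume with hN
  have hNT : N ≠ ⊤ := (hψ.memLp _).2.ne
  set B₁ : ℝ≥0∞ := ENNReal.ofReal (c₁ * κ ^ (-(σ + 2 * d * δ'))) *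
    (C₁ * eLpNorm S (ENNReal.ofReal p') volume * N) with hB₁
  set B₂ : ℝ≥0∞ := ENNReal.ofReal (c₂ * κ ^ (σ - 2 * d * δ)) *
    (C₂ * eLpNorm g (ENNReal.ofReal p) volume * N) with hB₂
  have hsub : ∀ ε T : ℝ, 0 < ε → ε ≤ T →
      ‖gaussAverage κ e ν f ψ T - gaussAverage κ e ν f ψ ε‖ₑ ≤ B₁ + B₂ := by
    intro ε T hε hεT
    rw [gaussAverage_sub he hκ hν hνe hε hεT hpp hf hfp hψ]
    refine (enorm_add_le _ _).trans (add_le_add ?_ ?_)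
    · refine (enorm_integral_le_lintegral_enorm _).trans ?_
      calc _ ≤ ∫⁻ s in Ioc ε T, ENNReal.ofReal (c₁ * κ ^ (-(σ + 2 * d * δ'))) *
            (ENNReal.ofReal (s ^ (δ' - 1) * ((κ * s ^ e * (κ / ν * s ^ (e + 1))) ^ d) ^ δ') *
            ∫⁻ η : Space d × Space d, ‖K₁ η.1 * gauss η.2‖ₑ * ∫⁻ z, ‖S z‖ₑ *
              ‖ψ (flow s (scaledDisplacement κ e ν s η) z)‖ₑ) := by
            refine setLIntegral_mono' measurableSet_Ioc fun s hs => ?_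
            have hs0 : 0 < s := hε.trans hs.1
            rw [integral_gauss_mul_flowAverageDeriv hσ0 hσ1 hκ hs0 hpp hS hSp hψ hfS hK₁ hK₁F,
              enorm_neg, enorm_mul, scale_rpow_neg_eq hκ hν hs0 d hs', ← hc₁,
              Real.enorm_of_nonneg (by positivity), ENNReal.ofReal_mul (by positivity), mul_assoc]
            exact mul_le_mul' le_rfl (mul_le_mul' le_rfl (enorm_integral_kernel_le _ _ _ _))
        _ ≤ ∫⁻ s in Ioi (0 : ℝ), ENNReal.ofReal (c₁ * κ ^ (-(σ + 2 * d * δ'))) *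
            (ENNReal.ofReal (s ^ (δ' - 1) * ((κ * s ^ e * (κ / ν * s ^ (e + 1))) ^ d) ^ δ') *
            ∫⁻ η : Space d × Space d, ‖K₁ η.1 * gauss η.2‖ₑ * ∫⁻ z, ‖S z‖ₑ *
              ‖ψ (flow s (scaledDisplacement κ e ν s η) z)‖ₑ) :=
            lintegral_mono_set fun s hs => hε.trans hs.1
        _ ≤ _ := by
            rw [lintegral_const_mul' _ _ ENNReal.ofReal_ne_top]
            exact mul_le_mul' le_rfl G₁
    · refine (enorm_integral_le_lintegral_enorm _).trans ?_
      calc _ ≤ ∫⁻ s in Ioc ε T, ENNReal.ofReal (c₂ * κ ^ (σ - 2 * d * δ)) *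
            (ENNReal.ofReal (s ^ (δ - 1) * ((κ * s ^ e * (κ / ν * s ^ (e + 1))) ^ d) ^ δ) *
            ∫⁻ η : Space d × Space d, ‖K₂ η.1 * gauss η.2‖ₑ * ∫⁻ z, ‖g z‖ₑ *
              ‖ψ (flow s (scaledDisplacement κ e ν s η) z)‖ₑ) := by
            refine setLIntegral_mono' measurableSet_Ioc fun s hs => ?_
            have hs0 : 0 < s := hε.trans hs.1
            rw [integral_gaussLap_mul_flowAverage hσ0 hσ1 hκ hs0 hpp hf.measurable hfp hψ hfg hK₂
              hK₂F, mul_neg, enorm_neg, ← mul_assoc, enorm_mul]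
            have e1 : (2 * e + 1) / s * ((κ * s ^ e) ^ σ / (2 * Real.pi)) =
                c₂ * κ ^ (σ - 2 * d * δ) *
                (s ^ (δ - 1) * ((κ * s ^ e * (κ / ν * s ^ (e + 1))) ^ d) ^ δ) := by
              have := scale_rpow_pos_eq hκ hν hs0 d ‹e * σ = _›
              calc _ = (2 * e + 1) / (2 * Real.pi) * (s⁻¹ * (κ * s ^ e) ^ σ) := by
                    field_simp
                _ = _ := by rw [this, hc₂]; ring
            rw [e1, Real.enorm_of_nonneg (by positivity), ENNReal.ofReal_mul (by positivity),
              mul_assoc]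
            exact mul_le_mul' le_rfl (mul_le_mul' le_rfl (enorm_integral_kernel_le _ _ _ _))
        _ ≤ ∫⁻ s in Ioi (0 : ℝ), ENNReal.ofReal (c₂ * κ ^ (σ - 2 * d * δ)) *
            (ENNReal.ofReal (s ^ (δ - 1) * ((κ * s ^ e * (κ / ν * s ^ (e + 1))) ^ d) ^ δ) *
            ∫⁻ η : Space d × Space d, ‖K₂ η.1 * gauss η.2‖ₑ * ∫⁻ z, ‖g z‖ₑ *
              ‖ψ (flow s (scaledDisplacement κ e ν s η) z)‖ₑ) :=
            lintegral_mono_set fun s hs => hε.trans hs.1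
        _ ≤ _ := by
            rw [lintegral_const_mul' _ _ ENNReal.ofReal_ne_top]
            exact mul_le_mul' le_rfl G₂
  have hlim : ∀ T : ℝ, 0 < T → ‖gaussAverage κ e ν f ψ T - ∫ z, f z * ψ z‖ₑ ≤ B₁ + B₂ := by
    intro T hT
    have h1 := (tendsto_const_nhds (x := gaussAverage κ e ν f ψ T)).sub
      (tendsto_gaussAverage (κ := κ) (ν := ν) he hpp hf hfp hψ)
    refine le_of_tendsto h1.enorm ?_
    filter_upwards [Ioc_mem_nhdsGT hT] with ε hε
    exact hsub ε T hε.1 hε.2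
  have hmain : ‖∫ z, f z * ψ z‖ₑ ≤ B₁ + B₂ := by
    -- No limit at infinity is computed. If the bound failed, `|gaussAverage|` would be at least `c
    -- > 0` at every positive time. By `G₃` it is integrable against a multiple of `s^(eσ-1)`, which
    -- has infinite integral on `(1, ∞)`.
    by_contra hcon
    rw [not_le] at hcon
    set c := ‖∫ z, f z * ψ z‖ₑ - (B₁ + B₂) with hc
    have hc0 : 0 < c := tsub_pos_of_lt hcon
    have hlow : ∀ T : ℝ, 0 < T → c ≤ ‖gaussAverage κ e ν f ψ T‖ₑ := by
      intro T hT
      rw [hc, tsub_le_iff_right]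
      calc _ = ‖gaussAverage κ e ν f ψ T - (gaussAverage κ e ν f ψ T - ∫ z, f z * ψ z)‖ₑ := by
            rw [sub_sub_cancel]
        _ ≤ ‖gaussAverage κ e ν f ψ T‖ₑ + ‖gaussAverage κ e ν f ψ T - ∫ z, f z * ψ z‖ₑ :=
            enorm_sub_le
        _ ≤ _ := by gcongr; exact hlim T hT
    have hfin : C₃ * eLpNorm f (ENNReal.ofReal p) volume * N ≠ ⊤ :=
      ENNReal.mul_ne_top (ENNReal.mul_ne_top hC₃ hfp.2.ne) hNT
    set w : ℝ := κ ^ (2 * d * δ) / ν ^ (d * δ) with hw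
    have hw0 : 0 < w := by positivity
    have hnot : ∫⁻ s in Ioi (1 : ℝ), ENNReal.ofReal (s ^ (e * σ - 1)) = ⊤ := by
      by_contra htop
      have h1 : IntegrableOn (fun s : ℝ => s ^ (e * σ - 1)) (Ioi 1) := by
        refine ⟨by fun_prop, ?_⟩
        rw [hasFiniteIntegral_iff_ofReal]
        · exact lt_top_iff_ne_top.2 htop
        · filter_upwards [ae_restrict_mem measurableSet_Ioi] with s hs
          exact Real.rpow_nonneg (zero_le_one.trans (le_of_lt hs)) _
      rw [integrableOn_Ioi_rpow_iff one_pos] at h1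
      have := mul_pos he hσ0
      linarith
    refine hfin (top_le_iff.1 (le_trans ?_ G₃))
    calc ⊤ = ENNReal.ofReal w * c * ∫⁻ s in Ioi (1 : ℝ), ENNReal.ofReal (s ^ (e * σ - 1)) := by
          rw [hnot, ENNReal.mul_top]
          exact mul_ne_zero (by simpa using hw0) hc0.ne'
      _ ≤ ∫⁻ s in Ioi (1 : ℝ), ENNReal.ofReal w * c * ENNReal.ofReal (s ^ (e * σ - 1)) :=
          lintegral_const_mul_le _ _
      _ ≤ ∫⁻ s in Ioi (1 : ℝ), ENNReal.ofReal (s ^ (δ - 1) *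
          ((κ * s ^ e * (κ / ν * s ^ (e + 1))) ^ d) ^ δ) *
          ∫⁻ η : Space d × Space d, ‖gauss η.1 * gauss η.2‖ₑ * ∫⁻ z, ‖f z‖ₑ *
            ‖ψ (flow s (scaledDisplacement κ e ν s η) z)‖ₑ := by
          refine setLIntegral_mono' measurableSet_Ioi fun s hs1 => ?_
          have hs0 : 0 < s := zero_lt_one.trans hs1
          rw [scale_rpow_eq hκ hν hs0, ← hw, ← hs, ENNReal.ofReal_mul hw0.le, mul_right_comm]
          gcongr
          exact (hlow s hs0).trans (enorm_integral_kernel_le _ _ _ _)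
      _ ≤ _ := lintegral_mono_set (Ioi_subset_Ioi zero_le_one)
  refine hmain.trans ?_
  rw [hB₁, hB₂, ENNReal.ofReal_mul hc₁0.le, ENNReal.ofReal_mul hc₂0.le, mul_add, add_mul]
  refine add_le_add ?_ ?_
  · calc _ = (ENNReal.ofReal c₁ * C₁) * (ENNReal.ofReal (κ ^ (-(σ + 2 * d * δ'))) *
          eLpNorm S (ENNReal.ofReal p') volume) * N := by ring
      _ ≤ _ := by gcongr; exact le_self_add
  · calc _ = (ENNReal.ofReal c₂ * C₂) * (ENNReal.ofReal (κ ^ (σ - 2 * d * δ)) *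
          eLpNorm g (ENNReal.ofReal p) volume) * N := by ring
      _ ≤ _ := by gcongr; exact le_add_self

end Duality

/-! ### Converse of Hölder's inequality and optimisation of the scale. -/

section Conclusion

variable {d : ℕ} {f : Phase d → ℝ}

/-- A bound on the pairing with test functions extends to continuous functions with compact
support. -/
lemma enorm_integral_mul_le_of_forall_isTest (hf : Continuous f) {m : ℝ} (hm : 1 ≤ m) {M : ℝ≥0∞}
    (hM : M ≠ ⊤) (H : ∀ ψ : Phase d → ℝ, IsTest ψ → ‖∫ z, f z * ψ z‖ₑ ≤
      M * eLpNorm ψ (ENNReal.ofReal m) volume) {h : Phase d → ℝ} (hh : Continuous h)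
    (hc : HasCompactSupport h) :
    ‖∫ z, f z * h z‖ₑ ≤ M * eLpNorm h (ENNReal.ofReal m) volume := by
  have hK : IsCompact (tsupport h) := hc.isCompact
  set b : ℝ≥0∞ := volume (tsupport h) ^ (1 / (ENNReal.ofReal m).toReal) with hb
  have hbT : b ≠ ⊤ := ENNReal.rpow_ne_top_of_nonneg (by positivity) hK.measure_lt_top.ne
  have hint : IntegrableOn f (tsupport h) := hf.continuousOn.integrableOn_compact hK
  set a : ℝ≥0∞ := ∫⁻ z in tsupport h, ‖f z‖ₑ with ha
  have haT : a ≠ ⊤ := hint.2.ne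
  have key : ∀ ε : ℝ, 0 < ε → ‖∫ z, f z * h z‖ₑ ≤
      M * (eLpNorm h (ENNReal.ofReal m) volume + ENNReal.ofReal ε * b) + ENNReal.ofReal ε * a := by
    intro ε hε
    -- The approximant is supported inside the support of `h`, so a uniform error `ε` costs at most
    -- `ε b` in the `L^m` norm and `ε a` in the pairing.
    obtain ⟨ψ, hψ1, hψ2, hψ3⟩ := hh.exists_contDiff_approx ⊤ (ε := fun _ => ε) (by fun_prop)
      (fun _ => hε)
    have hψ : IsTest ψ := ⟨hψ1, hc.mono hψ3⟩
    have hdist : ∀ z, dist (h z) (ψ z) ≤ ε := fun z => by rw [dist_comm]; exact (hψ2 z).le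
    have i1 : Integrable fun z => f z * h z :=
      (hf.mul hh).integrable_of_hasCompactSupport hc.mul_left
    have i2 : Integrable fun z => f z * ψ z :=
      (hf.mul hψ.continuous).integrable_of_hasCompactSupport hψ.2.mul_left
    have e1 : eLpNorm (ψ - h) (ENNReal.ofReal m) volume ≤ ENNReal.ofReal ε * b := by
      rw [eLpNorm_sub_comm]
      exact eLpNorm_sub_le_of_dist_bdd volume ENNReal.ofReal_ne_top hc.measurableSet hε.le
        hdist (subset_tsupport h) (hψ3.trans (subset_tsupport h))
    have e2 : eLpNorm ψ (ENNReal.ofReal m) volume ≤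
        eLpNorm h (ENNReal.ofReal m) volume + ENNReal.ofReal ε * b := by
      calc _ = eLpNorm (h + (ψ - h)) (ENNReal.ofReal m) volume := by rw [add_sub_cancel]
        _ ≤ _ := (eLpNorm_add_le hh.aestronglyMeasurable
          (hψ.continuous.sub hh).aestronglyMeasurable (by simpa using hm)).trans (by gcongr)
    have e3 : ‖∫ z, f z * (h z - ψ z)‖ₑ ≤ ENNReal.ofReal ε * a := by
      refine (enorm_integral_le_lintegral_enorm _).trans ?_
      rw [ha, ← lintegral_const_mul' _ _ ENNReal.ofReal_ne_top,
        ← lintegral_indicator hc.measurableSet]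
      refine lintegral_mono fun z => ?_
      by_cases hz : z ∈ tsupport h
      · rw [indicator_of_mem hz, enorm_mul, mul_comm]
        gcongr
        rw [← ofReal_norm, ← dist_eq_norm]
        exact ENNReal.ofReal_le_ofReal (hdist z)
      · have h1 : h z = 0 := image_eq_zero_of_notMem_tsupport hz
        have h2 : ψ z = 0 := by
          by_contra hne
          exact hz (subset_tsupport h (hψ3 hne))
        simp [h1, h2]
    calc ‖∫ z, f z * h z‖ₑ = ‖(∫ z, f z * ψ z) + ∫ z, f z * (h z - ψ z)‖ₑ := by
          simp_rw [mul_sub]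
          rw [integral_sub i1 i2, add_sub_cancel]
      _ ≤ ‖∫ z, f z * ψ z‖ₑ + ‖∫ z, f z * (h z - ψ z)‖ₑ := enorm_add_le _ _
      _ ≤ _ := add_le_add ((H ψ hψ).trans (by gcongr)) e3
  have hε : Filter.Tendsto (fun ε : ℝ => ENNReal.ofReal ε) (nhdsWithin 0 (Ioi 0)) (nhds 0) := by
    have := (ENNReal.continuous_ofReal.tendsto 0).mono_left (nhdsWithin_le_nhds (s := Ioi 0))
    rwa [ENNReal.ofReal_zero] at this
  have t1 : Filter.Tendsto (fun ε : ℝ => M * (eLpNorm h (ENNReal.ofReal m) volume +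
      ENNReal.ofReal ε * b) + ENNReal.ofReal ε * a) (nhdsWithin 0 (Ioi 0))
      (nhds (M * (eLpNorm h (ENNReal.ofReal m) volume + 0 * b) + 0 * a)) :=
    (ENNReal.Tendsto.const_mul (tendsto_const_nhds.add
      (ENNReal.Tendsto.mul_const hε (Or.inr hbT))) (Or.inr hM)).add
      (ENNReal.Tendsto.mul_const hε (Or.inr haT))
  rw [zero_mul, zero_mul, add_zero, add_zero] at t1
  refine ge_of_tendsto t1 ?_
  filter_upwards [self_mem_nhdsWithin] with ε hε
  exact key ε hε

/-- The converse of Hölder's inequality for continuous functions, tested on smooth functions with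
compact support. -/
lemma eLpNorm_le_of_forall_isTest (hf : Continuous f) {q m : ℝ} (hq : 2 ≤ q)
    (hqm : q.HolderConjugate m) {M : ℝ≥0∞} (hM : M ≠ ⊤)
    (H : ∀ ψ : Phase d → ℝ, IsTest ψ → ‖∫ z, f z * ψ z‖ₑ ≤
      M * eLpNorm ψ (ENNReal.ofReal m) volume) :
    eLpNorm f (ENNReal.ofReal q) volume ≤ M := by
  have hm := hqm.symm.lt
  have hball : ∀ n : ℕ, ∫⁻ z in Metric.closedBall (0 : Phase d) n, ‖f z‖ₑ ^ q ≤ M ^ q := by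
    intro n
    set χ : Phase d → ℝ := fun z => max 0 (min 1 (n + 1 - ‖z‖)) with hχ
    have hχc : Continuous χ := by fun_prop
    have hχ0 : ∀ z, 0 ≤ χ z := fun z => le_max_left _ _
    have hχ1 : ∀ z, χ z ≤ 1 := fun z => max_le zero_le_one (min_le_left _ _)
    have hχs : HasCompactSupport χ := by
      refine HasCompactSupport.intro (isCompact_closedBall (0 : Phase d) (n + 1)) fun z hz => ?_
      rw [mem_closedBall_zero_iff, not_le] at hz
      rw [hχ]
      exact max_eq_left ((min_le_right _ _).trans (by linarith))
    have hχb : ∀ z ∈ Metric.closedBall (0 : Phase d) n, χ z = 1 := by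
      intro z hz
      rw [mem_closedBall_zero_iff] at hz
      simp only [hχ]
      rw [min_eq_left (by linarith), max_eq_right zero_le_one]
    -- The extremiser of Hölder's inequality, cut off. The assumption `2 ≤ q` makes it continuous at
    -- the zeros of `f`.
    set h : Phase d → ℝ := fun z => |f z| ^ (q - 2) * f z * χ z with hh
    have hhc : Continuous h :=
      ((hf.abs.rpow_const fun z => Or.inr (by linarith)).mul hf).mul hχc
    have hhs : HasCompactSupport h := hχs.mul_left
    have hprod : ∀ z, f z * h z = |f z| ^ q * χ z := by
      intro z
      rcases eq_or_ne (f z) 0 with h0 | h0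
      · simp [hh, h0, Real.zero_rpow (by linarith : q ≠ 0)]
      · have h1 : 0 < |f z| := abs_pos.2 h0
        have h2 : |f z| ^ q = |f z| ^ (q - 2) * (f z * f z) := by
          rw [← abs_mul_abs_self (f z), ← sq, ← Real.rpow_natCast |f z| 2, ← Real.rpow_add h1]
          congr 1
          push_cast
          ring
        rw [h2]
        simp only [hh]
        ring
    set I : ℝ≥0∞ := ∫⁻ z, ENNReal.ofReal (|f z| ^ q * χ z) with hI
    have hIc : Continuous fun z => |f z| ^ q * χ z :=
      (hf.abs.rpow_const fun z => Or.inr (by linarith)).mul hχc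
    have hIi : Integrable fun z => |f z| ^ q * χ z :=
      hIc.integrable_of_hasCompactSupport hχs.mul_left
    have hI0 : ∀ z, 0 ≤ |f z| ^ q * χ z := fun z => mul_nonneg (by positivity) (hχ0 z)
    -- The cutoff gives this finiteness, which allows division by `I ^ (1 / m)`; finiteness of the
    -- `L^q` norm of `f` is not presupposed.
    have hIT : I ≠ ⊤ := hIi.lintegral_lt_top.ne
    have e1 : ‖∫ z, f z * h z‖ₑ = I := by
      simp_rw [hprod]
      rw [Real.enorm_of_nonneg (integral_nonneg hI0), ofReal_integral_eq_lintegral_ofReal hIi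
        (Filter.Eventually.of_forall hI0)]
    have e2 : eLpNorm h (ENNReal.ofReal m) volume ≤ I ^ (1 / m) := by
      rw [eLpNorm_ofReal_eq hqm.symm.pos]
      refine ENNReal.rpow_le_rpow (lintegral_mono fun z => ?_) (by have := hqm.symm.pos; positivity)
      simp only
      rw [Real.enorm_eq_ofReal_abs, ENNReal.ofReal_rpow_of_nonneg (abs_nonneg _) hqm.symm.nonneg]
      refine ENNReal.ofReal_le_ofReal ?_
      have h1 : |h z| = |f z| ^ (q - 1) * χ z := by
        simp only [hh]
        rw [abs_mul, abs_mul, abs_of_nonneg (hχ0 z), abs_of_nonneg (by positivity)]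
        rcases eq_or_ne (f z) 0 with h0 | h0
        · simp [h0, Real.zero_rpow (by linarith : q - 1 ≠ 0)]
        · rw [← Real.rpow_add_one (abs_pos.2 h0).ne']
          congr 2
          ring
      rw [h1, Real.mul_rpow (by positivity) (hχ0 z), ← Real.rpow_mul (abs_nonneg _),
        hqm.sub_one_mul_conj]
      gcongr
      exact Real.rpow_le_self_of_le_one (hχ0 z) (hχ1 z) hm.le
    have e3 : I ≤ M * I ^ (1 / m) := by
      rw [← e1]
      refine (enorm_integral_mul_le_of_forall_isTest hf hm.le hM H hhc hhs).trans ?_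
      rw [e1]
      gcongr
    have e4 : I ≤ M ^ q := by
      rcases eq_or_ne I 0 with h0 | h0
      · rw [h0]; exact zero_le
      have h1 : I = I ^ (1 / q) * I ^ (1 / m) := by
        rw [← ENNReal.rpow_add _ _ h0 hIT, one_div, one_div, hqm.inv_add_inv_eq_one,
          ENNReal.rpow_one]
      have h2 : I ^ (1 / m) ≠ 0 := by
        simp [ENNReal.rpow_eq_zero_iff, h0, hIT]
      have h3 : I ^ (1 / m) ≠ ⊤ := ENNReal.rpow_ne_top_of_nonneg
        (by have := hqm.symm.pos; positivity) hIT
      have h4 : I ^ (1 / q) ≤ M := by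
        have h5 : I ^ (1 / q) * I ^ (1 / m) ≤ M * I ^ (1 / m) := by rw [← h1]; exact e3
        exact (ENNReal.mul_le_mul_iff_left h2 h3).1 h5
      calc I = (I ^ (1 / q)) ^ q := by
            rw [← ENNReal.rpow_mul, one_div_mul_cancel hqm.ne_zero, ENNReal.rpow_one]
        _ ≤ _ := ENNReal.rpow_le_rpow h4 hqm.nonneg
    refine le_trans ?_ e4
    rw [hI, ← lintegral_indicator Metric.isClosed_closedBall.measurableSet]
    refine lintegral_mono fun z => ?_
    by_cases hz : z ∈ Metric.closedBall (0 : Phase d) n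
    · rw [indicator_of_mem hz, hχb z hz, mul_one, Real.enorm_eq_ofReal_abs,
        ENNReal.ofReal_rpow_of_nonneg (abs_nonneg _) hqm.nonneg]
    · rw [indicator_of_notMem hz]; exact zero_le
  have hfin : ∫⁻ z, ‖f z‖ₑ ^ q ≤ M ^ q := by
    have h1 : ⋃ n : ℕ, Metric.closedBall (0 : Phase d) n = univ := Metric.iUnion_closedBall_nat 0
    rw [← setLIntegral_univ, ← h1, setLIntegral_iUnion_of_directed]
    · exact iSup_le hball
    · exact directed_of_isDirected_le fun a b hab =>
        Metric.closedBall_subset_closedBall (Nat.cast_le.2 hab)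
  rw [eLpNorm_ofReal_eq hqm.pos]
  calc _ ≤ (M ^ q) ^ (1 / q) := ENNReal.rpow_le_rpow hfin (by have := hqm.pos; positivity)
    _ = M := by rw [← ENNReal.rpow_mul, mul_one_div_cancel hqm.ne_zero, ENNReal.rpow_one]

/-- Optimisation of a two-term bound in its scaling parameter. -/
lemma le_mul_rpow_of_forall_scale {A B : ℝ} (hA : 0 < A) (hB : 0 < B) {N C G S : ℝ≥0∞}
    (hC : C ≠ ⊤) (hG : G ≠ ⊤) (hS : S ≠ ⊤)
    (H : ∀ κ : ℝ, 0 < κ → N ≤ C * (ENNReal.ofReal (κ ^ (-A)) * S + ENNReal.ofReal (κ ^ B) * G)) :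
    N ≤ ENNReal.ofReal (2 * C.toReal + 1) * G ^ (A / (A + B)) * S ^ (B / (A + B)) := by
  have hAB : 0 < A + B := by positivity
  -- At `κ = (y/x)^(1/(A+B))` the two terms coincide, hence the factor `2`. Adding `ε` to both norms
  -- keeps this choice legitimate when one of them is zero, and the `+ 1` keeps the constant
  -- positive.
  have key : ∀ ε : ℝ, 0 < ε → N ≤ ENNReal.ofReal ((2 * C.toReal + 1) *
      (G.toReal + ε) ^ (A / (A + B)) * (S.toReal + ε) ^ (B / (A + B))) := by
    intro ε hε
    set x : ℝ := G.toReal + ε with hx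
    set y : ℝ := S.toReal + ε with hy
    have hx0 : 0 < x := by positivity
    have hy0 : 0 < y := by positivity
    have hκ : 0 < (y / x) ^ (1 / (A + B)) := by positivity
    have hxy : y / x * x = y := by field_simp
    have e1 : ((y / x) ^ (1 / (A + B))) ^ (-A) * y = x ^ (A / (A + B)) * y ^ (B / (A + B)) := by
      rw [← Real.rpow_mul (by positivity), Real.div_rpow hy0.le hx0.le,
        show 1 / (A + B) * -A = -(A / (A + B)) by ring, Real.rpow_neg hx0.le, div_inv_eq_mul,
        show B / (A + B) = -(A / (A + B)) + 1 by field_simp; ring, Real.rpow_add_one hy0.ne']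
      ring
    have e2 : ((y / x) ^ (1 / (A + B))) ^ B * x = x ^ (A / (A + B)) * y ^ (B / (A + B)) := by
      rw [← Real.rpow_mul (by positivity), Real.div_rpow hy0.le hx0.le,
        show 1 / (A + B) * B = B / (A + B) by ring,
        show A / (A + B) = 1 - B / (A + B) by field_simp; ring, Real.rpow_sub hx0, Real.rpow_one]
      ring
    have hGx : G ≤ ENNReal.ofReal x := by
      rw [← ENNReal.ofReal_toReal hG]; exact ENNReal.ofReal_le_ofReal (by linarith)
    have hSy : S ≤ ENNReal.ofReal y := by
      rw [← ENNReal.ofReal_toReal hS]; exact ENNReal.ofReal_le_ofReal (by linarith)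
    calc N ≤ C * (ENNReal.ofReal (((y / x) ^ (1 / (A + B))) ^ (-A)) * ENNReal.ofReal y +
          ENNReal.ofReal (((y / x) ^ (1 / (A + B))) ^ B) * ENNReal.ofReal x) :=
          (H _ hκ).trans (by gcongr)
      _ = ENNReal.ofReal (C.toReal * (2 * (x ^ (A / (A + B)) * y ^ (B / (A + B))))) := by
          rw [← ENNReal.ofReal_mul (by positivity), ← ENNReal.ofReal_mul (by positivity), e1, e2,
            ← ENNReal.ofReal_add (by positivity) (by positivity), ← two_mul,
            ENNReal.ofReal_mul ENNReal.toReal_nonneg, ENNReal.ofReal_toReal hC]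
      _ ≤ _ := by
          refine ENNReal.ofReal_le_ofReal ?_
          have : 0 ≤ x ^ (A / (A + B)) * y ^ (B / (A + B)) := by positivity
          nlinarith
  have hc : Continuous fun ε : ℝ => ENNReal.ofReal ((2 * C.toReal + 1) *
      (G.toReal + ε) ^ (A / (A + B)) * (S.toReal + ε) ^ (B / (A + B))) := by
    refine ENNReal.continuous_ofReal.comp ((continuous_const.mul ?_).mul ?_)
    · exact (continuous_const.add continuous_id).rpow_const fun _ => Or.inr (by positivity)
    · exact (continuous_const.add continuous_id).rpow_const fun _ => Or.inr (by positivity)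
  have h1 := (hc.tendsto 0).mono_left (nhdsWithin_le_nhds (s := Ioi 0))
  have h2 : N ≤ ENNReal.ofReal ((2 * C.toReal + 1) *
      (G.toReal + 0) ^ (A / (A + B)) * (S.toReal + 0) ^ (B / (A + B))) := by
    refine ge_of_tendsto h1 ?_
    filter_upwards [self_mem_nhdsWithin] with ε hε
    exact key ε hε
  refine h2.trans (le_of_eq ?_)
  have hA' : 0 ≤ A / (A + B) := by positivity
  have hB' : 0 ≤ B / (A + B) := by positivity
  rw [add_zero, add_zero, ENNReal.ofReal_mul (by positivity), ENNReal.ofReal_mul (by positivity),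
    ← ENNReal.ofReal_rpow_of_nonneg ENNReal.toReal_nonneg hA',
    ← ENNReal.ofReal_rpow_of_nonneg ENNReal.toReal_nonneg hB', ENNReal.ofReal_toReal hG,
    ENNReal.ofReal_toReal hS]

end Conclusion

end KineticBessel

/-! ### The algebra of the exponents and the main theorem. -/

theorem theorem1p3 (d : ℕ) (hd : 1 ≤ d) (σ p q : ℝ) (hσ0 : 0 < σ) (hσ1 : σ < 1)
    (hp_lower : 2 - 2 * σ / (2 * d + d * σ + 2 * σ) < p) (hp_upper : p < 2 + 2 / (d : ℝ))
    (hq : q = 2 * p * (d * σ + d + σ) / (d * (p * σ + 2))) :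
    ∃ C : ℝ, 0 < C ∧
      ∀ f g S : KineticBessel.Phase d → ℝ,
        ContDiff ℝ 1 f →
        MeasureTheory.MemLp f (ENNReal.ofReal p) MeasureTheory.volume →
        MeasureTheory.MemLp g (ENNReal.ofReal p) MeasureTheory.volume →
        MeasureTheory.MemLp S (ENNReal.ofReal (p / (p - 1))) MeasureTheory.volume →
        KineticBessel.HasVelDeriv σ f g →
        KineticBessel.SolvesKinetic σ f S →
        MeasureTheory.eLpNorm f (ENNReal.ofReal q) MeasureTheory.volume ≤
          ENNReal.ofReal C
            * MeasureTheory.eLpNorm g (ENNReal.ofReal p) MeasureTheory.volume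
                ^ ((d * σ + 2 * d + σ) / (2 * (d * σ + d + σ)))
            * MeasureTheory.eLpNorm S (ENNReal.ofReal (p / (p - 1))) MeasureTheory.volume
                ^ (σ * (d + 1) / (2 * (d * σ + d + σ))) := by
  have hd1 : (1 : ℝ) ≤ d := by exact_mod_cast hd
  have hd0 : (0 : ℝ) < d := by linarith
  have hD : 0 < 2 * d + d * σ + 2 * σ := by positivity
  have hlow : 2 * d * σ + 4 * d + 2 * σ < p * (2 * d + d * σ + 2 * σ) := by
    have h1 : 2 * σ / (2 * d + d * σ + 2 * σ) * (2 * d + d * σ + 2 * σ) = 2 * σ := by field_simp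
    nlinarith
  have hupp : p * d < 2 * d + 2 := by
    have h1 : 2 / (d : ℝ) * d = 2 := by field_simp
    nlinarith
  have hp1 : 1 < p := by nlinarith [mul_pos hd0 hσ0]
  have hp0 : 0 < p := by linarith
  have hK : 0 < d * σ + d + σ := by positivity
  set K := d * σ + d + σ with hKdef
  have hpp : p.HolderConjugate (p / (p - 1)) := Real.HolderConjugate.conjExponent hp1
  have hq0 : 0 < q := by rw [hq]; positivity
  have hqi : 1 / q = d * (p * σ + 2) / (2 * p * K) := by rw [hq, one_div_div]
  have hp'i : 1 / (p / (p - 1)) = 1 - 1 / p := by field_simp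
  -- A consequence of the lower bound on `p`; it makes the exponent of `κ` in front of `g` positive,
  -- as optimisation in `κ` requires.
  have hX : 0 < p * (σ + d) - 2 * d := by
    nlinarith [mul_pos hd0 hσ0]
  -- The orders of the two fractional integrals in time: `δ > 0` is the upper bound on `p`, and `δ'
  -- > 0` is the lower one.
  set δ := 1 / p - 1 / q with hδdef
  set δ' := 1 / (p / (p - 1)) - 1 / q with hδ'def
  have hδe : δ = σ * (2 * d + 2 - p * d) / (2 * p * K) := by
    rw [hδdef, hqi, hKdef]; field_simp; ring
  have hδe' : δ' = (p * (2 * d + d * σ + 2 * σ) - (2 * d * σ + 4 * d + 2 * σ)) / (2 * p * K) := by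
    rw [hδ'def, hp'i, hqi, hKdef]; field_simp; ring
  have hδ : 0 < δ := by
    rw [hδe]
    have : 0 < 2 * d + 2 - p * d := by linarith
    positivity
  have hδ' : 0 < δ' := by rw [hδe']; exact div_pos (by linarith) (by positivity)
  have hq1 : 1 / q < 1 / p := by linarith
  have hip : 1 / p < 1 := by rw [div_lt_one hp0]; exact hp1
  have hip0 : 0 < 1 / p := by positivity
  have hiq0 : 0 < 1 / q := by positivity
  have hδ1 : δ < 1 := by linarith
  have hδ1' : δ' < 1 := by rw [hδ'def, hp'i]; linarith
  -- Adding `1/q < 1/p` and `1/q < 1 - 1/p`.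
  have hq2 : 2 ≤ q := by
    have h1 : 1 / q ≤ 1 / 2 := by linarith
    exact (one_div_le_one_div hq0 two_pos).1 h1
  have hqm : q.HolderConjugate (q / (q - 1)) := Real.HolderConjugate.conjExponent (by linarith)
  set m := q / (q - 1) with hm
  have hmi : 1 / m = 1 - 1 / q := by
    have : q - 1 ≠ 0 := by linarith
    rw [hm]; field_simp
  have hB : σ - 2 * d * δ = σ * (d + 1) * (p * (σ + d) - 2 * d) / (p * K) := by
    rw [hδe, hKdef]; field_simp; ring
  have hB0 : 0 < σ - 2 * d * δ := by rw [hB]; positivity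
  -- The solution of the exponent equation for `g`, which is linear in `e`. That it also solves the
  -- equation for `S`, in `hs'`, depends on the value of `q`.
  set e := (d + 1) * δ / (σ - 2 * d * δ) with he
  have he0 : 0 < e := by positivity
  have hes : e * (σ - 2 * d * δ) = (d + 1) * δ := div_mul_cancel₀ _ hB0.ne'
  have hs : e * σ = (d * (2 * e + 1) + 1) * δ := by linear_combination hes
  have hδδ : δ + δ' = (p * (σ + d) - 2 * d) / (p * K) := by
    rw [hδe, hδe', hKdef]; field_simp; ring
  have hs' : e * σ + (d * (2 * e + 1) + 1) * δ' = 1 := by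
    have h1 : (d * (2 * e + 1) + 1) * (σ - 2 * d * δ) = (d + 1) * σ := by
      linear_combination 2 * d * hes
    have h2 : (d + 1) * σ * (δ + δ') = σ - 2 * d * δ := by rw [hδδ, hB]; ring
    have h3 : (d * (2 * e + 1) + 1) * (δ + δ') * (σ - 2 * d * δ) = 1 * (σ - 2 * d * δ) := by
      linear_combination (δ + δ') * h1 + h2
    rw [hs]
    linear_combination mul_right_cancel₀ hB0.ne' h3
  have hA0 : 0 < σ + 2 * d * δ' := by positivity
  have hAB : σ + 2 * d * δ' + (σ - 2 * d * δ) = 2 * (p * (σ + d) - 2 * d) / p := by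
    rw [hδe', hδe, hKdef]; field_simp; ring
  -- Numerator and denominator share the factor `(p(σ+d) - 2d)/p`, which is why the final exponents
  -- do not depend on `p`.
  have hBθ : (σ - 2 * d * δ) / (σ + 2 * d * δ' + (σ - 2 * d * δ)) = σ * (d + 1) / (2 * K) := by
    rw [hAB, hB]
    generalize p * (σ + d) - 2 * d = Y at hX
    field_simp
  have hAθ : (σ + 2 * d * δ') / (σ + 2 * d * δ' + (σ - 2 * d * δ)) =
      (d * σ + 2 * d + σ) / (2 * K) := by
    have h1 : (σ + 2 * d * δ') / (σ + 2 * d * δ' + (σ - 2 * d * δ)) =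
        1 - (σ - 2 * d * δ) / (σ + 2 * d * δ' + (σ - 2 * d * δ)) := by
      have : σ + 2 * d * δ' + (σ - 2 * d * δ) ≠ 0 := by positivity
      field_simp
      ring
    rw [h1, hBθ, hKdef]; field_simp; ring
  obtain ⟨C, hC, H⟩ := KineticBessel.exists_enorm_integral_mul_le d hσ0 hσ1 hpp hqm.symm.lt hδ hδ1
    hδ' hδ1' (by rw [hmi, hδdef]; ring) (by rw [hmi, hδ'def]; ring) he0 hs hs'
  refine ⟨2 * C.toReal + 1, by positivity, fun f g S hf hfp hg hS hfg hfS => ?_⟩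
  -- `g` and `S` are only almost everywhere measurable; measurable representatives change neither
  -- the weak identities nor the norms.
  have hg' : KineticBessel.HasVelDeriv σ f (hg.1.mk g) := fun φ hφ => by
    rw [← hfg φ hφ]
    refine MeasureTheory.integral_congr_ae ?_
    filter_upwards [hg.1.ae_eq_mk] with z hz
    rw [hz]
  have hS' : KineticBessel.SolvesKinetic σ f (hS.1.mk S) := fun φ hφ => by
    rw [hfS φ hφ]
    refine MeasureTheory.integral_congr_ae ?_
    filter_upwards [hS.1.ae_eq_mk] with z hz
    rw [hz]
  have hSp := (MeasureTheory.memLp_congr_ae hS.1.ae_eq_mk).1 hS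
  have H1 := H f _ _ hf.continuous hfp hg.1.stronglyMeasurable_mk.measurable
    hS.1.stronglyMeasurable_mk.measurable hSp hg' hS'
  rw [← MeasureTheory.eLpNorm_congr_ae hg.1.ae_eq_mk,
    ← MeasureTheory.eLpNorm_congr_ae hS.1.ae_eq_mk] at H1
  rw [← hAθ, ← hBθ]
  refine KineticBessel.le_mul_rpow_of_forall_scale hA0 hB0 hC hg.2.ne hS.2.ne fun κ hκ => ?_
  have hgT := hg.2.ne
  have hST := hS.2.ne
  exact KineticBessel.eLpNorm_le_of_forall_isTest hf.continuous hq2 hqm (by finiteness)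
    fun ψ hψ => H1 κ hκ ψ hψ
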